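/- Let $n\ge 1$. For $0<\alpha\le 1$ let $\mathcal C_\alpha$ be the set of functions $\varphi$ on $\mathbb R^n$ with support in $\{|x|\le 1\}$, $\int_{\mathbb R^n}\varphi\,dx=0$ and $|\varphi(x)-\varphi(x')|\le|x-x'|^\alpha$ for all $x,x'\in\mathbb R^n$. Put $\varphi_t(x)=t^{-n}\varphi(x/t)$ and, for $f\in L^1_{\mathrm{loc}}(\mathbb R^n)$, $y\in\mathbb R^n$ and $t>0$, $$A_\alpha(f)(y,t)=\sup_{\varphi\in\mathcal C_\alpha}\Big|\int_{\mathbb R^n}\varphi_t(y-z)f(z)\,dz\Big|.$$ The intrinsic $g^*_\lambda$-function of $f$ is $$g^*_{\lambda,\alpha}(f)(x)=\left(\iint_{\mathbb R^n\times(0,\infty)}\Big(\frac{t}{t+|x-y|}\Big)^{\lambda n}\big(A_\alpha(f)(y,t)\big)^2\,\frac{dy\,dt}{t^{n+1}}\right)^{1/2}.$$ Let $\Phi$ be a positive increasing function on $(0,\infty)$. For $1\le p<\infty$ the generalized Morrey space $L^{p,\Phi}(\mathbb R^n)$ consists of all locally integrable functions $f$ on $\mathbb R^n$ for which there is a finite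 constant $C\ge 0$ with $$\int_{B(x_0,r)}|f(x)|^p\,dx\le C^p\,\Phi(r)\qquad\text{for all }x_0\in\mathbb R^n,\ r>0,$$ where $B(x_0,r)=\{x:|x-x_0|<r\}$; the norm $\|f\|_{L^{p,\Phi}}$ is the smallest such $C$. **Theorem.** Let $0<\alpha\le1$, $1<p<\infty$ and $\lambda>3$. Suppose that $\Phi$ satisfies the doubling condition $\Phi(2r)\le D\,\Phi(r)$ for all $r>0$, with a constant $D$ such that $1\le D<2^n$. Then there is a constant $C>0$ such that for every $f\in L^{p,\Phi}(\mathbb R^n)$ the function $g^*_{\lambda,\alpha}(f)$ belongs to $L^{p,\Phi}(\mathbb R^n)$ and $$\big\|g^*_{\lambda,\alpha}(f)\big\|_{L^{p,\Phi}}\le C\,\|f\|_{L^{p,\Phi}}.$$ -/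

import Mathlib

open MeasureTheory Set
open scoped ENNReal

noncomputable section

namespace IntrinsicSquare

/-- The Hölder class `𝒞_α` of kernels on `ℝⁿ`: supported in the closed unit ball, with mean
value zero, and `|φ(x) - φ(x')| ≤ |x - x'|^α` everywhere. (Such a `φ` is continuous with compact
support, hence integrable.) The scalars `𝕜` are `ℝ` or `ℂ`. -/
def kernelClass (𝕜 : Type*) [RCLike 𝕜] (n : ℕ) (α : ℝ) :
    Set (EuclideanSpace ℝ (Fin n) → 𝕜) :=
  {φ | Function.support φ ⊆ Metric.closedBall 0 1 ∧
    ∫ x, φ x = 0 ∧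
    ∀ x x', ‖φ x - φ x'‖ ≤ ‖x - x'‖ ^ α}

/-- The dilation `φ_t(x) = t⁻ⁿ φ(x / t)`. -/
def dilate {𝕜 : Type*} [RCLike 𝕜] {n : ℕ} (φ : EuclideanSpace ℝ (Fin n) → 𝕜) (t : ℝ)
    (x : EuclideanSpace ℝ (Fin n)) : 𝕜 :=
  (t ^ n)⁻¹ • φ (t⁻¹ • x)

/-- `A_α(f)(y,t) = sup_{φ ∈ 𝒞_α} |f * φ_t(y)|`, with
`f * φ_t(y) = ∫ φ_t(y - z) f(z) dz`. -/
def maximalConv {𝕜 : Type*} [RCLike 𝕜] {n : ℕ} (α : ℝ) (f : EuclideanSpace ℝ (Fin n) → 𝕜)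
    (y : EuclideanSpace ℝ (Fin n)) (t : ℝ) : ℝ≥0∞ :=
  ⨆ φ ∈ kernelClass 𝕜 n α, ‖∫ z, dilate φ t (y - z) * f z‖ₑ

/-- The upper half space `ℝⁿ × (0, ∞)`. -/
def upperHalfSpace (n : ℕ) : Set (EuclideanSpace ℝ (Fin n) × ℝ) :=
  univ ×ˢ Ioi 0

/-- The intrinsic `g*_λ`-function of `f` of order `α`, as a function with values in `[0, ∞]`:
`(∬ (t / (t + |x - y|))^{λ n} A_α(f)(y,t)² dy dt / t^{n+1})^{1/2}`, the integral being over the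
upper half space `ℝⁿ × (0, ∞)`. -/
def gStar {𝕜 : Type*} [RCLike 𝕜] {n : ℕ} (lam α : ℝ) (f : EuclideanSpace ℝ (Fin n) → 𝕜)
    (x : EuclideanSpace ℝ (Fin n)) : ℝ≥0∞ :=
  (∫⁻ q in upperHalfSpace n,
    ENNReal.ofReal ((q.2 / (q.2 + ‖x - q.1‖)) ^ (lam * n)) *
      maximalConv α f q.1 q.2 ^ 2 * ENNReal.ofReal ((q.2 ^ (n + 1))⁻¹)) ^ (1 / 2 : ℝ)

/-- A growth function: positive and (weakly) increasing on `(0, ∞)`. -/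
structure IsGrowthFunction (Φ : ℝ → ℝ) : Prop where
  pos : ∀ r, 0 < r → 0 < Φ r
  mono : MonotoneOn Φ (Ioi 0)

/-- `D` is a doubling constant of `Φ`: `D ≥ 1` and `Φ(2r) ≤ D Φ(r)` for all `r > 0`. -/
def IsDoublingConst (Φ : ℝ → ℝ) (D : ℝ) : Prop :=
  1 ≤ D ∧ ∀ r, 0 < r → Φ (2 * r) ≤ D * Φ r

/-- The generalized Morrey norm of `f`: the smallest `C ∈ [0, ∞]` such that
`∫_{B(x₀,r)} |f|^p ≤ C^p Φ(r)` for all balls `B(x₀, r)`.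
The values of `f` may be scalars or elements of `[0, ∞]`. -/
def morreyNorm {n : ℕ} {ε : Type*} [ENorm ε] (p : ℝ) (Φ : ℝ → ℝ)
    (f : EuclideanSpace ℝ (Fin n) → ε) : ℝ≥0∞ :=
  sInf {C : ℝ≥0∞ | ∀ (x₀ : EuclideanSpace ℝ (Fin n)) (r : ℝ), 0 < r →
    ∫⁻ x in Metric.ball x₀ r, ‖f x‖ₑ ^ p ≤ C ^ p * ENNReal.ofReal (Φ r)}

/-- The generalized Morrey space `L^{p,Φ}(ℝⁿ)`: locally integrable functions (for values in
`[0, ∞]`: measurable, with finite integral near every point, hence finite almost everywhere) for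
which some finite `C` satisfies `∫_{B(x₀,r)} |f|^p ≤ C^p Φ(r)` for all balls. -/
def MemMorrey {n : ℕ} {ε : Type*} [TopologicalSpace ε] [ContinuousENorm ε] (p : ℝ) (Φ : ℝ → ℝ)
    (f : EuclideanSpace ℝ (Fin n) → ε) : Prop :=
  LocallyIntegrable f volume ∧ morreyNorm p Φ f < ∞

end IntrinsicSquare

end

/-! The weight makes `g*` the square function of `A_α`. Almost orthogonality of the dilated
kernels, through the `T T*` method and Schur's test, bounds `A_α` on `L²`; localizing to balls on
which the maximal function of a weight is large upgrades this to a weighted `L²` inequality, from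
which duality and the maximal theorem give the `L^p` bound for `2 ≤ p`. For `1 < p < 2` one
interpolates the `L²` bound with a weak type `(1, 1)` bound, obtained from the Calderón–Zygmund
decomposition and the pointwise decay of `g*` away from an atom; this decay needs `λ > 2`.
For the Morrey estimate on `B(x₀, r)`, split `f` into its restrictions to `B(x₀, 2r)`, controlled
by the `L^p` bound, and to dyadic annuli, whose contributions decay geometrically because
`D < 2 ^ n`. -/

noncomputable section

namespace IntrinsicSquare

open Metric Filter Topology Module ComplexConjugate

local notation "ℝ^" n:max => EuclideanSpace ℝ (Fin n)

/-! ### The layer cake formula for functions with values in `[0, ∞]` -/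

section LayerCake

lemma lintegral_Ioo_rpow {a : ℝ} (ha : -1 < a) {R : ℝ} (hR : 0 ≤ R) :
    ∫⁻ t in Ioo (0 : ℝ) R, ENNReal.ofReal (t ^ a) = ENNReal.ofReal (R ^ (a + 1) / (a + 1)) := by
  rw [← ofReal_integral_eq_lintegral_ofReal]
  · rw [← integral_Ioc_eq_integral_Ioo, ← intervalIntegral.integral_of_le hR,
      integral_rpow (Or.inl ha), Real.zero_rpow (by linarith), sub_zero]
  · exact ((intervalIntegrable_iff_integrableOn_Ioc_of_le hR).1
      (intervalIntegral.intervalIntegrable_rpow' ha)).mono_set Ioo_subset_Ioc_self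
  · refine (ae_restrict_iff' measurableSet_Ioo).2 (.of_forall fun s hs => ?_)
    have := hs.1
    positivity

lemma lintegral_Ioo_mul_rpow_sub_one {q : ℝ} (hq : 0 < q) {a : ℝ} (ha : 0 ≤ a) :
    ∫⁻ s in Ioo (0 : ℝ) a, ENNReal.ofReal (q * s ^ (q - 1)) = ENNReal.ofReal a ^ q := by
  simp only [ENNReal.ofReal_mul hq.le]
  rw [lintegral_const_mul' _ _ ENNReal.ofReal_ne_top, lintegral_Ioo_rpow (by linarith) ha,
    ← ENNReal.ofReal_mul hq.le, sub_add_cancel, mul_div_cancel₀ _ hq.ne',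
    ENNReal.ofReal_rpow_of_nonneg ha hq.le]

lemma setLIntegral_ofReal_lt_rpow {q : ℝ} (hq : 0 < q) (c : ℝ≥0∞) :
    ∫⁻ s in {s : ℝ | 0 < s ∧ ENNReal.ofReal s < c}, ENNReal.ofReal (q * s ^ (q - 1)) = c ^ q := by
  obtain rfl | hc := eq_or_ne c ∞
  · rw [ENNReal.top_rpow_of_pos hq]
    refine ENNReal.eq_top_of_forall_nnreal_le fun b => ?_
    calc (b : ℝ≥0∞) = ENNReal.ofReal ((b : ℝ) ^ q⁻¹) ^ q := by
          rw [ENNReal.ofReal_rpow_of_nonneg (by positivity) hq.le,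
            Real.rpow_inv_rpow b.coe_nonneg hq.ne', ENNReal.ofReal_coe_nnreal]
      _ = ∫⁻ s in Ioo (0 : ℝ) ((b : ℝ) ^ q⁻¹), ENNReal.ofReal (q * s ^ (q - 1)) :=
          (lintegral_Ioo_mul_rpow_sub_one hq (by positivity)).symm
      _ ≤ ∫⁻ s in {s : ℝ | 0 < s ∧ ENNReal.ofReal s < ∞}, ENNReal.ofReal (q * s ^ (q - 1)) :=
          lintegral_mono_set fun s hs => ⟨hs.1, ENNReal.ofReal_lt_top⟩
  · have hset : {s : ℝ | 0 < s ∧ ENNReal.ofReal s < c} = Ioo 0 c.toReal := by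
      ext s
      exact and_congr_right fun hs => ENNReal.ofReal_lt_iff_lt_toReal hs.le hc
    rw [hset, lintegral_Ioo_mul_rpow_sub_one hq ENNReal.toReal_nonneg, ENNReal.ofReal_toReal hc]

variable {X : Type*} [MeasurableSpace X] {μ : Measure X} [SFinite μ] {q : ℝ} {h : X → ℝ≥0∞}

lemma lintegral_mul_setLIntegral_comm {Y : Type*} [MeasurableSpace Y] {ν : Measure Y} [SFinite ν]
    {v : X → ℝ≥0∞} {w : Y → ℝ≥0∞} (hv : Measurable v) (hw : Measurable w) {S : Set (X × Y)}
    (hS : MeasurableSet S) :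
    ∫⁻ x, v x * ∫⁻ y in {y | (x, y) ∈ S}, w y ∂ν ∂μ =
      ∫⁻ y, w y * ∫⁻ x in {x | (x, y) ∈ S}, v x ∂μ ∂ν := by
  calc ∫⁻ x, v x * ∫⁻ y in {y | (x, y) ∈ S}, w y ∂ν ∂μ
      = ∫⁻ x, ∫⁻ y, S.indicator (fun z => v z.1 * w z.2) (x, y) ∂ν ∂μ := by
        refine lintegral_congr fun x => ?_
        have hSx : MeasurableSet {y | (x, y) ∈ S} := measurable_prodMk_left hS
        rw [← lintegral_const_mul _ hw, ← lintegral_indicator hSx]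
        rfl
    _ = ∫⁻ y, ∫⁻ x, S.indicator (fun z => v z.1 * w z.2) (x, y) ∂μ ∂ν :=
        lintegral_lintegral_swap <| Measurable.aemeasurable <| Measurable.indicator
          (f := fun z : X × Y => v z.1 * w z.2) (by fun_prop) hS
    _ = ∫⁻ y, w y * ∫⁻ x in {x | (x, y) ∈ S}, v x ∂μ ∂ν := by
        refine lintegral_congr fun y => ?_
        have hSy : MeasurableSet {x | (x, y) ∈ S} := measurable_prodMk_right hS
        rw [← lintegral_const_mul _ hv, ← lintegral_indicator hSy]
        exact lintegral_congr fun x => by simp only [indicator, mem_ofPred_eq, mul_comm]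

lemma lintegral_mul_rpow_eq_lintegral_setLIntegral_lt (hq : 0 < q) (hh : Measurable h)
    {v : X → ℝ≥0∞} (hv : Measurable v) :
    ∫⁻ x, v x * h x ^ q ∂μ = ∫⁻ s in Ioi (0 : ℝ),
      ENNReal.ofReal (q * s ^ (q - 1)) * ∫⁻ x in {x | ENNReal.ofReal s < h x}, v x ∂μ := by
  refine Eq.trans (lintegral_congr fun x => ?_) (lintegral_mul_setLIntegral_comm
    (S := {z : X × ℝ | ENNReal.ofReal z.2 < h z.1}) hv (by fun_prop)
    (measurableSet_lt (by fun_prop) (by fun_prop)))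
  have hx : MeasurableSet {s : ℝ | ENNReal.ofReal s < h x} :=
    measurableSet_lt (by fun_prop) (by fun_prop)
  rw [← setLIntegral_ofReal_lt_rpow hq]
  simp only [mem_ofPred_eq]
  rw [Measure.restrict_restrict hx, inter_comm]
  rfl

lemma lintegral_rpow_eq_lintegral_meas_lt (hq : 0 < q) (hh : Measurable h) :
    ∫⁻ x, h x ^ q ∂μ = ∫⁻ s in Ioi (0 : ℝ),
      ENNReal.ofReal (q * s ^ (q - 1)) * μ {x | ENNReal.ofReal s < h x} := by
  simpa only [Pi.one_apply, one_mul, setLIntegral_one] using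
    lintegral_mul_rpow_eq_lintegral_setLIntegral_lt (μ := μ) hq hh measurable_one

end LayerCake

/-! ### The Hardy–Littlewood maximal function -/

section MaximalFunction

variable {E : Type*} [NormedAddCommGroup E] [MeasurableSpace E]

/-- The uncentred Hardy–Littlewood maximal function of a nonnegative function. -/
def maximalFn (μ : Measure E) (w : E → ℝ≥0∞) (x : E) : ℝ≥0∞ :=
  ⨆ (c : E) (r : ℝ) (_ : x ∈ ball c r), ⨍⁻ z in ball c r, w z ∂μ

variable {μ : Measure E} {w w' : E → ℝ≥0∞} {s : ℝ≥0∞} {x c : E} {r : ℝ}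

lemma lt_maximalFn_iff :
    s < maximalFn μ w x ↔ ∃ c r, x ∈ ball c r ∧ s < ⨍⁻ z in ball c r, w z ∂μ := by
  simp only [maximalFn, lt_iSup_iff, exists_prop]

lemma isOpen_lt_maximalFn (μ : Measure E) (w : E → ℝ≥0∞) (s : ℝ≥0∞) :
    IsOpen {x | s < maximalFn μ w x} := by
  have : {x | s < maximalFn μ w x} =
      ⋃ (c : E) (r : ℝ) (_ : s < ⨍⁻ z in ball c r, w z ∂μ), ball c r := by
    ext x
    simp only [mem_ofPred_eq, lt_maximalFn_iff, mem_iUnion, exists_prop, and_comm]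
  rw [this]
  exact isOpen_iUnion fun c => isOpen_iUnion fun r => isOpen_iUnion fun _ => isOpen_ball

lemma measurable_maximalFn [BorelSpace E] (μ : Measure E) (w : E → ℝ≥0∞) :
    Measurable (maximalFn μ w) :=
  measurable_of_Ioi fun s => (isOpen_lt_maximalFn μ w s).measurableSet

lemma setLAverage_ball_le_maximalFn (h : x ∈ ball c r) :
    ⨍⁻ z in ball c r, w z ∂μ ≤ maximalFn μ w x :=
  le_iSup_of_le c (le_iSup_of_le r (le_iSup_of_le h le_rfl))

lemma maximalFn_mono (h : ∀ x, w x ≤ w' x) (x : E) : maximalFn μ w x ≤ maximalFn μ w' x := by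
  simp only [maximalFn, laverage_eq]
  gcongr
  exact h _

lemma maximalFn_one_le (μ : Measure E) (x : E) : maximalFn μ (fun _ => 1) x ≤ 1 :=
  iSup_le fun _ => iSup_le fun _ => iSup_le fun _ => by
    rw [setLAverage_eq, setLIntegral_const, one_mul]
    exact ENNReal.div_self_le_one

lemma maximalFn_add_const_le (hw : Measurable w) (a : ℝ≥0∞) (x : E) :
    maximalFn μ (fun z => w z + a) x ≤ maximalFn μ w x + a := by
  refine iSup_le fun c => iSup_le fun r => iSup_le fun h => ?_
  rw [setLAverage_eq, lintegral_add_left hw, ENNReal.add_div, setLIntegral_const, ← setLAverage_eq]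
  gcongr
  · exact setLAverage_ball_le_maximalFn h
  · exact ENNReal.div_le_of_le_mul le_rfl

variable [NormedSpace ℝ E] [FiniteDimensional ℝ E] [μ.IsAddHaarMeasure]

lemma setLIntegral_ball_le_maximalFn_mul (h : x ∈ ball c r) :
    ∫⁻ z in ball c r, w z ∂μ ≤ maximalFn μ w x * μ (ball c r) := by
  rw [← ENNReal.div_le_iff (measure_ball_pos μ c (pos_of_mem_ball h)).ne' measure_ball_lt_top.ne,
    ← setLAverage_eq]
  exact setLAverage_ball_le_maximalFn h

lemma mul_measure_ball_le_of_lt_setLAverage (h : s < ⨍⁻ z in ball c r, w z ∂μ) :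
    s * μ (ball c r) ≤ ∫⁻ z in ball c r, w z ∂μ := by
  rw [← measure_mul_setLAverage _ measure_ball_lt_top.ne, mul_comm]
  gcongr

variable [BorelSpace E]

lemma measure_ball_mul (μ : Measure E) [μ.IsAddHaarMeasure] (c : E) {a : ℝ} (ha : 0 < a) (r : ℝ) :
    μ (ball c (a * r)) = ENNReal.ofReal a ^ finrank ℝ E * μ (ball c r) := by
  rw [Measure.addHaar_ball_mul_of_pos μ c ha, ← ENNReal.ofReal_pow ha.le,
    Measure.addHaar_ball_center μ c]

lemma mul_measure_lt_maximalFn_le (w : E → ℝ≥0∞) (s : ℝ≥0∞) :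
    s * μ {x | s < maximalFn μ w x} ≤ 5 ^ finrank ℝ E * ∫⁻ x, w x ∂μ := by
  rw [(isOpen_lt_maximalFn μ w s).measure_eq_iSup_isCompact, ENNReal.mul_iSup]
  simp_rw [ENNReal.mul_iSup]
  refine iSup_le fun K => iSup_le fun hK => iSup_le fun hKc => ?_
  choose! c r hmem hlt using fun x (hx : x ∈ K) => lt_maximalFn_iff.1 (hK hx)
  obtain ⟨t, htK, hcov⟩ := hKc.elim_nhds_subcover (fun x => ball (c x) (r x))
    fun x hx => isOpen_ball.mem_nhds (hmem x hx)
  obtain ⟨R, hR⟩ := (t.image fun x => r x).bddAbove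
  obtain ⟨u, hut, hdisj, hsub⟩ := Vitali.exists_disjoint_subfamily_covering_enlargement_ball
    (t : Set E) (fun x => c x) (fun x => r x) R
    (fun x hx => hR (Finset.mem_coe.2 (Finset.mem_image_of_mem _ hx))) 5 (by norm_num)
  have hu : u.Countable := (t.finite_toSet.subset hut).countable
  have hKu : K ⊆ ⋃ x ∈ u, ball (c x) (5 * r x) := fun y hy => by
    obtain ⟨x, hx, hyx⟩ := mem_iUnion₂.1 (hcov hy)
    obtain ⟨b, hb, hxb⟩ := hsub x hx
    exact mem_biUnion hb (hxb hyx)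
  calc s * μ K
      ≤ s * ∑' x : u, μ (ball (c x) (5 * r x)) := by
        gcongr
        exact (measure_mono hKu).trans (measure_biUnion_le _ hu _)
    _ = 5 ^ finrank ℝ E * ∑' x : u, s * μ (ball (c x) (r x)) := by
        simp_rw [measure_ball_mul μ _ (show (0 : ℝ) < 5 by norm_num), ← ENNReal.tsum_mul_left,
          ENNReal.ofReal_ofNat, mul_left_comm s]
    _ ≤ 5 ^ finrank ℝ E * ∑' x : u, ∫⁻ z in ball (c x) (r x), w z ∂μ := by
        gcongr with x
        exact mul_measure_ball_le_of_lt_setLAverage (hlt _ (htK _ (hut x.2)))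
    _ = 5 ^ finrank ℝ E * ∫⁻ z in ⋃ x ∈ u, ball (c x) (r x), w z ∂μ := by
        rw [lintegral_biUnion hu (fun _ _ => measurableSet_ball) hdisj]
    _ ≤ 5 ^ finrank ℝ E * ∫⁻ x, w x ∂μ := by
        gcongr
        exact Measure.restrict_le_self

/-- Only the part of `w` above half of the level contributes: the rest adds at most `s / 2` to the
maximal function. -/
lemma mul_measure_lt_maximalFn_le_setLIntegral (hw : Measurable w) (s : ℝ≥0∞) :
    s * μ {x | s < maximalFn μ w x} ≤ 2 * 5 ^ finrank ℝ E * ∫⁻ x in {x | s < 2 * w x}, w x ∂μ := by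
  have hm : MeasurableSet {x | s < 2 * w x} := measurableSet_lt measurable_const (by fun_prop)
  set w₁ : E → ℝ≥0∞ := {x | s < 2 * w x}.indicator w with hw₁
  have hle : ∀ x, w x ≤ w₁ x + s / 2 := by
    intro x
    by_cases hx : s < 2 * w x
    · exact le_add_right (indicator_of_mem (s := {x | s < 2 * w x}) hx w).ge
    · refine le_add_left ?_
      rw [ENNReal.le_div_iff_mul_le (by simp) (by simp), mul_comm]
      exact not_lt.1 hx
  have hsub : {x | s < maximalFn μ w x} ⊆ {x | s / 2 < maximalFn μ w₁ x} := fun x hx => by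
    have h : s / 2 + s / 2 < maximalFn μ w₁ x + s / 2 := by
      rw [ENNReal.add_halves]
      exact lt_of_lt_of_le hx
        ((maximalFn_mono hle x).trans (maximalFn_add_const_le (hw.indicator hm) _ x))
    exact lt_of_add_lt_add_right h
  calc s * μ {x | s < maximalFn μ w x}
      ≤ s * μ {x | s / 2 < maximalFn μ w₁ x} := by gcongr
    _ = 2 * (s / 2 * μ {x | s / 2 < maximalFn μ w₁ x}) := by
        rw [← mul_assoc, ENNReal.mul_div_cancel (by simp) (by simp)]
    _ ≤ 2 * (5 ^ finrank ℝ E * ∫⁻ x, w₁ x ∂μ) :=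
        mul_le_mul_right (mul_measure_lt_maximalFn_le w₁ (s / 2)) 2
    _ = _ := by rw [hw₁, lintegral_indicator hm, mul_assoc]

lemma self_mul_rpow_sub_one {q : ℝ} (hq : 1 ≤ q) (a : ℝ≥0∞) : a * a ^ (q - 1) = a ^ q := by
  conv_lhs => rw [← ENNReal.rpow_one a, ← ENNReal.rpow_mul, one_mul]
  rw [← ENNReal.rpow_add_of_nonneg _ _ zero_le_one (sub_nonneg.2 hq), add_sub_cancel]

/-- Integrate the weak type bound against `q s^(q-1) ds`. The factor `s⁻¹` lowers the exponent of
the weight, and the layer cake formula is used backwards. -/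
lemma exists_lintegral_maximalFn_rpow_le (μ : Measure E) [μ.IsAddHaarMeasure] {q : ℝ}
    (hq : 1 < q) : ∃ C : ℝ≥0∞, C ≠ ∞ ∧ ∀ w : E → ℝ≥0∞, Measurable w →
      ∫⁻ x, maximalFn μ w x ^ q ∂μ ≤ C * ∫⁻ x, w x ^ q ∂μ := by
  have hq1 : 0 < q - 1 := sub_pos.2 hq
  set A : ℝ≥0∞ := 2 * 5 ^ finrank ℝ E * ENNReal.ofReal (q / (q - 1)) with hA
  refine ⟨A * 2 ^ (q - 1), by finiteness, fun w hw => ?_⟩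
  have hlevel : ∀ s ∈ Ioi (0 : ℝ),
      ENNReal.ofReal (q * s ^ (q - 1)) * μ {x | ENNReal.ofReal s < maximalFn μ w x} ≤
        A * (ENNReal.ofReal ((q - 1) * s ^ (q - 1 - 1)) *
          ∫⁻ x in {x | ENNReal.ofReal s < 2 * w x}, w x ∂μ) := by
    intro s hs
    have hs : 0 < s := hs
    have hsplit : ENNReal.ofReal (q * s ^ (q - 1)) = ENNReal.ofReal (q / (q - 1)) *
        ENNReal.ofReal ((q - 1) * s ^ (q - 1 - 1)) * ENNReal.ofReal s := by
      rw [← ENNReal.ofReal_mul (by positivity), ← ENNReal.ofReal_mul (by positivity),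
        Real.rpow_sub_one hs.ne' (q - 1)]
      field_simp
    rw [hsplit, mul_assoc]
    refine (mul_le_mul_right (mul_measure_lt_maximalFn_le_setLIntegral hw _) _).trans (le_of_eq ?_)
    rw [hA]
    ring
  calc ∫⁻ x, maximalFn μ w x ^ q ∂μ
      = ∫⁻ s in Ioi (0 : ℝ), ENNReal.ofReal (q * s ^ (q - 1)) *
          μ {x | ENNReal.ofReal s < maximalFn μ w x} :=
        lintegral_rpow_eq_lintegral_meas_lt (by linarith) (measurable_maximalFn μ w)
    _ ≤ ∫⁻ s in Ioi (0 : ℝ), A * (ENNReal.ofReal ((q - 1) * s ^ (q - 1 - 1)) *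
          ∫⁻ x in {x | ENNReal.ofReal s < 2 * w x}, w x ∂μ) :=
        setLIntegral_mono' measurableSet_Ioi hlevel
    _ = A * ∫⁻ x, w x * (2 * w x) ^ (q - 1) ∂μ := by
        rw [lintegral_const_mul' _ _ (by finiteness),
          lintegral_mul_rpow_eq_lintegral_setLIntegral_lt hq1 (by fun_prop) hw]
    _ = A * 2 ^ (q - 1) * ∫⁻ x, w x ^ q ∂μ := by
        simp_rw [ENNReal.mul_rpow_of_nonneg _ _ hq1.le, mul_left_comm (w _),
          self_mul_rpow_sub_one hq.le]
        rw [lintegral_const_mul' _ _ (by finiteness), hA]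
        ring

lemma ae_le_maximalFn (hw : Measurable w) (hloc : ∀ r : ℝ, ∫⁻ z in ball 0 r, w z ∂μ ≠ ∞) :
    ∀ᵐ x ∂μ, w x ≤ maximalFn μ w x := by
  have htendsto : ∀ N : ℕ, ∀ᵐ x ∂μ, Tendsto
      (fun a => (∫⁻ y in a, (ball 0 N).indicator w y ∂μ) / μ a)
      ((Besicovitch.vitaliFamily μ).filterAt x) (𝓝 ((ball (0 : E) N).indicator w x)) := by
    intro N
    refine VitaliFamily.ae_tendsto_lintegral_div' _ (hw.indicator measurableSet_ball) ?_
    rw [lintegral_indicator measurableSet_ball]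
    exact hloc N
  filter_upwards [ae_all_iff.2 htendsto] with x hx
  obtain ⟨N, hN⟩ := exists_nat_gt ‖x‖
  have hx' := (hx N).comp (Besicovitch.tendsto_filterAt μ x)
  rw [indicator_of_mem (by simpa using hN)] at hx'
  refine le_of_tendsto hx' ?_
  filter_upwards [self_mem_nhdsWithin] with r hr
  have hr : 0 < r := hr
  have hae : closedBall x r =ᵐ[μ] ball x r := by
    refine (ae_eq_of_subset_of_measure_ge ball_subset_closedBall ?_
      measurableSet_ball.nullMeasurableSet measure_closedBall_lt_top.ne).symm
    rw [Measure.addHaar_closedBall _ _ hr.le, Measure.addHaar_ball_of_pos _ _ hr]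
  simp only [Function.comp, setLIntegral_congr hae, measure_congr hae]
  refine le_trans ?_ (setLAverage_ball_le_maximalFn (mem_ball_self hr))
  rw [setLAverage_eq]
  gcongr
  exact indicator_le_self _ _ _

end MaximalFunction

/-! ### Minkowski's inequality for countable sums -/

section Minkowski

variable {X ι : Type*} [MeasurableSpace X] {μ : Measure X} {p : ℝ} {a : ι → X → ℝ≥0∞}

lemma lintegral_rpow_sum_le (hp : 1 ≤ p) (ha : ∀ i, AEMeasurable (a i) μ) (s : Finset ι) :
    (∫⁻ x, (∑ i ∈ s, a i x) ^ p ∂μ) ^ (1 / p) ≤ ∑ i ∈ s, (∫⁻ x, a i x ^ p ∂μ) ^ (1 / p) := by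
  classical
  have hp0 : 0 < p := by linarith
  induction s using Finset.induction_on with
  | empty => simp [hp0]
  | insert i s hi ih =>
    simp only [Finset.sum_insert hi]
    have hs : AEMeasurable (fun x => ∑ i ∈ s, a i x) μ :=
      Finset.aemeasurable_fun_sum s fun i _ => ha i
    exact (ENNReal.lintegral_Lp_add_le (ha i) hs hp).trans (by gcongr)

lemma lintegral_rpow_tsum_le [Countable ι] (hp : 1 ≤ p) (ha : ∀ i, AEMeasurable (a i) μ) :
    (∫⁻ x, (∑' i, a i x) ^ p ∂μ) ^ (1 / p) ≤ ∑' i, (∫⁻ x, a i x ^ p ∂μ) ^ (1 / p) := by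
  have hp0 : 0 < p := by linarith
  have hsup : ∀ x, (∑' i, a i x) ^ p = ⨆ s : Finset ι, (∑ i ∈ s, a i x) ^ p := fun x => by
    rw [ENNReal.tsum_eq_iSup_sum]
    exact (ENNReal.orderIsoRpow p hp0).map_iSup _
  simp_rw [hsup]
  rw [lintegral_iSup_directed]
  · rw [show (⨆ s : Finset ι, ∫⁻ x, (∑ i ∈ s, a i x) ^ p ∂μ) ^ (1 / p) =
      ⨆ s : Finset ι, (∫⁻ x, (∑ i ∈ s, a i x) ^ p ∂μ) ^ (1 / p) from
      (ENNReal.orderIsoRpow (1 / p) (by positivity)).map_iSup _]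
    exact iSup_le fun s => (lintegral_rpow_sum_le hp ha s).trans (ENNReal.sum_le_tsum s)
  · exact fun s => (Finset.aemeasurable_fun_sum s fun i _ => ha i).pow_const p
  · refine Monotone.directed_le fun s t hst x => ?_
    dsimp only
    gcongr

end Minkowski

/-! ### The kernels -/

section Kernels

variable {𝕜 : Type*} [RCLike 𝕜] {n : ℕ} {α t : ℝ} {φ f f' : ℝ^n → 𝕜}

lemma zero_mem_kernelClass (𝕜 : Type*) [RCLike 𝕜] (n : ℕ) (α : ℝ) :
    (0 : ℝ^n → 𝕜) ∈ kernelClass 𝕜 n α := by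
  refine ⟨by simp, by simp, fun x x' => ?_⟩
  simp only [Pi.zero_apply, sub_self, norm_zero]
  positivity

lemma eq_zero_of_mem_kernelClass (hφ : φ ∈ kernelClass 𝕜 n α) {x : ℝ^n}
    (hx : x ∉ closedBall 0 1) : φ x = 0 :=
  Function.notMem_support.1 fun h => hx (hφ.1 h)

lemma continuous_of_mem_kernelClass (hα : 0 < α) (hφ : φ ∈ kernelClass 𝕜 n α) : Continuous φ := by
  refine continuous_iff_continuousAt.2 fun x => tendsto_iff_norm_sub_tendsto_zero.2 ?_
  refine squeeze_zero (fun _ => norm_nonneg _) (fun x' => hφ.2.2 x' x) ?_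
  have : Continuous fun x' : ℝ^n => ‖x' - x‖ ^ α :=
    (Real.continuous_rpow_const hα.le).comp (by fun_prop)
  simpa only [sub_self, norm_zero, Real.zero_rpow hα.ne'] using this.tendsto x

/-- A kernel has mean value zero, so its values are controlled by its oscillation on the unit
ball. -/
lemma norm_le_of_mem_kernelClass (hα : 0 < α) (hφ : φ ∈ kernelClass 𝕜 n α) (x : ℝ^n) :
    ‖φ x‖ ≤ 2 ^ α := by
  by_cases hx : x ∈ closedBall 0 1
  swap
  · rw [eq_zero_of_mem_kernelClass hφ hx, norm_zero]
    positivity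
  set B : Set (ℝ^n) := closedBall 0 1
  have hB : volume B < ∞ := measure_closedBall_lt_top
  have hB0 : 0 < volume.real B :=
    ENNReal.toReal_pos (measure_closedBall_pos volume 0 one_pos).ne' hB.ne
  have hφB : IntegrableOn φ B :=
    (continuous_of_mem_kernelClass hα hφ).continuousOn.integrableOn_compact
      (isCompact_closedBall 0 1)
  have hmean : ∫ z in B, (φ x - φ z) = volume.real B • φ x := by
    rw [integral_sub (integrable_const_iff.2 (Or.inr ⟨by simpa using hB⟩)) hφB, setIntegral_const,
      setIntegral_eq_integral_of_forall_compl_eq_zero fun z hz => eq_zero_of_mem_kernelClass hφ hz,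
      hφ.2.1, sub_zero]
  have hosc : ‖∫ z in B, (φ x - φ z)‖ ≤ 2 ^ α * volume.real B := by
    refine norm_setIntegral_le_of_norm_le_const hB fun z hz => (hφ.2.2 x z).trans ?_
    gcongr
    rw [mem_closedBall_zero_iff] at hx hz
    linarith [norm_sub_le x z]
  rw [hmean, norm_smul, Real.norm_of_nonneg hB0.le, mul_comm] at hosc
  exact le_of_mul_le_mul_right hosc hB0

lemma dilate_eq_zero (hφ : φ ∈ kernelClass 𝕜 n α) (ht : 0 < t) {x : ℝ^n} (hx : t < ‖x‖) :
    dilate φ t x = 0 := by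
  rw [dilate, eq_zero_of_mem_kernelClass hφ, smul_zero]
  rw [mem_closedBall_zero_iff, norm_smul, Real.norm_of_nonneg (by positivity), inv_mul_eq_div,
    not_le, one_lt_div ht]
  exact hx

lemma dilate_sub_eq_zero (hφ : φ ∈ kernelClass 𝕜 n α) (ht : 0 < t) {y z : ℝ^n}
    (hz : z ∉ closedBall y t) : dilate φ t (y - z) = 0 :=
  dilate_eq_zero hφ ht (by rwa [mem_closedBall, dist_comm, dist_eq_norm, not_le] at hz)

lemma norm_dilate_le (hα : 0 < α) (hφ : φ ∈ kernelClass 𝕜 n α) (ht : 0 < t) (x : ℝ^n) :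
    ‖dilate φ t x‖ ≤ 2 ^ α * (t ^ n)⁻¹ := by
  rw [dilate, norm_smul, Real.norm_of_nonneg (by positivity), mul_comm]
  gcongr
  exact norm_le_of_mem_kernelClass hα hφ _

lemma norm_dilate_sub_dilate_le (hφ : φ ∈ kernelClass 𝕜 n α) (ht : 0 < t) (x x' : ℝ^n) :
    ‖dilate φ t x - dilate φ t x'‖ ≤ (t ^ n)⁻¹ * (‖x - x'‖ / t) ^ α := by
  rw [dilate, dilate, ← smul_sub, norm_smul, Real.norm_of_nonneg (by positivity)]
  gcongr
  refine (hφ.2.2 _ _).trans_eq ?_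
  rw [← smul_sub, norm_smul, Real.norm_of_nonneg (by positivity), inv_mul_eq_div]

lemma continuous_dilate_sub (hα : 0 < α) (hφ : φ ∈ kernelClass 𝕜 n α) (t : ℝ) (y : ℝ^n) :
    Continuous fun z => dilate φ t (y - z) :=
  ((continuous_of_mem_kernelClass hα hφ).comp (by fun_prop)).const_smul _

lemma integral_dilate_sub (hφ : φ ∈ kernelClass 𝕜 n α) (t : ℝ) (y : ℝ^n) :
    ∫ z, dilate φ t (y - z) = 0 := by
  rw [integral_sub_left_eq_self (dilate φ t) volume y]
  unfold dilate
  rw [integral_smul, Measure.integral_comp_smul, hφ.2.1, smul_zero, smul_zero]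

lemma lintegral_enorm_dilate_mul_le (hα : 0 < α) (hφ : φ ∈ kernelClass 𝕜 n α) (f : ℝ^n → 𝕜)
    (y : ℝ^n) (ht : 0 < t) :
    ∫⁻ z, ‖dilate φ t (y - z) * f z‖ₑ ≤
      ENNReal.ofReal (2 ^ α * (t ^ n)⁻¹) * ∫⁻ z in closedBall y t, ‖f z‖ₑ := by
  rw [← lintegral_const_mul' _ _ (by finiteness), ← lintegral_indicator measurableSet_closedBall]
  refine lintegral_mono fun z => ?_
  by_cases hz : z ∈ closedBall y t
  · rw [indicator_of_mem hz, enorm_mul, ← ofReal_norm]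
    gcongr
    exact norm_dilate_le hα hφ ht _
  · rw [dilate_sub_eq_zero hφ ht hz, zero_mul, enorm_zero]
    exact zero_le

lemma maximalConv_le (hα : 0 < α) (f : ℝ^n → 𝕜) (y : ℝ^n) (ht : 0 < t) :
    maximalConv α f y t ≤
      ENNReal.ofReal (2 ^ α * (t ^ n)⁻¹) * ∫⁻ z in closedBall y t, ‖f z‖ₑ :=
  iSup₂_le fun _ hφ => (enorm_integral_le_lintegral_enorm _).trans
    (lintegral_enorm_dilate_mul_le hα hφ f y ht)

lemma maximalConv_congr {y : ℝ^n} (ht : 0 < t)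
    (h : ∀ᵐ z, z ∈ closedBall y t → f z = f' z) : maximalConv α f y t = maximalConv α f' y t := by
  refine iSup_congr fun φ => iSup_congr fun hφ => congrArg _ (integral_congr_ae ?_)
  filter_upwards [h] with z hz
  by_cases hzt : z ∈ closedBall y t
  · rw [hz hzt]
  · rw [dilate_sub_eq_zero hφ ht hzt, zero_mul, zero_mul]

lemma maximalConv_le_tsum {ι : Type*} [Countable ι] (hα : 0 < α) {F : ι → ℝ^n → 𝕜}
    (hF : ∀ i, AEStronglyMeasurable (F i) volume) (hsum : ∀ᵐ z, HasSum (fun i => F i z) (f z))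
    {y : ℝ^n} (ht : 0 < t) (hfin : ∑' i, ∫⁻ z in closedBall y t, ‖F i z‖ₑ ≠ ∞) :
    maximalConv α f y t ≤ ∑' i, maximalConv α (F i) y t := by
  refine iSup₂_le fun φ hφ => ?_
  calc ‖∫ z, dilate φ t (y - z) * f z‖ₑ = ‖∫ z, ∑' i, dilate φ t (y - z) * F i z‖ₑ := by
        refine congrArg _ (integral_congr_ae ?_)
        filter_upwards [hsum] with z hz using (hz.mul_left _).tsum_eq.symm
    _ = ‖∑' i, ∫ z, dilate φ t (y - z) * F i z‖ₑ := by
        rw [integral_tsum (f := fun i z => dilate φ t (y - z) * F i z) fun i =>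
          (continuous_dilate_sub hα hφ t y).aestronglyMeasurable.mul (hF i)]
        refine ne_top_of_le_ne_top ?_ (ENNReal.tsum_le_tsum fun i =>
          lintegral_enorm_dilate_mul_le hα hφ (F i) y ht)
        rw [ENNReal.tsum_mul_left]
        finiteness
    _ ≤ ∑' i, maximalConv α (F i) y t :=
        enorm_tsum_le_tsum_enorm.trans (ENNReal.tsum_le_tsum fun i => le_iSup₂_of_le φ hφ le_rfl)

end Kernels

/-! ### Measurability -/

section Measurability

variable {𝕜 : Type*} [RCLike 𝕜] {n : ℕ} {α t : ℝ} {φ f : ℝ^n → 𝕜}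

lemma isOpen_upperHalfSpace (n : ℕ) : IsOpen (upperHalfSpace n) := isOpen_univ.prod isOpen_Ioi

lemma measurableSet_upperHalfSpace (n : ℕ) : MeasurableSet (upperHalfSpace n) :=
  (isOpen_upperHalfSpace n).measurableSet

lemma mem_upperHalfSpace {q : ℝ^n × ℝ} : q ∈ upperHalfSpace n ↔ 0 < q.2 := by
  simp only [upperHalfSpace, mem_prod, mem_univ, mem_Ioi, true_and]

lemma continuousAt_dilate_fst_sub (hα : 0 < α) (hφ : φ ∈ kernelClass 𝕜 n α) {q₀ : ℝ^n × ℝ}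
    (ht₀ : q₀.2 ≠ 0) (z : ℝ^n) :
    ContinuousAt (fun q : ℝ^n × ℝ => dilate φ q.2 (q.1 - z)) q₀ := by
  have hpow : ContinuousAt (fun q : ℝ^n × ℝ => (q.2 ^ n)⁻¹) q₀ :=
    (continuousAt_snd.pow n).inv₀ (pow_ne_zero n ht₀)
  have harg : ContinuousAt (fun q : ℝ^n × ℝ => q.2⁻¹ • (q.1 - z)) q₀ :=
    (continuousAt_snd.inv₀ ht₀).smul (by fun_prop)
  exact hpow.smul
    ((continuous_of_mem_kernelClass hα hφ).continuousAt.comp harg)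

lemma norm_dilate_mul_le_indicator (hα : 0 < α) (hφ : φ ∈ kernelClass 𝕜 n α) {y y₀ z : ℝ^n}
    {t₀ : ℝ} (hy : dist y y₀ < 1) (ht₀ : 0 < t₀) (ht : t ∈ Ioo (t₀ / 2) (2 * t₀)) :
    ‖dilate φ t (y - z) * f z‖ ≤ (closedBall y₀ (1 + 2 * t₀)).indicator
      (fun z => 2 ^ α * ((t₀ / 2) ^ n)⁻¹ * ‖f z‖) z := by
  have ht0 : 0 < t := (half_pos ht₀).trans ht.1
  by_cases hz : z ∈ closedBall y₀ (1 + 2 * t₀)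
  · rw [indicator_of_mem hz, norm_mul]
    gcongr
    refine (norm_dilate_le hα hφ ht0 _).trans ?_
    gcongr
    exact ht.1.le
  · rw [indicator_of_notMem hz, dilate_sub_eq_zero hφ ht0, zero_mul, norm_zero]
    contrapose! hz
    rw [mem_closedBall] at hz ⊢
    linarith [dist_triangle z y y₀, ht.2]

lemma continuousOn_conv (hα : 0 < α) (hφ : φ ∈ kernelClass 𝕜 n α)
    (hf : LocallyIntegrable f volume) :
    ContinuousOn (fun q : ℝ^n × ℝ => ∫ z, dilate φ q.2 (q.1 - z) * f z) (upperHalfSpace n) := by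
  intro q₀ hq₀
  have ht₀ : 0 < q₀.2 := mem_upperHalfSpace.1 hq₀
  have hdom : Integrable ((closedBall q₀.1 (1 + 2 * q₀.2)).indicator
      fun z => 2 ^ α * ((q₀.2 / 2) ^ n)⁻¹ * ‖f z‖) volume :=
    (integrable_indicator_iff measurableSet_closedBall).2
      ((hf.integrableOn_isCompact (isCompact_closedBall _ _)).norm.const_mul _)
  have hnhds : ∀ᶠ q : ℝ^n × ℝ in 𝓝 q₀, dist q.1 q₀.1 < 1 ∧ q.2 ∈ Ioo (q₀.2 / 2) (2 * q₀.2) :=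
    (continuous_fst.continuousAt.eventually (ball_mem_nhds q₀.1 one_pos)).and
      (continuous_snd.continuousAt.eventually
        (Ioo_mem_nhds (half_lt_self ht₀) (lt_two_mul_self ht₀)))
  refine ContinuousAt.continuousWithinAt (continuousAt_of_dominated ?_ ?_ hdom ?_)
  · exact .of_forall fun q =>
      (continuous_dilate_sub hα hφ q.2 q.1).aestronglyMeasurable.mul hf.aestronglyMeasurable
  · filter_upwards [hnhds] with q hq
    exact .of_forall fun z => norm_dilate_mul_le_indicator hα hφ hq.1 ht₀ hq.2
  · exact .of_forall fun z =>
      (continuousAt_dilate_fst_sub hα hφ ht₀.ne' z).mul continuousAt_const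

/-- The function `(y, t) ↦ |f * φ_t(y)|` on the upper half space, extended by `0`. -/
def convExt (φ f : ℝ^n → 𝕜) : ℝ^n × ℝ → ℝ≥0∞ :=
  (upperHalfSpace n).indicator fun q => ‖∫ z, dilate φ q.2 (q.1 - z) * f z‖ₑ

/-- The function `A_α(f)` on the upper half space, extended by `0`; unlike `A_α(f)` itself, it is
lower semicontinuous on the whole space. -/
def maximalConvExt (α : ℝ) (f : ℝ^n → 𝕜) : ℝ^n × ℝ → ℝ≥0∞ :=
  (upperHalfSpace n).indicator fun q => maximalConv α f q.1 q.2

lemma maximalConvExt_of_mem (f : ℝ^n → 𝕜) {q : ℝ^n × ℝ} (hq : q ∈ upperHalfSpace n) :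
    maximalConvExt α f q = maximalConv α f q.1 q.2 := indicator_of_mem hq _

lemma maximalConvExt_eq_iSup (α : ℝ) (f : ℝ^n → 𝕜) :
    maximalConvExt α f = fun q => ⨆ φ ∈ kernelClass 𝕜 n α, convExt φ f q := by
  ext q
  by_cases hq : q ∈ upperHalfSpace n
  · simp only [maximalConvExt_of_mem f hq, maximalConv, convExt, indicator_of_mem hq]
  · simp [maximalConvExt, convExt, indicator_of_notMem hq]

lemma lowerSemicontinuous_convExt (hα : 0 < α) (hφ : φ ∈ kernelClass 𝕜 n α)
    (hf : LocallyIntegrable f volume) : LowerSemicontinuous (convExt φ f) := by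
  refine lowerSemicontinuous_iff_isOpen_preimage.2 fun s => ?_
  have h := (continuousOn_conv hα hφ hf).enorm.isOpen_inter_preimage
    (isOpen_upperHalfSpace n) (isOpen_Ioi (a := s))
  convert h using 1
  ext q
  by_cases hq : q ∈ upperHalfSpace n <;> simp [convExt, hq]

lemma lowerSemicontinuous_maximalConvExt (hα : 0 < α) (hf : LocallyIntegrable f volume) :
    LowerSemicontinuous (maximalConvExt α f) := by
  rw [maximalConvExt_eq_iSup]
  exact lowerSemicontinuous_iSup fun φ => lowerSemicontinuous_iSup fun hφ =>
    lowerSemicontinuous_convExt hα hφ hf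

lemma measurable_maximalConvExt (hα : 0 < α) (hf : LocallyIntegrable f volume) :
    Measurable (maximalConvExt α f) :=
  (lowerSemicontinuous_maximalConvExt hα hf).measurable

lemma lintegral_upperHalfSpace {g : ℝ^n × ℝ → ℝ≥0∞} (hg : Measurable g) :
    ∫⁻ q in upperHalfSpace n, g q = ∫⁻ t in Ioi (0 : ℝ), ∫⁻ y, g (y, t) := by
  rw [upperHalfSpace, Measure.volume_eq_prod, ← Measure.prod_restrict, Measure.restrict_univ,
    lintegral_prod_symm' _ hg]

end Measurability

/-! ### Elementary properties of `g*` -/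

section GStar

variable {𝕜 : Type*} [RCLike 𝕜] {n : ℕ} {α lam : ℝ} {f f' : ℝ^n → 𝕜}

/-- The density, with respect to `dy dt`, of the measure against which `A_α(f)²` is integrated in
the definition of `g*_λ(f)(x)`. -/
def gStarWeight (lam : ℝ) (x : ℝ^n) (q : ℝ^n × ℝ) : ℝ≥0∞ :=
  ENNReal.ofReal ((q.2 / (q.2 + ‖x - q.1‖)) ^ (lam * n)) * ENNReal.ofReal ((q.2 ^ (n + 1))⁻¹)

lemma measurable_gStarWeight (lam : ℝ) :
    Measurable fun z : ℝ^n × (ℝ^n × ℝ) => gStarWeight lam z.1 z.2 := by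
  unfold gStarWeight
  fun_prop

lemma gStar_eq (lam α : ℝ) (f : ℝ^n → 𝕜) (x : ℝ^n) :
    gStar lam α f x = (∫⁻ q in upperHalfSpace n,
      gStarWeight lam x q * maximalConvExt α f q ^ 2) ^ (1 / 2 : ℝ) := by
  refine congrArg (· ^ (1 / 2 : ℝ))
    (setLIntegral_congr_fun (measurableSet_upperHalfSpace n) fun q hq => ?_)
  simp only [maximalConvExt_of_mem f hq, gStarWeight]
  ring

lemma gStar_sq (lam α : ℝ) (f : ℝ^n → 𝕜) (x : ℝ^n) :
    gStar lam α f x ^ 2 =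
      ∫⁻ q in upperHalfSpace n, gStarWeight lam x q * maximalConvExt α f q ^ 2 := by
  rw [gStar_eq, ← ENNReal.rpow_natCast, ← ENNReal.rpow_mul]
  norm_num

lemma measurable_gStar (hα : 0 < α) (lam : ℝ) (hf : LocallyIntegrable f volume) :
    Measurable (gStar lam α f) := by
  rw [funext (gStar_eq lam α f)]
  refine Measurable.pow_const (Measurable.lintegral_prod_right' (f := fun z : ℝ^n × (ℝ^n × ℝ) =>
    gStarWeight lam z.1 z.2 * maximalConvExt α f z.2 ^ 2) ?_) _
  exact (measurable_gStarWeight lam).mul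
    (((measurable_maximalConvExt hα hf).comp measurable_snd).pow_const 2)

lemma gStar_congr (h : f =ᵐ[volume] f') (x : ℝ^n) : gStar lam α f x = gStar lam α f' x := by
  refine congrArg (· ^ (1 / 2 : ℝ))
    (setLIntegral_congr_fun (measurableSet_upperHalfSpace n) fun q hq => ?_)
  rw [maximalConv_congr (f' := f') (mem_upperHalfSpace.1 hq) (h.mono fun z hz _ => hz)]

lemma gStar_le_tsum {ι : Type*} [Countable ι] (hα : 0 < α) {F : ι → ℝ^n → 𝕜}
    (hF : ∀ i, LocallyIntegrable (F i) volume) (hsum : ∀ᵐ z, HasSum (fun i => F i z) (f z))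
    (hfin : ∀ (y : ℝ^n) (t : ℝ), ∑' i, ∫⁻ z in closedBall y t, ‖F i z‖ₑ ≠ ∞) (x : ℝ^n) :
    gStar lam α f x ≤ ∑' i, gStar lam α (F i) x := by
  have hw : Measurable fun q : ℝ^n × ℝ => gStarWeight lam x q ^ (1 / 2 : ℝ) :=
    ((measurable_gStarWeight lam).comp measurable_prodMk_left).pow_const _
  have hsq : ∀ a b : ℝ≥0∞, a * b ^ 2 = (a ^ (1 / 2 : ℝ) * b) ^ (2 : ℝ) := fun a b => by
    rw [ENNReal.mul_rpow_of_nonneg _ _ zero_le_two, ← ENNReal.rpow_mul]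
    norm_num
  simp_rw [gStar_eq, hsq]
  refine le_trans ?_ (lintegral_rpow_tsum_le one_le_two fun i =>
    (hw.mul (measurable_maximalConvExt hα (hF i))).aemeasurable)
  gcongr ?_ ^ _
  refine setLIntegral_mono' (measurableSet_upperHalfSpace n) fun q hq => ?_
  simp_rw [ENNReal.tsum_mul_left, maximalConvExt_of_mem _ hq]
  gcongr
  exact maximalConv_le_tsum hα (fun i => (hF i).aestronglyMeasurable) hsum
    (mem_upperHalfSpace.1 hq) (hfin _ _)

end GStar

/-! ### Schur's test and the `T T*` method -/

section Schur

variable {W Z 𝕜 : Type*} [MeasurableSpace W] [MeasurableSpace Z] [RCLike 𝕜]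
  {μ : Measure W} {ν : Measure Z} {H : W → W → ℝ≥0∞} {C : ℝ≥0∞}

lemma ennreal_two_mul_le_add_sq (a b : ℝ≥0∞) : 2 * (a * b) ≤ a ^ 2 + b ^ 2 := by
  rcases le_total a b with h | h <;> obtain ⟨c, rfl⟩ := exists_add_of_le h
  · rw [show a ^ 2 + (a + c) ^ 2 = 2 * (a * (a + c)) + c ^ 2 by ring]
    exact le_self_add
  · rw [show (b + c) ^ 2 + b ^ 2 = 2 * ((b + c) * b) + c ^ 2 by ring]
    exact le_self_add

lemma lintegral_lintegral_mul_mul_le [SFinite μ] {F : W → ℝ≥0∞} (hF : Measurable F)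
    (hH : Measurable (Function.uncurry H)) (hsymm : ∀ w w', H w w' = H w' w)
    (hC : ∀ w, ∫⁻ w', H w w' ∂μ ≤ C) :
    ∫⁻ w, ∫⁻ w', F w * F w' * H w w' ∂μ ∂μ ≤ C * ∫⁻ w, F w ^ 2 ∂μ := by
  have hm : Measurable (Function.uncurry fun w w' => F w ^ 2 * H w w') :=
    ((hF.comp measurable_fst).pow_const 2).mul hH
  have hrow : ∫⁻ w, ∫⁻ w', F w ^ 2 * H w w' ∂μ ∂μ ≤ C * ∫⁻ w, F w ^ 2 ∂μ := by
    rw [← lintegral_const_mul _ (hF.pow_const 2)]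
    refine lintegral_mono fun w => ?_
    rw [lintegral_const_mul _ hH.of_uncurry_left, mul_comm]
    gcongr
    exact hC w
  have hcol : ∫⁻ w, ∫⁻ w', F w' ^ 2 * H w w' ∂μ ∂μ = ∫⁻ w, ∫⁻ w', F w ^ 2 * H w w' ∂μ ∂μ := by
    rw [lintegral_lintegral_swap (f := fun w w' => F w ^ 2 * H w w') hm.aemeasurable]
    simp only [hsymm]
  refine (ENNReal.mul_le_mul_iff_right two_ne_zero ENNReal.ofNat_ne_top).1 ?_
  calc 2 * ∫⁻ w, ∫⁻ w', F w * F w' * H w w' ∂μ ∂μ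
      = ∫⁻ w, ∫⁻ w', 2 * (F w * F w') * H w w' ∂μ ∂μ := by
        simp only [mul_assoc, lintegral_const_mul' _ _ ENNReal.ofNat_ne_top]
    _ ≤ ∫⁻ w, ∫⁻ w', F w ^ 2 * H w w' + F w' ^ 2 * H w w' ∂μ ∂μ := by
        gcongr with w w'
        rw [← add_mul]
        gcongr
        exact ennreal_two_mul_le_add_sq _ _
    _ = ∫⁻ w, ∫⁻ w', F w ^ 2 * H w w' ∂μ ∂μ + ∫⁻ w, ∫⁻ w', F w' ^ 2 * H w w' ∂μ ∂μ := by
        rw [← lintegral_add_left (f := fun w => ∫⁻ w', F w ^ 2 * H w w' ∂μ)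
          hm.lintegral_prod_right']
        exact lintegral_congr fun w =>
          lintegral_add_left (f := fun w' => F w ^ 2 * H w w') hm.of_uncurry_left _
    _ ≤ 2 * (C * ∫⁻ w, F w ^ 2 ∂μ) := by
        rw [hcol, two_mul]
        gcongr

lemma lintegral_mul_sq_le {f g : Z → ℝ≥0∞} (hf : AEMeasurable f ν) (hg : AEMeasurable g ν) :
    (∫⁻ z, f z * g z ∂ν) ^ 2 ≤ (∫⁻ z, f z ^ 2 ∂ν) * ∫⁻ z, g z ^ 2 ∂ν := by
  have hsqrt (a : ℝ≥0∞) : (a ^ (1 / 2 : ℝ)) ^ 2 = a := by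
    rw [← ENNReal.rpow_mul_natCast]
    norm_num
  have h := ENNReal.lintegral_mul_le_Lp_mul_Lq ν Real.HolderConjugate.two_two hf hg
  simp only [ENNReal.rpow_two] at h
  calc (∫⁻ z, f z * g z ∂ν) ^ 2
      ≤ ((∫⁻ z, f z ^ 2 ∂ν) ^ (1 / 2 : ℝ) * (∫⁻ z, g z ^ 2 ∂ν) ^ (1 / 2 : ℝ)) ^ 2 := by
        gcongr
        exact h
    _ = _ := by rw [mul_pow, hsqrt, hsqrt]

lemma lintegral_enorm_sq_eq {g : Z → 𝕜} (hg : Integrable (fun x => ‖g x‖ ^ 2) ν) :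
    ∫⁻ x, ‖g x‖ₑ ^ 2 ∂ν = ‖∫ x, conj (g x) * g x ∂ν‖ₑ := by
  have hconj : ∫ x, conj (g x) * g x ∂ν = ((∫ x, ‖g x‖ ^ 2 ∂ν : ℝ) : 𝕜) := by
    simp only [RCLike.conj_mul, ← integral_ofReal, map_pow]
  have hnonneg : 0 ≤ ∫ x, ‖g x‖ ^ 2 ∂ν := integral_nonneg fun x => by positivity
  rw [hconj, ← ofReal_norm, RCLike.norm_ofReal, abs_of_nonneg hnonneg,
    ofReal_integral_eq_lintegral_ofReal hg (.of_forall fun x => by positivity)]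
  simp only [ENNReal.ofReal_pow (norm_nonneg _), ofReal_norm]

lemma norm_integral_mul_le_mul_integral_norm {f g : Z → 𝕜} {B : ℝ} (hgB : ∀ z, ‖g z‖ ≤ B)
    (hf : Integrable f ν) : ‖∫ z, g z * f z ∂ν‖ ≤ B * ∫ z, ‖f z‖ ∂ν := by
  rw [← integral_const_mul]
  refine norm_integral_le_of_norm_le (hf.norm.const_mul _) (.of_forall fun z => ?_)
  rw [norm_mul]
  gcongr
  exact hgB z

variable [IsFiniteMeasure μ] [IsFiniteMeasure ν] {k : W → Z → 𝕜} {B : ℝ}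

lemma norm_integral_mul_le {F : W → 𝕜} {g : W → 𝕜} {M : ℝ} (hFM : ∀ w, ‖F w‖ ≤ M)
    (hgB : ∀ w, ‖g w‖ ≤ B) : ‖∫ w, F w * g w ∂μ‖ ≤ M * B * μ.real univ :=
  norm_integral_le_of_norm_le_const <| .of_forall fun w => by
    rw [norm_mul]
    exact mul_le_mul (hFM w) (hgB w) (norm_nonneg _) ((norm_nonneg _).trans (hFM w))

lemma integrable_norm_sq_of_bound {F : W → 𝕜} (hF : StronglyMeasurable F) {M : ℝ}
    (hFM : ∀ w, ‖F w‖ ≤ M) : Integrable (fun w => ‖F w‖ ^ 2) μ :=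
  .of_bound (hF.norm.pow 2).aestronglyMeasurable (M ^ 2) <| .of_forall fun w => by
    rw [norm_pow, norm_norm]
    gcongr
    exact hFM w

lemma lintegral_enorm_integral_mul_kernel_sq_le (hk : StronglyMeasurable (Function.uncurry k))
    (hB : ∀ w z, ‖k w z‖ ≤ B) (hH : Measurable (Function.uncurry H))
    (hsymm : ∀ w w', H w w' = H w' w) (hC : ∀ w, ∫⁻ w', H w w' ∂μ ≤ C)
    (hkH : ∀ w w', ‖∫ z, conj (k w z) * k w' z ∂ν‖ₑ ≤ H w w') {F : W → 𝕜}
    (hF : StronglyMeasurable F) {M : ℝ} (hFM : ∀ w, ‖F w‖ ≤ M) :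
    ∫⁻ z, ‖∫ w, F w * k w z ∂μ‖ₑ ^ 2 ∂ν ≤ C * ∫⁻ w, ‖F w‖ₑ ^ 2 ∂μ := by
  have hFk : StronglyMeasurable fun q : W × Z => F q.1 * k q.1 q.2 :=
    (hF.comp_measurable measurable_fst).mul hk
  have hFkM (w : W) (z : Z) : ‖F w * k w z‖ ≤ M * B := by
    rw [norm_mul]
    exact mul_le_mul (hFM w) (hB w z) (norm_nonneg _) ((norm_nonneg _).trans (hFM w))
  have hFk₂ : StronglyMeasurable fun q : Z × (W × W) =>
      conj (F q.2.1 * k q.2.1 q.1) * (F q.2.2 * k q.2.2 q.1) :=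
    (RCLike.continuous_conj.comp_stronglyMeasurable
      (hFk.comp_measurable (g := fun q : Z × (W × W) => (q.2.1, q.1)) (by fun_prop))).mul
      (hFk.comp_measurable (g := fun q : Z × (W × W) => (q.2.2, q.1)) (by fun_prop))
  calc ∫⁻ z, ‖∫ w, F w * k w z ∂μ‖ₑ ^ 2 ∂ν
      = ‖∫ z, conj (∫ w, F w * k w z ∂μ) * ∫ w, F w * k w z ∂μ ∂ν‖ₑ :=
        lintegral_enorm_sq_eq (integrable_norm_sq_of_bound (.integral_prod_left hFk)
          fun z => norm_integral_mul_le hFM fun w => hB w z)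
    _ = ‖∫ z, ∫ p, conj (F p.1 * k p.1 z) * (F p.2 * k p.2 z) ∂μ.prod μ ∂ν‖ₑ := by
        simp only [← integral_conj, ← integral_prod_mul]
    _ = ‖∫ p, ∫ z, conj (F p.1 * k p.1 z) * (F p.2 * k p.2 z) ∂ν ∂μ.prod μ‖ₑ := by
        congr 1
        refine integral_integral_swap (.of_bound hFk₂.aestronglyMeasurable ((M * B) * (M * B))
          (.of_forall fun q => ?_))
        rw [Function.uncurry, norm_mul, RCLike.norm_conj]
        exact mul_le_mul (hFkM _ _) (hFkM _ _) (norm_nonneg _)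
          ((norm_nonneg _).trans (hFkM q.2.1 q.1))
    _ ≤ ∫⁻ p, ‖F p.1‖ₑ * ‖F p.2‖ₑ * H p.1 p.2 ∂μ.prod μ := by
        refine (enorm_integral_le_lintegral_enorm _).trans (lintegral_mono fun p => ?_)
        simp only [map_mul, mul_mul_mul_comm, integral_const_mul, enorm_mul, RCLike.enorm_conj]
        gcongr
        exact hkH _ _
    _ = ∫⁻ w, ∫⁻ w', ‖F w‖ₑ * ‖F w'‖ₑ * H w w' ∂μ ∂μ :=
        lintegral_prod _ (((hF.enorm.comp measurable_fst).mul
          (hF.enorm.comp measurable_snd)).mul hH).aemeasurable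
    _ ≤ C * ∫⁻ w, ‖F w‖ₑ ^ 2 ∂μ := lintegral_lintegral_mul_mul_le hF.enorm hH hsymm hC

lemma lintegral_enorm_integral_kernel_mul_sq_eq (hk : StronglyMeasurable (Function.uncurry k))
    (hB : ∀ w z, ‖k w z‖ ≤ B) {f : Z → 𝕜} (hfm : StronglyMeasurable f) (hf : Integrable f ν) :
    ∫⁻ w, ‖∫ z, k w z * f z ∂ν‖ₑ ^ 2 ∂μ =
      ‖∫ z, (∫ w, conj (∫ z', k w z' * f z' ∂ν) * k w z ∂μ) * f z ∂ν‖ₑ := by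
  set F : W → 𝕜 := fun w => ∫ z, k w z * f z ∂ν
  have hF : StronglyMeasurable F :=
    .integral_prod_right (hk.mul (hfm.comp_measurable measurable_snd))
  have hFM (w : W) : ‖F w‖ ≤ B * ∫ z, ‖f z‖ ∂ν := norm_integral_mul_le_mul_integral_norm (hB w) hf
  have hker : StronglyMeasurable fun q : W × Z => conj (F q.1) * k q.1 q.2 :=
    ((RCLike.continuous_conj.comp_stronglyMeasurable hF).comp_measurable measurable_fst).mul hk
  calc ∫⁻ w, ‖F w‖ₑ ^ 2 ∂μ = ‖∫ w, conj (F w) * F w ∂μ‖ₑ :=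
        lintegral_enorm_sq_eq (integrable_norm_sq_of_bound hF hFM)
    _ = ‖∫ w, ∫ z, conj (F w) * k w z * f z ∂ν ∂μ‖ₑ := by
        simp only [mul_assoc, integral_const_mul, F]
    _ = ‖∫ z, ∫ w, conj (F w) * k w z * f z ∂μ ∂ν‖ₑ := by
        congr 1
        refine integral_integral_swap <| (hf.comp_snd μ).bdd_mul (c := (B * ∫ z, ‖f z‖ ∂ν) * B)
          hker.aestronglyMeasurable (.of_forall fun q => ?_)
        rw [norm_mul, RCLike.norm_conj]
        exact mul_le_mul (hFM _) (hB _ _) (norm_nonneg _) ((norm_nonneg _).trans (hFM q.1))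
    _ = ‖∫ z, (∫ w, conj (F w) * k w z ∂μ) * f z ∂ν‖ₑ := by simp only [integral_mul_const]

lemma lintegral_enorm_integral_kernel_mul_sq_le (hk : StronglyMeasurable (Function.uncurry k))
    (hB : ∀ w z, ‖k w z‖ ≤ B) (hH : Measurable (Function.uncurry H))
    (hsymm : ∀ w w', H w w' = H w' w) (hC : ∀ w, ∫⁻ w', H w w' ∂μ ≤ C)
    (hkH : ∀ w w', ‖∫ z, conj (k w z) * k w' z ∂ν‖ₑ ≤ H w w') {f : Z → 𝕜}
    (hfm : StronglyMeasurable f) (hf : Integrable f ν) :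
    ∫⁻ w, ‖∫ z, k w z * f z ∂ν‖ₑ ^ 2 ∂μ ≤ C * ∫⁻ z, ‖f z‖ₑ ^ 2 ∂ν := by
  set F : W → 𝕜 := fun w => ∫ z, k w z * f z ∂ν
  have hF : StronglyMeasurable F :=
    .integral_prod_right (hk.mul (hfm.comp_measurable measurable_snd))
  have hconj : StronglyMeasurable fun w => conj (F w) :=
    RCLike.continuous_conj.comp_stronglyMeasurable hF
  have hconjM (w : W) : ‖conj (F w)‖ ≤ B * ∫ z, ‖f z‖ ∂ν :=
    (RCLike.norm_conj _).trans_le (norm_integral_mul_le_mul_integral_norm (hB w) hf)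
  have hker : StronglyMeasurable fun q : W × Z => conj (F q.1) * k q.1 q.2 :=
    (hconj.comp_measurable measurable_fst).mul hk
  have hdual : ∫⁻ w, ‖F w‖ₑ ^ 2 ∂μ = ‖∫ z, (∫ w, conj (F w) * k w z ∂μ) * f z ∂ν‖ₑ :=
    lintegral_enorm_integral_kernel_mul_sq_eq hk hB hfm hf
  have hsq : (∫⁻ w, ‖F w‖ₑ ^ 2 ∂μ) ^ 2 ≤
      (C * ∫⁻ z, ‖f z‖ₑ ^ 2 ∂ν) * ∫⁻ w, ‖F w‖ₑ ^ 2 ∂μ :=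
    calc (∫⁻ w, ‖F w‖ₑ ^ 2 ∂μ) ^ 2
        ≤ (∫⁻ z, ‖∫ w, conj (F w) * k w z ∂μ‖ₑ * ‖f z‖ₑ ∂ν) ^ 2 := by
          rw [hdual]
          gcongr
          simpa only [enorm_mul] using enorm_integral_le_lintegral_enorm
            fun z => (∫ w, conj (F w) * k w z ∂μ) * f z
      _ ≤ (∫⁻ z, ‖∫ w, conj (F w) * k w z ∂μ‖ₑ ^ 2 ∂ν) * ∫⁻ z, ‖f z‖ₑ ^ 2 ∂ν :=
          lintegral_mul_sq_le (StronglyMeasurable.integral_prod_left hker).enorm.aemeasurable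
            hfm.enorm.aemeasurable
      _ ≤ (C * ∫⁻ w, ‖F w‖ₑ ^ 2 ∂μ) * ∫⁻ z, ‖f z‖ₑ ^ 2 ∂ν := by
          gcongr
          simpa only [RCLike.enorm_conj] using
            lintegral_enorm_integral_mul_kernel_sq_le hk hB hH hsymm hC hkH hconj hconjM
      _ = _ := by ring
  rcases eq_or_ne (∫⁻ w, ‖F w‖ₑ ^ 2 ∂μ) 0 with h0 | h0
  · exact h0.trans_le zero_le
  · rw [sq] at hsq
    exact (ENNReal.mul_le_mul_iff_left h0 (hdual.trans_ne enorm_ne_top)).1 hsq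

end Schur

/-! ### Almost orthogonality of the kernels -/

section AlmostOrthogonality

variable {𝕜 : Type*} [RCLike 𝕜] {n : ℕ} {α t t' : ℝ} {φ ψ : ℝ^n → 𝕜}

lemma integral_conj_dilate_mul_dilate_eq (hα : 0 < α) (hφ : φ ∈ kernelClass 𝕜 n α)
    (hψ : ψ ∈ kernelClass 𝕜 n α) (ht : 0 < t) (y y' : ℝ^n) :
    ∫ z, conj (dilate φ t (y - z)) * dilate ψ t' (y' - z) = ∫ z in closedBall y t,
      conj (dilate φ t (y - z)) * (dilate ψ t' (y' - z) - dilate ψ t' (y' - y)) := by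
  have hφc : Continuous fun z => conj (dilate φ t (y - z)) :=
    RCLike.continuous_conj.comp (continuous_dilate_sub hα hφ t y)
  have hsupp : HasCompactSupport fun z => conj (dilate φ t (y - z)) :=
    .intro (isCompact_closedBall y t) fun z hz => by rw [dilate_sub_eq_zero hφ ht hz, map_zero]
  have hint : Integrable fun z => conj (dilate φ t (y - z)) * dilate ψ t' (y' - z) :=
    (hφc.mul (continuous_dilate_sub hα hψ t' y')).integrable_of_hasCompactSupport hsupp.mul_right
  rw [setIntegral_eq_integral_of_forall_compl_eq_zero fun z hz => by
    rw [dilate_sub_eq_zero hφ ht hz, map_zero, zero_mul]]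
  simp only [mul_sub]
  rw [integral_sub hint ((hφc.integrable_of_hasCompactSupport hsupp).mul_const _),
    integral_mul_const, integral_conj, integral_dilate_sub hφ, map_zero, zero_mul, sub_zero]

lemma norm_integral_conj_dilate_mul_dilate_le (hα : 0 < α) (hφ : φ ∈ kernelClass 𝕜 n α)
    (hψ : ψ ∈ kernelClass 𝕜 n α) (ht : 0 < t) (ht' : 0 < t') (y y' : ℝ^n) :
    ‖∫ z, conj (dilate φ t (y - z)) * dilate ψ t' (y' - z)‖ ≤
      2 ^ α * volume.real (ball (0 : ℝ^n) 1) * ((t' ^ n)⁻¹ * (t / t') ^ α) := by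
  rw [integral_conj_dilate_mul_dilate_eq hα hφ hψ ht]
  calc ‖∫ z in closedBall y t,
        conj (dilate φ t (y - z)) * (dilate ψ t' (y' - z) - dilate ψ t' (y' - y))‖
      ≤ 2 ^ α * (t ^ n)⁻¹ * ((t' ^ n)⁻¹ * (t / t') ^ α) * volume.real (closedBall y t) := by
        refine norm_setIntegral_le_of_norm_le_const measure_closedBall_lt_top fun z hz => ?_
        rw [norm_mul, RCLike.norm_conj]
        gcongr
        · exact norm_dilate_le hα hφ ht _
        · refine (norm_dilate_sub_dilate_le hψ ht' _ _).trans ?_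
          rw [sub_sub_sub_cancel_left, ← dist_eq_norm, dist_comm]
          gcongr
          exact hz
    _ = _ := by
        rw [Measure.addHaar_real_closedBall _ _ ht.le, finrank_euclideanSpace_fin]
        field_simp

lemma integral_conj_dilate_mul_dilate_eq_zero (hφ : φ ∈ kernelClass 𝕜 n α)
    (hψ : ψ ∈ kernelClass 𝕜 n α) (ht : 0 < t) (ht' : 0 < t') {y y' : ℝ^n}
    (h : t + t' < ‖y - y'‖) : ∫ z, conj (dilate φ t (y - z)) * dilate ψ t' (y' - z) = 0 := by
  refine integral_eq_zero_of_ae (.of_forall fun z => ?_)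
  by_cases hz : t < ‖y - z‖
  · simp only [dilate_eq_zero hφ ht hz, map_zero, zero_mul, Pi.zero_apply]
  · have hz' : t' < ‖y' - z‖ := by
      have := norm_sub_le (y - z) (y' - z)
      rw [sub_sub_sub_cancel_right] at this
      linarith
    simp only [dilate_eq_zero hψ ht' hz', mul_zero, Pi.zero_apply]

/-- An upper bound for the inner product of two dilated kernels centred at `w.1`, `w'.1` of scales
`w.2`, `w'.2`. -/
def crossBound (n : ℕ) (α : ℝ) (w w' : ℝ^n × ℝ) : ℝ≥0∞ :=
  {p : (ℝ^n × ℝ) × (ℝ^n × ℝ) | 0 < p.1.2 ∧ 0 < p.2.2 ∧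
      ‖p.1.1 - p.2.1‖ ≤ 2 * max p.1.2 p.2.2}.indicator
    (fun p => ENNReal.ofReal (2 ^ α * volume.real (ball (0 : ℝ^n) 1) * ((max p.1.2 p.2.2 ^ n)⁻¹ *
      (min p.1.2 p.2.2 / max p.1.2 p.2.2) ^ α))) (w, w')

lemma crossBound_symm (w w' : ℝ^n × ℝ) : crossBound n α w w' = crossBound n α w' w := by
  simp only [crossBound, indicator, mem_ofPred_eq, max_comm w.2, min_comm w.2, norm_sub_rev w.1,
    and_left_comm]

lemma measurable_crossBound : Measurable (Function.uncurry (crossBound n α)) := by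
  have hpos : MeasurableSet {p : (ℝ^n × ℝ) × (ℝ^n × ℝ) | 0 < p.1.2} :=
    measurableSet_lt (by fun_prop) (by fun_prop)
  have hpos' : MeasurableSet {p : (ℝ^n × ℝ) × (ℝ^n × ℝ) | 0 < p.2.2} :=
    measurableSet_lt (by fun_prop) (by fun_prop)
  have hdist : MeasurableSet {p : (ℝ^n × ℝ) × (ℝ^n × ℝ) | ‖p.1.1 - p.2.1‖ ≤ 2 * max p.1.2 p.2.2} :=
    measurableSet_le (by fun_prop) (by fun_prop)
  exact Measurable.indicator (by fun_prop) (hpos.inter (hpos'.inter hdist))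

lemma enorm_integral_conj_dilate_mul_dilate_le (hα : 0 < α) (hφ : φ ∈ kernelClass 𝕜 n α)
    (hψ : ψ ∈ kernelClass 𝕜 n α) {w w' : ℝ^n × ℝ} (hw : 0 < w.2) (hw' : 0 < w'.2) :
    ‖∫ z, conj (dilate φ w.2 (w.1 - z)) * dilate ψ w'.2 (w'.1 - z)‖ₑ ≤ crossBound n α w w' := by
  wlog h : w.2 ≤ w'.2 generalizing φ ψ w w'
  · rw [crossBound_symm, ← RCLike.enorm_conj, ← integral_conj]
    simpa only [map_mul, RCLike.conj_conj, mul_comm] using this hψ hφ hw' hw (le_of_not_ge h)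
  by_cases hd : ‖w.1 - w'.1‖ ≤ 2 * max w.2 w'.2
  · rw [crossBound, indicator_of_mem (mem_ofPred_eq.mpr ⟨hw, hw', hd⟩), max_eq_right h,
      min_eq_left h, ← ofReal_norm]
    exact ENNReal.ofReal_le_ofReal
      (norm_integral_conj_dilate_mul_dilate_le hα hφ hψ hw hw' w.1 w'.1)
  · rw [integral_conj_dilate_mul_dilate_eq_zero hφ hψ hw hw', enorm_zero]
    · exact zero_le
    · linarith [le_max_left w.2 w'.2, le_max_right w.2 w'.2]

lemma lintegral_Ioi_rpow {a : ℝ} (ha : a < -1) {R : ℝ} (hR : 0 < R) :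
    ∫⁻ t in Ioi R, ENNReal.ofReal (t ^ a) = ENNReal.ofReal (-R ^ (a + 1) / (a + 1)) := by
  rw [← integral_Ioi_rpow_of_lt ha hR,
    ofReal_integral_eq_lintegral_ofReal (integrableOn_Ioi_rpow_of_lt ha hR)]
  refine (ae_restrict_iff' measurableSet_Ioi).2 (.of_forall fun s hs => ?_)
  have : 0 < s := hR.trans hs
  positivity

lemma lintegral_min_rpow {s b : ℝ} (hs : 0 < s) (hb : s < b) {R : ℝ} (hR : 0 < R) :
    ∫⁻ t in Ioi (0 : ℝ), ENNReal.ofReal (min 1 (t / R) ^ b * t ^ (-s - 1)) =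
      ENNReal.ofReal (R ^ (-s) * (1 / (b - s) + 1 / s)) := by
  have : 0 < b - s := sub_pos.2 hb
  rw [← Ioo_union_Ici_eq_Ioi hR, lintegral_union measurableSet_Ici
    ((Iio_disjoint_Ici le_rfl).mono_left Ioo_subset_Iio_self),
    setLIntegral_congr Ioi_ae_eq_Ici.symm, mul_add,
    ENNReal.ofReal_add (by positivity) (by positivity)]
  congr 1
  · have hsmall : ∀ t ∈ Ioo 0 R, ENNReal.ofReal (min 1 (t / R) ^ b * t ^ (-s - 1)) =
        ENNReal.ofReal (R ^ (-b)) * ENNReal.ofReal (t ^ (b - s - 1)) := by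
      intro t ht
      have ht0 := ht.1
      rw [← ENNReal.ofReal_mul (by positivity), min_eq_right ((div_le_one hR).2 ht.2.le),
        Real.div_rpow ht0.le hR.le, Real.rpow_neg hR.le,
        show b - s - 1 = b + (-s - 1) by ring, Real.rpow_add ht0]
      congr 1
      ring
    rw [setLIntegral_congr_fun measurableSet_Ioo hsmall, lintegral_const_mul' _ _ (by finiteness),
      lintegral_Ioo_rpow (by linarith) hR.le, ← ENNReal.ofReal_mul (by positivity), sub_add_cancel,
      show -s = -b + (b - s) by ring, Real.rpow_add hR]
    congr 1
    ring
  · have hlarge : ∀ t ∈ Ioi R, ENNReal.ofReal (min 1 (t / R) ^ b * t ^ (-s - 1)) =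
        ENNReal.ofReal (t ^ (-s - 1)) := fun t ht => by
      rw [min_eq_left ((one_le_div hR).2 (le_of_lt ht)), Real.one_rpow, one_mul]
    rw [setLIntegral_congr_fun measurableSet_Ioi hlarge, lintegral_Ioi_rpow (by linarith) hR,
      sub_add_cancel]
    congr 1
    field_simp

lemma min_div_max_rpow {a : ℝ} (ha : 0 < a) (ht : 0 < t) :
    (min a t / max a t) ^ α = a ^ α * min 1 (t / a) ^ (2 * α) * t ^ (-α) := by
  rcases le_total t a with h | h
  · rw [min_eq_right h, max_eq_left h, min_eq_right ((div_le_one ha).2 h), two_mul,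
      Real.rpow_add (by positivity), Real.div_rpow ht.le ha.le, Real.rpow_neg ht.le]
    field_simp
  · rw [min_eq_left h, max_eq_right h, min_eq_left ((one_le_div ha).2 h), Real.one_rpow,
      Real.div_rpow ha.le ht.le, Real.rpow_neg ht.le]
    field_simp

lemma lintegral_crossBound_le (w : ℝ^n × ℝ) (t : ℝ) :
    ∫⁻ y, crossBound n α w (y, t) ≤
      ENNReal.ofReal (2 ^ α * volume.real (ball (0 : ℝ^n) 1) * 2 ^ n) * volume (ball (0 : ℝ^n) 1) *
        ENNReal.ofReal ((min w.2 t / max w.2 t) ^ α) := by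
  by_cases hpos : 0 < w.2 ∧ 0 < t
  swap
  · have hzero : ∀ y, crossBound n α w (y, t) = 0 := fun y =>
      indicator_of_notMem (fun h => hpos ⟨h.1, h.2.1⟩) _
    simp only [hzero, lintegral_zero, zero_le]
  have hmax : 0 < max w.2 t := lt_max_of_lt_left hpos.1
  have hmin : 0 ≤ min w.2 t := le_min hpos.1.le hpos.2.le
  calc ∫⁻ y, crossBound n α w (y, t)
      ≤ ∫⁻ y, (closedBall w.1 (2 * max w.2 t)).indicator (fun _ => ENNReal.ofReal
          (2 ^ α * volume.real (ball (0 : ℝ^n) 1) *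
            ((max w.2 t ^ n)⁻¹ * (min w.2 t / max w.2 t) ^ α))) y := by
        refine lintegral_mono fun y => ?_
        by_cases hy : y ∈ closedBall w.1 (2 * max w.2 t)
        · rw [indicator_of_mem hy]
          exact indicator_le_self _ _ _
        · rw [indicator_of_notMem hy, crossBound, indicator_of_notMem]
          rw [mem_closedBall, dist_comm, dist_eq_norm] at hy
          exact fun h => hy h.2.2
    _ = _ := by
        rw [lintegral_indicator_const measurableSet_closedBall,
          Measure.addHaar_closedBall _ _ (by positivity), finrank_euclideanSpace_fin,
          ← mul_assoc, mul_right_comm _ (volume _), ← ENNReal.ofReal_mul (by positivity),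
          ← ENNReal.ofReal_mul (by positivity)]
        congr 2
        field_simp
        ring

lemma exists_setLIntegral_crossBound_le (n : ℕ) (hα : 0 < α) :
    ∃ C : ℝ≥0∞, C ≠ ∞ ∧ ∀ w : ℝ^n × ℝ,
      ∫⁻ w' in upperHalfSpace n, ENNReal.ofReal w'.2⁻¹ * crossBound n α w w' ≤ C := by
  refine ⟨ENNReal.ofReal (2 ^ α * volume.real (ball (0 : ℝ^n) 1) * 2 ^ n) *
    volume (ball (0 : ℝ^n) 1) * ENNReal.ofReal (1 / (2 * α - α) + 1 / α), by finiteness,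
    fun w => ?_⟩
  rcases le_or_gt w.2 0 with hw | hw
  · have : ∀ w', crossBound n α w w' = 0 := fun w' => indicator_of_notMem (fun h => hw.not_gt h.1) _
    simp only [this, mul_zero, lintegral_zero, zero_le]
  set A := ENNReal.ofReal (2 ^ α * volume.real (ball (0 : ℝ^n) 1) * 2 ^ n) *
    volume (ball (0 : ℝ^n) 1)
  calc ∫⁻ w' in upperHalfSpace n, ENNReal.ofReal w'.2⁻¹ * crossBound n α w w'
      = ∫⁻ t in Ioi (0 : ℝ), ENNReal.ofReal t⁻¹ * ∫⁻ y, crossBound n α w (y, t) := by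
        rw [lintegral_upperHalfSpace (g := fun w' => ENNReal.ofReal w'.2⁻¹ * crossBound n α w w')
          (Measurable.mul (by fun_prop) measurable_crossBound.of_uncurry_left)]
        exact lintegral_congr fun t =>
          lintegral_const_mul' (ENNReal.ofReal t⁻¹) _ ENNReal.ofReal_ne_top
    _ ≤ ∫⁻ t in Ioi (0 : ℝ), A * ENNReal.ofReal (w.2 ^ α) *
          ENNReal.ofReal (min 1 (t / w.2) ^ (2 * α) * t ^ (-α - 1)) := by
        refine setLIntegral_mono' measurableSet_Ioi fun t (ht : 0 < t) => ?_
        refine (mul_le_mul_right (lintegral_crossBound_le w t) _).trans_eq ?_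
        rw [mul_left_comm, mul_assoc A, ← ENNReal.ofReal_mul (by positivity),
          ← ENNReal.ofReal_mul (by positivity), min_div_max_rpow hw ht, Real.rpow_sub_one ht.ne']
        congr 2
        ring
    _ = A * ENNReal.ofReal (1 / (2 * α - α) + 1 / α) := by
        rw [lintegral_const_mul' _ _ (by finiteness), lintegral_min_rpow hα (by linarith) hw,
          mul_assoc, ← ENNReal.ofReal_mul (by positivity), ← mul_assoc, ← Real.rpow_add hw,
          add_neg_cancel, Real.rpow_zero, one_mul]

end AlmostOrthogonality

/-! ### The `L²` bound for `A_α` -/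

section LTwoBound

variable {𝕜 : Type*} [RCLike 𝕜] {n N : ℕ} {α : ℝ} {f : ℝ^n → 𝕜} {φ : ℕ → ℝ^n → 𝕜}
  {j : ℝ^n × ℝ → ℕ}

/-- The `N`-th compact set in an exhaustion of the upper half space. -/
def truncBox (n N : ℕ) : Set (ℝ^n × ℝ) := closedBall 0 N ×ˢ Icc ((N : ℝ) + 1)⁻¹ N

lemma measurableSet_truncBox (n N : ℕ) : MeasurableSet (truncBox n N) :=
  measurableSet_closedBall.prod measurableSet_Icc

lemma snd_pos_of_mem_truncBox {q : ℝ^n × ℝ} (hq : q ∈ truncBox n N) : 0 < q.2 :=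
  lt_of_lt_of_le (by positivity) hq.2.1

lemma inv_snd_le_of_mem_truncBox {q : ℝ^n × ℝ} (hq : q ∈ truncBox n N) : q.2⁻¹ ≤ N + 1 :=
  (inv_le_comm₀ (snd_pos_of_mem_truncBox hq) (by positivity)).2 hq.2.1

lemma truncBox_subset (n N : ℕ) : truncBox n N ⊆ upperHalfSpace n :=
  fun _ hq => mem_upperHalfSpace.2 (snd_pos_of_mem_truncBox hq)

lemma eventually_mem_truncBox {q : ℝ^n × ℝ} (hq : 0 < q.2) :
    ∀ᶠ N : ℕ in atTop, q ∈ truncBox n N := by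
  have h := tendsto_natCast_atTop_atTop (R := ℝ)
  filter_upwards [h.eventually_ge_atTop ‖q.1‖, h.eventually_ge_atTop q.2,
    h.eventually_ge_atTop q.2⁻¹] with N hfst hsnd hinv
  refine ⟨mem_closedBall_zero_iff.2 hfst, ?_, hsnd⟩
  rw [inv_le_comm₀ (by positivity) hq]
  linarith

/-- The measure `dy dt / t` restricted to `truncBox n N`. -/
def truncMeasure (n N : ℕ) : Measure (ℝ^n × ℝ) :=
  (volume.restrict (truncBox n N)).withDensity fun q => ENNReal.ofReal q.2⁻¹

instance (n N : ℕ) : IsFiniteMeasure (truncMeasure n N) := by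
  have hbound : ENNReal.ofReal (N + 1) * volume (truncBox n N) ≠ ∞ :=
    ENNReal.mul_ne_top ENNReal.ofReal_ne_top
      ((isCompact_closedBall _ _).prod isCompact_Icc).measure_ne_top
  refine isFiniteMeasure_withDensity (ne_top_of_le_ne_top hbound ?_)
  rw [← setLIntegral_const]
  exact setLIntegral_mono' (measurableSet_truncBox n N) fun q hq =>
    ENNReal.ofReal_le_ofReal (inv_snd_le_of_mem_truncBox hq)

lemma lintegral_truncMeasure {g : ℝ^n × ℝ → ℝ≥0∞} (hg : Measurable g) :
    ∫⁻ q, g q ∂truncMeasure n N = ∫⁻ q in truncBox n N, ENNReal.ofReal q.2⁻¹ * g q :=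
  lintegral_withDensity_eq_lintegral_mul _ (by fun_prop) hg

/-- The kernel `z ↦ φ_t(y - z)`, where `φ` is the member of a sequence selected by `j (y, t)`,
restricted to `(y, t)` in `truncBox n N`. -/
def truncKernel (φ : ℕ → ℝ^n → 𝕜) (j : ℝ^n × ℝ → ℕ) (N : ℕ) (w : ℝ^n × ℝ) (z : ℝ^n) : 𝕜 :=
  (truncBox n N).indicator (fun w => dilate (φ (j w)) w.2 (w.1 - z)) w

lemma truncKernel_of_mem {w : ℝ^n × ℝ} (hw : w ∈ truncBox n N) :
    truncKernel φ j N w = fun z => dilate (φ (j w)) w.2 (w.1 - z) :=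
  funext fun _ => indicator_of_mem hw _

lemma truncKernel_of_notMem {w : ℝ^n × ℝ} (hw : w ∉ truncBox n N) : truncKernel φ j N w = 0 :=
  funext fun _ => indicator_of_notMem hw _

lemma stronglyMeasurable_truncKernel (hα : 0 < α) (hφ : ∀ i, φ i ∈ kernelClass 𝕜 n α)
    (hj : Measurable j) (N : ℕ) : StronglyMeasurable (Function.uncurry (truncKernel φ j N)) := by
  have hseq : Measurable fun p : ℕ × ((ℝ^n × ℝ) × ℝ^n) =>
      dilate (φ p.1) p.2.1.2 (p.2.1.1 - p.2.2) := by
    refine measurable_from_prod_countable_right fun i => ?_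
    have hφi : Measurable (φ i) := (continuous_of_mem_kernelClass hα (hφ i)).measurable
    exact Measurable.smul (by fun_prop) (hφi.comp (by fun_prop))
  have hsel : Measurable fun p : (ℝ^n × ℝ) × ℝ^n => dilate (φ (j p.1)) p.1.2 (p.1.1 - p.2) :=
    hseq.comp ((hj.comp measurable_fst).prodMk measurable_id)
  exact (hsel.indicator (measurable_fst (measurableSet_truncBox n N))).stronglyMeasurable

lemma norm_truncKernel_le (hα : 0 < α) (hφ : ∀ i, φ i ∈ kernelClass 𝕜 n α) (w : ℝ^n × ℝ)
    (z : ℝ^n) : ‖truncKernel φ j N w z‖ ≤ 2 ^ α * ((N : ℝ) + 1) ^ n := by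
  by_cases hw : w ∈ truncBox n N
  · have ht := snd_pos_of_mem_truncBox hw
    rw [truncKernel_of_mem hw]
    refine (norm_dilate_le hα (hφ _) ht _).trans ?_
    rw [← inv_pow]
    gcongr
    exact inv_snd_le_of_mem_truncBox hw
  · rw [truncKernel_of_notMem hw, Pi.zero_apply, norm_zero]
    positivity

lemma truncKernel_eq_zero (hφ : ∀ i, φ i ∈ kernelClass 𝕜 n α) (w : ℝ^n × ℝ) {z : ℝ^n}
    (hz : z ∉ closedBall 0 (2 * N)) : truncKernel φ j N w z = 0 := by
  by_cases hw : w ∈ truncBox n N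
  · rw [truncKernel_of_mem hw]
    refine dilate_eq_zero (hφ _) (snd_pos_of_mem_truncBox hw) ?_
    have hy : ‖w.1‖ ≤ N := mem_closedBall_zero_iff.1 hw.1
    have ht : w.2 ≤ N := hw.2.2
    have hz : 2 * N < ‖z‖ := by simpa using hz
    have := norm_sub_le w.1 (w.1 - z)
    rw [sub_sub_cancel] at this
    linarith
  · rw [truncKernel_of_notMem hw, Pi.zero_apply]

lemma enorm_integral_conj_truncKernel_mul_le (hα : 0 < α) (hφ : ∀ i, φ i ∈ kernelClass 𝕜 n α)
    (w w' : ℝ^n × ℝ) :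
    ‖∫ z in closedBall 0 (2 * N), conj (truncKernel φ j N w z) * truncKernel φ j N w' z‖ₑ ≤
      crossBound n α w w' := by
  rw [setIntegral_eq_integral_of_forall_compl_eq_zero fun z hz => by
    rw [truncKernel_eq_zero hφ w hz, map_zero, zero_mul]]
  by_cases hw : w ∈ truncBox n N
  swap
  · simp [truncKernel_of_notMem hw]
  by_cases hw' : w' ∈ truncBox n N
  swap
  · simp [truncKernel_of_notMem hw']
  rw [truncKernel_of_mem hw, truncKernel_of_mem hw']
  exact enorm_integral_conj_dilate_mul_dilate_le hα (hφ _) (hφ _) (snd_pos_of_mem_truncBox hw)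
    (snd_pos_of_mem_truncBox hw')

lemma setLIntegral_truncBox_convExt_sq_le (hα : 0 < α) {C : ℝ≥0∞}
    (hC : ∀ w : ℝ^n × ℝ,
      ∫⁻ w' in upperHalfSpace n, ENNReal.ofReal w'.2⁻¹ * crossBound n α w w' ≤ C)
    (hφ : ∀ i, φ i ∈ kernelClass 𝕜 n α) (hj : Measurable j) (N : ℕ) (hfm : StronglyMeasurable f)
    (hf : LocallyIntegrable f volume) :
    ∫⁻ q in truncBox n N, ENNReal.ofReal q.2⁻¹ * convExt (φ (j q)) f q ^ 2 ≤
      C * ∫⁻ z, ‖f z‖ₑ ^ 2 := by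
  have hkm := stronglyMeasurable_truncKernel hα hφ hj N
  have hrow (w : ℝ^n × ℝ) : ∫⁻ w', crossBound n α w w' ∂truncMeasure n N ≤ C := by
    rw [lintegral_truncMeasure measurable_crossBound.of_uncurry_left]
    exact (lintegral_mono_set (truncBox_subset n N)).trans (hC w)
  have : IsFiniteMeasure (volume.restrict (closedBall (0 : ℝ^n) (2 * N))) :=
    isFiniteMeasure_restrict.2 measure_closedBall_lt_top.ne
  have hconv : ∀ q ∈ truncBox n N,
      convExt (φ (j q)) f q = ‖∫ z in closedBall 0 (2 * N), truncKernel φ j N q z * f z‖ₑ := by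
    intro q hq
    rw [convExt, indicator_of_mem (truncBox_subset n N hq),
      setIntegral_eq_integral_of_forall_compl_eq_zero fun z hz => by
        rw [truncKernel_eq_zero hφ q hz, zero_mul], truncKernel_of_mem hq]
  have hmeas : Measurable fun w =>
      ‖∫ z in closedBall 0 (2 * N), truncKernel φ j N w z * f z‖ₑ ^ 2 :=
    (StronglyMeasurable.integral_prod_right
      (hkm.mul (hfm.comp_measurable measurable_snd))).enorm.pow_const 2
  calc ∫⁻ q in truncBox n N, ENNReal.ofReal q.2⁻¹ * convExt (φ (j q)) f q ^ 2
      = ∫⁻ q, ‖∫ z in closedBall 0 (2 * N), truncKernel φ j N q z * f z‖ₑ ^ 2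
          ∂truncMeasure n N := by
        rw [lintegral_truncMeasure hmeas]
        exact setLIntegral_congr_fun (measurableSet_truncBox n N) fun q hq => by
          simp only [hconv q hq]
    _ ≤ C * ∫⁻ z in closedBall 0 (2 * N), ‖f z‖ₑ ^ 2 :=
        lintegral_enorm_integral_kernel_mul_sq_le hkm (norm_truncKernel_le hα hφ)
          measurable_crossBound crossBound_symm hrow (enorm_integral_conj_truncKernel_mul_le hα hφ)
          hfm (hf.integrableOn_isCompact (isCompact_closedBall _ _))
    _ ≤ C * ∫⁻ z, ‖f z‖ₑ ^ 2 := mul_le_mul_right (setLIntegral_le_lintegral _ _) _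

lemma exists_measurable_argmax {X : Type*} [MeasurableSpace X] {a : ℕ → X → ℝ≥0∞}
    (ha : ∀ i, Measurable (a i)) (N : ℕ) :
    ∃ j : X → ℕ, Measurable j ∧ ∀ x, ∀ i ≤ N, a i x ≤ a (j x) x := by
  induction N with
  | zero => exact ⟨fun _ => 0, measurable_const, fun x i hi => by rw [Nat.le_zero.1 hi]⟩
  | succ N ih =>
    obtain ⟨j, hj, hja⟩ := ih
    have hm : Measurable fun x => a (j x) x :=
      (measurable_from_prod_countable_right (f := fun p : ℕ × X => a p.1 p.2) ha).comp
        (hj.prodMk measurable_id)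
    refine ⟨fun x => if a (j x) x ≤ a (N + 1) x then N + 1 else j x,
      Measurable.ite (measurableSet_le hm (ha _)) measurable_const hj, fun x i hi => ?_⟩
    dsimp only
    obtain hi | rfl := Nat.le_succ_iff.1 hi
    · split_ifs with h
      exacts [(hja x i hi).trans h, hja x i hi]
    · split_ifs with h
      exacts [le_rfl, (not_le.1 h).le]

lemma exists_seq_maximalConvExt_eq_iSup (hα : 0 < α) (hf : LocallyIntegrable f volume) :
    ∃ φ : ℕ → ℝ^n → 𝕜, (∀ i, φ i ∈ kernelClass 𝕜 n α) ∧
      ∀ q, maximalConvExt α f q = ⨆ i, convExt (φ i) f q := by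
  have hlub : IsLUB ((convExt (n := n) · f) '' kernelClass 𝕜 n α) (maximalConvExt α f) := by
    have : maximalConvExt α f = sSup ((convExt (n := n) · f) '' kernelClass 𝕜 n α) := by
      ext q
      simp only [maximalConvExt_eq_iSup, sSup_image, iSup_apply]
    rw [this]
    exact isLUB_sSup _
  obtain ⟨S, hS, hScount, hSlub⟩ := exists_countable_lowerSemicontinuous_isLUB
    (by rintro _ ⟨φ, hφ, rfl⟩; exact lowerSemicontinuous_convExt hα hφ hf) hlub
  obtain ⟨g, hg⟩ := (hScount.insert (convExt (0 : ℝ^n → 𝕜) f)).exists_eq_range (insert_nonempty _ _)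
  have hgS (i : ℕ) : ∃ φ ∈ kernelClass 𝕜 n α, convExt φ f = g i := by
    obtain hi | hi := mem_insert_iff.1 (hg ▸ mem_range_self i)
    exacts [⟨0, zero_mem_kernelClass 𝕜 n α, hi.symm⟩, hS hi]
  choose φ hφ hφg using hgS
  refine ⟨φ, hφ, fun q => le_antisymm ?_ (iSup_le fun i => hlub.1 ⟨φ i, hφ i, rfl⟩ q)⟩
  have hle : maximalConvExt α f ≤ fun q => ⨆ i, convExt (φ i) f q := by
    refine hSlub.2 fun s hs => ?_
    obtain ⟨i, rfl⟩ : s ∈ range g := hg ▸ mem_insert_of_mem _ hs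
    rw [← hφg]
    exact fun q => le_iSup (fun i => convExt (φ i) f q) i
  exact hle q

lemma exists_lintegral_maximalConvExt_sq_le (𝕜 : Type*) [RCLike 𝕜] (n : ℕ) (hα : 0 < α) :
    ∃ C : ℝ≥0∞, C ≠ ∞ ∧ ∀ f : ℝ^n → 𝕜, StronglyMeasurable f → LocallyIntegrable f volume →
      ∫⁻ q in upperHalfSpace n, ENNReal.ofReal q.2⁻¹ * maximalConvExt α f q ^ 2 ≤
        C * ∫⁻ z, ‖f z‖ₑ ^ 2 := by
  obtain ⟨C, hC_top, hC⟩ := exists_setLIntegral_crossBound_le n hα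
  refine ⟨C, hC_top, fun f hfm hf => ?_⟩
  obtain ⟨φ, hφ, hsup⟩ := exists_seq_maximalConvExt_eq_iSup hα hf
  have hconv (i : ℕ) : Measurable (convExt (φ i) f) :=
    (lowerSemicontinuous_convExt hα (hφ i) hf).measurable
  choose j hj hmax using exists_measurable_argmax hconv
  set S : ℕ → ℝ^n × ℝ → ℝ≥0∞ := fun N => (truncBox n N).indicator
    fun q => ENNReal.ofReal q.2⁻¹ * convExt (φ (j N q)) f q ^ 2 with hS
  have hSm (N : ℕ) : Measurable (S N) := by
    have hsel : Measurable fun q => convExt (φ (j N q)) f q :=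
      (measurable_from_prod_countable_right
        (f := fun p : ℕ × (ℝ^n × ℝ) => convExt (φ p.1) f p.2) hconv).comp
        ((hj N).prodMk measurable_id)
    exact Measurable.indicator (by fun_prop) (measurableSet_truncBox n N)
  have hlim : ∀ q ∈ upperHalfSpace n, ENNReal.ofReal q.2⁻¹ * maximalConvExt α f q ^ 2 ≤
      liminf (fun N => S N q) atTop := by
    intro q hq
    rw [hsup, ENNReal.iSup_pow, ENNReal.mul_iSup]
    refine iSup_le fun i => le_liminf_of_le (by isBoundedDefault) ?_
    filter_upwards [eventually_mem_truncBox (mem_upperHalfSpace.1 hq), eventually_ge_atTop i]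
      with N hN hiN
    simp only [hS, indicator_of_mem hN]
    gcongr
    exact hmax N q i hiN
  have hSle (N : ℕ) : ∫⁻ q in upperHalfSpace n, S N q ≤ C * ∫⁻ z, ‖f z‖ₑ ^ 2 := by
    refine (setLIntegral_le_lintegral _ _).trans ?_
    rw [hS, lintegral_indicator (measurableSet_truncBox n N)]
    exact setLIntegral_truncBox_convExt_sq_le hα hC hφ (hj N) N hfm hf
  calc ∫⁻ q in upperHalfSpace n, ENNReal.ofReal q.2⁻¹ * maximalConvExt α f q ^ 2
      ≤ ∫⁻ q in upperHalfSpace n, liminf (fun N => S N q) atTop :=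
        setLIntegral_mono' (measurableSet_upperHalfSpace n) hlim
    _ ≤ liminf (fun N => ∫⁻ q in upperHalfSpace n, S N q) atTop := lintegral_liminf_le hSm
    _ ≤ C * ∫⁻ z, ‖f z‖ₑ ^ 2 :=
        liminf_le_of_le (by isBoundedDefault) fun b hb => hb.exists.elim fun N hN =>
          hN.trans (hSle N)

end LTwoBound

/-! ### The weighted `L²` inequality -/

section WeightedLTwo

variable {𝕜 : Type*} [RCLike 𝕜] {n : ℕ} {α b lam t : ℝ} {f : ℝ^n → 𝕜} {w : ℝ^n → ℝ≥0∞}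

lemma tsum_ofReal_inv_pow_rpow_mul_ne_top (hb : n < b) :
    ∑' k : ℕ, ENNReal.ofReal ((2 ^ k)⁻¹ ^ b * (2 ^ (k + 1)) ^ n) ≠ ∞ := by
  have hgeom (k : ℕ) : ((2 : ℝ) ^ k)⁻¹ ^ b * (2 ^ (k + 1)) ^ n = 2 ^ n * (2 ^ (n - b)) ^ k := by
    rw [← inv_pow, ← Real.rpow_natCast_mul (by norm_num), mul_comm (k : ℝ) b,
      Real.rpow_mul_natCast (by norm_num), Real.inv_rpow zero_le_two,
      Real.rpow_sub zero_lt_two, Real.rpow_natCast, div_eq_mul_inv]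
    ring
  have hlt : ENNReal.ofReal (2 ^ (n - b)) < 1 :=
    ENNReal.ofReal_lt_one.2 (Real.rpow_lt_one_of_one_lt_of_neg one_lt_two (by linarith))
  simp_rw [hgeom, ENNReal.ofReal_mul (pow_nonneg zero_le_two n),
    ENNReal.ofReal_pow (Real.rpow_nonneg zero_le_two _), ENNReal.tsum_mul_left,
    ENNReal.tsum_geometric]
  exact ENNReal.mul_ne_top ENNReal.ofReal_ne_top (ENNReal.inv_ne_top.2 (tsub_pos_of_lt hlt).ne')

lemma ofReal_div_rpow_mul_le_tsum (hb : 0 ≤ b) (w : ℝ^n → ℝ≥0∞) (ht : 0 < t) (x y : ℝ^n) :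
    ENNReal.ofReal ((t / (t + ‖x - y‖)) ^ b) * w x ≤
      ∑' k : ℕ, (ball y (2 ^ (k + 1) * t)).indicator
        (fun x => ENNReal.ofReal ((2 ^ k)⁻¹ ^ b) * w x) x := by
  have h1 : 1 ≤ (t + ‖x - y‖) / t := by
    rw [one_le_div ht]
    linarith [norm_nonneg (x - y)]
  obtain ⟨k, hk, hk'⟩ := exists_nat_pow_near h1 one_lt_two
  have hx : x ∈ ball y (2 ^ (k + 1) * t) := by
    rw [div_lt_iff₀ ht] at hk'
    rw [mem_ball_iff_norm]
    linarith
  refine le_trans ?_ (ENNReal.le_tsum k)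
  rw [indicator_of_mem hx, ← inv_div]
  gcongr

lemma exists_lintegral_div_rpow_mul_le_maximalFn (hb : n < b) :
    ∃ C : ℝ≥0∞, C ≠ ∞ ∧ ∀ w : ℝ^n → ℝ≥0∞, Measurable w → ∀ (y : ℝ^n) (t : ℝ), 0 < t →
      ∀ x' ∈ closedBall y t, ∫⁻ x, ENNReal.ofReal ((t / (t + ‖x - y‖)) ^ b) * w x ≤
        C * ENNReal.ofReal (t ^ n) * maximalFn volume w x' := by
  refine ⟨(∑' k : ℕ, ENNReal.ofReal ((2 ^ k)⁻¹ ^ b * (2 ^ (k + 1)) ^ n)) *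
    volume (ball (0 : ℝ^n) 1), ENNReal.mul_ne_top (tsum_ofReal_inv_pow_rpow_mul_ne_top hb)
    measure_ball_lt_top.ne, fun w hw y t ht x' hx' => ?_⟩
  have hball (k : ℕ) : ∫⁻ x in ball y (2 ^ (k + 1) * t), w x ≤ maximalFn volume w x' *
      (ENNReal.ofReal ((2 ^ (k + 1)) ^ n) * ENNReal.ofReal (t ^ n) *
        volume (ball (0 : ℝ^n) 1)) := by
    have hpow : (1 : ℝ) < 2 ^ (k + 1) := one_lt_pow₀ one_lt_two k.succ_ne_zero
    have hmem : x' ∈ ball y (2 ^ (k + 1) * t) :=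
      closedBall_subset_ball (lt_mul_of_one_lt_left ht hpow) hx'
    refine (setLIntegral_ball_le_maximalFn_mul hmem).trans_eq ?_
    rw [Measure.addHaar_ball_of_pos _ _ (by positivity), finrank_euclideanSpace_fin, mul_pow,
      ENNReal.ofReal_mul (by positivity)]
  calc ∫⁻ x, ENNReal.ofReal ((t / (t + ‖x - y‖)) ^ b) * w x
      ≤ ∫⁻ x, ∑' k : ℕ, (ball y (2 ^ (k + 1) * t)).indicator
          (fun x => ENNReal.ofReal ((2 ^ k)⁻¹ ^ b) * w x) x :=
        lintegral_mono fun x =>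
          ofReal_div_rpow_mul_le_tsum ((Nat.cast_nonneg n).trans hb.le) w ht x y
    _ = ∑' k : ℕ, ENNReal.ofReal ((2 ^ k)⁻¹ ^ b) * ∫⁻ x in ball y (2 ^ (k + 1) * t), w x := by
        rw [lintegral_tsum fun k => ((hw.const_mul _).indicator measurableSet_ball).aemeasurable]
        refine tsum_congr fun k => ?_
        rw [lintegral_indicator measurableSet_ball, lintegral_const_mul _ hw]
    _ ≤ ∑' k : ℕ, ENNReal.ofReal ((2 ^ k)⁻¹ ^ b * (2 ^ (k + 1)) ^ n) *
          (volume (ball (0 : ℝ^n) 1) * ENNReal.ofReal (t ^ n) * maximalFn volume w x') := by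
        refine ENNReal.tsum_le_tsum fun k => (mul_le_mul_right (hball k) _).trans_eq ?_
        rw [ENNReal.ofReal_mul (by positivity)]
        ring
    _ = _ := by
        rw [ENNReal.tsum_mul_right]
        ring

lemma isOpen_closedBall_subset {Ω : Set (ℝ^n)} (hΩ : IsOpen Ω) :
    IsOpen {q : ℝ^n × ℝ | closedBall q.1 q.2 ⊆ Ω} := by
  refine isOpen_iff_mem_nhds.2 fun q₀ hq₀ => ?_
  obtain hneg | hnonneg := lt_or_ge q₀.2 0
  · filter_upwards [(isOpen_lt continuous_snd continuous_const).mem_nhds hneg] with q hq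
    rw [closedBall_eq_empty.2 hq]
    exact empty_subset Ω
  · obtain ⟨δ, hδ, hsub⟩ := (isCompact_closedBall q₀.1 q₀.2).exists_cthickening_subset_open hΩ hq₀
    rw [cthickening_closedBall hδ.le hnonneg] at hsub
    have hnear : ∀ᶠ q : ℝ^n × ℝ in 𝓝 q₀, q.2 + dist q.1 q₀.1 < δ + q₀.2 := by
      refine (isOpen_lt (by fun_prop) (by fun_prop)).mem_nhds ?_
      rw [mem_ofPred_eq, dist_self]
      linarith
    filter_upwards [hnear] with q hq
    exact (closedBall_subset_closedBall' hq.le).trans hsub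

/-- The infimum of the maximal function of `w` over the ball of radius `q.2` about `q.1`: the
weight on the upper half space that dominates the averages of `w` against the weight of `g*`. -/
def infMaximalFn (w : ℝ^n → ℝ≥0∞) (q : ℝ^n × ℝ) : ℝ≥0∞ :=
  ⨅ x : closedBall q.1 q.2, maximalFn volume w x

lemma measurable_infMaximalFn (w : ℝ^n → ℝ≥0∞) : Measurable (infMaximalFn w) := by
  refine measurable_of_Ioi fun s => IsOpen.measurableSet ?_
  have hpre : infMaximalFn w ⁻¹' Ioi s = ⋃ s' ∈ Ioi s,
      {q : ℝ^n × ℝ | closedBall q.1 q.2 ⊆ {x | s' < maximalFn volume w x}} := by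
    ext q
    simp only [mem_preimage, mem_Ioi, mem_iUnion, exists_prop]
    refine ⟨fun h => ?_, fun ⟨s', hs', hsub⟩ => hs'.trans_le (le_iInf fun x => (hsub x.2).le)⟩
    obtain ⟨s', hs', hlt⟩ := exists_between h
    exact ⟨s', hs', fun x hx => hlt.trans_le (iInf_le _ (⟨x, hx⟩ : closedBall q.1 q.2))⟩
  rw [hpre]
  exact isOpen_biUnion fun s' _ => isOpen_closedBall_subset (isOpen_lt_maximalFn volume w s')

/-- Where the infimum exceeds `s`, the value of `A_α(f)` depends only on the restriction of `f` to
the set `{M w > s}`. -/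
lemma setLIntegral_maximalConvExt_sq_le_of_lt_infMaximalFn {C : ℝ≥0∞}
    (hC : ∀ f : ℝ^n → 𝕜, StronglyMeasurable f → LocallyIntegrable f volume →
      ∫⁻ q in upperHalfSpace n, ENNReal.ofReal q.2⁻¹ * maximalConvExt α f q ^ 2 ≤
        C * ∫⁻ z, ‖f z‖ₑ ^ 2)
    (hfm : StronglyMeasurable f) (hf : LocallyIntegrable f volume) (w : ℝ^n → ℝ≥0∞) (s : ℝ≥0∞) :
    ∫⁻ q in {q | s < infMaximalFn w q}, ENNReal.ofReal q.2⁻¹ * maximalConvExt α f q ^ 2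
        ∂volume.restrict (upperHalfSpace n) ≤
      C * ∫⁻ z in {z | s < maximalFn volume w z}, ‖f z‖ₑ ^ 2 := by
  set Ω : Set (ℝ^n) := {z | s < maximalFn volume w z}
  have hΩ : MeasurableSet Ω := (isOpen_lt_maximalFn volume w s).measurableSet
  have hsq (z : ℝ^n) : ‖Ω.indicator f z‖ₑ ^ 2 = Ω.indicator (fun z => ‖f z‖ₑ ^ 2) z := by
    by_cases hz : z ∈ Ω <;> simp [hz]
  have hS : MeasurableSet {q | s < infMaximalFn w q} :=
    measurableSet_lt measurable_const (measurable_infMaximalFn w)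
  calc ∫⁻ q in {q | s < infMaximalFn w q}, ENNReal.ofReal q.2⁻¹ * maximalConvExt α f q ^ 2
        ∂volume.restrict (upperHalfSpace n)
      = ∫⁻ q in {q | s < infMaximalFn w q} ∩ upperHalfSpace n,
          ENNReal.ofReal q.2⁻¹ * maximalConvExt α (Ω.indicator f) q ^ 2 := by
        rw [Measure.restrict_restrict hS]
        refine setLIntegral_congr_fun (hS.inter (measurableSet_upperHalfSpace n)) fun q hq => ?_
        have hconv : maximalConv α f q.1 q.2 = maximalConv α (Ω.indicator f) q.1 q.2 := by
          refine maximalConv_congr (mem_upperHalfSpace.1 hq.2) (.of_forall fun z hz => ?_)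
          have hzΩ : z ∈ Ω := (show s < infMaximalFn w q from hq.1).trans_le
            (iInf_le _ (⟨z, hz⟩ : closedBall q.1 q.2))
          exact (indicator_of_mem hzΩ f).symm
        simp only [maximalConvExt_of_mem _ hq.2, hconv]
    _ ≤ ∫⁻ q in upperHalfSpace n,
          ENNReal.ofReal q.2⁻¹ * maximalConvExt α (Ω.indicator f) q ^ 2 :=
        lintegral_mono_set inter_subset_right
    _ ≤ C * ∫⁻ z, ‖Ω.indicator f z‖ₑ ^ 2 := hC _ (hfm.indicator hΩ) (hf.indicator hΩ)
    _ = C * ∫⁻ z in Ω, ‖f z‖ₑ ^ 2 := by simp_rw [hsq, lintegral_indicator hΩ]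

lemma exists_lintegral_maximalConvExt_sq_mul_infMaximalFn_le (𝕜 : Type*) [RCLike 𝕜] (n : ℕ)
    (hα : 0 < α) :
    ∃ C : ℝ≥0∞, C ≠ ∞ ∧ ∀ f : ℝ^n → 𝕜, StronglyMeasurable f → LocallyIntegrable f volume →
      ∀ w : ℝ^n → ℝ≥0∞, ∫⁻ q in upperHalfSpace n,
          ENNReal.ofReal q.2⁻¹ * maximalConvExt α f q ^ 2 * infMaximalFn w q ≤
        C * ∫⁻ z, ‖f z‖ₑ ^ 2 * maximalFn volume w z := by
  obtain ⟨C, hC_top, hC⟩ := exists_lintegral_maximalConvExt_sq_le 𝕜 n hα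
  refine ⟨C, hC_top, fun f hfm hf w => ?_⟩
  have hAm : Measurable fun q : ℝ^n × ℝ => ENNReal.ofReal q.2⁻¹ * maximalConvExt α f q ^ 2 :=
    Measurable.mul (by fun_prop) ((measurable_maximalConvExt hα hf).pow_const 2)
  have hleft := lintegral_mul_rpow_eq_lintegral_setLIntegral_lt
    (μ := volume.restrict (upperHalfSpace n)) one_pos (measurable_infMaximalFn w) hAm
  have hright := lintegral_mul_rpow_eq_lintegral_setLIntegral_lt (μ := volume) one_pos
    (measurable_maximalFn volume w) (hfm.enorm.pow_const 2)
  simp only [ENNReal.rpow_one] at hleft hright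
  rw [hleft, hright, ← lintegral_const_mul' _ _ hC_top]
  refine lintegral_mono fun s => ?_
  rw [mul_left_comm]
  gcongr
  exact setLIntegral_maximalConvExt_sq_le_of_lt_infMaximalFn hC hfm hf w _

lemma exists_lintegral_gStarWeight_mul_le (hb : n < lam * n) :
    ∃ C : ℝ≥0∞, C ≠ ∞ ∧ ∀ w : ℝ^n → ℝ≥0∞, Measurable w → ∀ q ∈ upperHalfSpace n,
      ∫⁻ x, gStarWeight lam x q * w x ≤ C * (ENNReal.ofReal q.2⁻¹ * infMaximalFn w q) := by
  obtain ⟨C, hC_top, hC⟩ := exists_lintegral_div_rpow_mul_le_maximalFn hb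
  refine ⟨C, hC_top, fun w hw q hq => ?_⟩
  have ht : 0 < q.2 := mem_upperHalfSpace.1 hq
  have hinf : ∫⁻ x, ENNReal.ofReal ((q.2 / (q.2 + ‖x - q.1‖)) ^ (lam * n)) * w x ≤
      C * ENNReal.ofReal (q.2 ^ n) * infMaximalFn w q := by
    rw [infMaximalFn, ENNReal.mul_iInf' (fun h => absurd h (by finiteness))
      fun _ => ⟨q.1, mem_closedBall_self ht.le⟩]
    exact le_iInf fun x' => hC w hw q.1 q.2 ht x' x'.2
  calc ∫⁻ x, gStarWeight lam x q * w x
      = ENNReal.ofReal (q.2 ^ (n + 1))⁻¹ *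
          ∫⁻ x, ENNReal.ofReal ((q.2 / (q.2 + ‖x - q.1‖)) ^ (lam * n)) * w x := by
        rw [← lintegral_const_mul _ (by fun_prop)]
        refine lintegral_congr fun x => ?_
        rw [gStarWeight]
        ring
    _ ≤ ENNReal.ofReal (q.2 ^ (n + 1))⁻¹ * (C * ENNReal.ofReal (q.2 ^ n) * infMaximalFn w q) := by
        gcongr
    _ = C * (ENNReal.ofReal q.2⁻¹ * infMaximalFn w q) := by
        have hcancel : q.2⁻¹ = (q.2 ^ (n + 1))⁻¹ * q.2 ^ n := by
          field_simp
          ring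
        rw [hcancel, ENNReal.ofReal_mul (by positivity)]
        ring

lemma exists_lintegral_gStar_sq_mul_le (𝕜 : Type*) [RCLike 𝕜] (hα : 0 < α)
    (hlam : n < lam * n) :
    ∃ C : ℝ≥0∞, C ≠ ∞ ∧ ∀ f : ℝ^n → 𝕜, StronglyMeasurable f → LocallyIntegrable f volume →
      ∀ w : ℝ^n → ℝ≥0∞, Measurable w →
      ∫⁻ x, gStar lam α f x ^ 2 * w x ≤ C * ∫⁻ z, ‖f z‖ₑ ^ 2 * maximalFn volume w z := by
  obtain ⟨C₁, hC₁_top, hC₁⟩ := exists_lintegral_maximalConvExt_sq_mul_infMaximalFn_le 𝕜 n hα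
  obtain ⟨C₂, hC₂_top, hC₂⟩ := exists_lintegral_gStarWeight_mul_le hlam
  refine ⟨C₂ * C₁, by finiteness, fun f hfm hf w hw => ?_⟩
  have hAm := measurable_maximalConvExt hα hf
  have hweight := measurable_gStarWeight (n := n) lam
  have hslice (x : ℝ^n) :
      Measurable fun q => gStarWeight lam x q * maximalConvExt α f q ^ 2 :=
    (Measurable.of_uncurry_left (f := gStarWeight lam) hweight).mul (hAm.pow_const 2)
  have hm : Measurable fun z : ℝ^n × (ℝ^n × ℝ) =>
      maximalConvExt α f z.2 ^ 2 * (gStarWeight lam z.1 z.2 * w z.1) :=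
    ((hAm.comp measurable_snd).pow_const 2).mul (hweight.mul (hw.comp measurable_fst))
  calc ∫⁻ x, gStar lam α f x ^ 2 * w x
      = ∫⁻ x, ∫⁻ q in upperHalfSpace n,
          maximalConvExt α f q ^ 2 * (gStarWeight lam x q * w x) := by
        refine lintegral_congr fun x => ?_
        rw [gStar_sq, ← lintegral_mul_const _ (hslice x)]
        exact lintegral_congr fun q => by rw [mul_comm (gStarWeight lam x q), mul_assoc]
    _ = ∫⁻ q in upperHalfSpace n,
          maximalConvExt α f q ^ 2 * ∫⁻ x, gStarWeight lam x q * w x := by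
        rw [lintegral_lintegral_swap hm.aemeasurable]
        exact lintegral_congr fun q => lintegral_const_mul _
          ((hweight.comp measurable_prodMk_right).mul hw)
    _ ≤ ∫⁻ q in upperHalfSpace n,
          C₂ * (ENNReal.ofReal q.2⁻¹ * maximalConvExt α f q ^ 2 * infMaximalFn w q) := by
        refine setLIntegral_mono' (measurableSet_upperHalfSpace n) fun q hq => ?_
        exact (mul_le_mul_right (hC₂ w hw q hq) _).trans_eq (by ring)
    _ ≤ C₂ * C₁ * ∫⁻ z, ‖f z‖ₑ ^ 2 * maximalFn volume w z := by
        rw [lintegral_const_mul' _ _ hC₂_top, mul_assoc]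
        gcongr
        exact hC₁ f hfm hf w

end WeightedLTwo

/-! ### The `L^p` bound for `p ≥ 2` -/

section Duality

variable {X : Type*} [MeasurableSpace X] {μ : Measure X} {p : ℝ} {a b : ℝ≥0∞}

lemma le_rpow_of_le_mul_rpow (hp : 2 < p) (ha : a ≠ ∞) (h : a ≤ b * a ^ (1 - 2 / p)) :
    a ≤ b ^ (p / 2) := by
  obtain rfl | h0 := eq_or_ne a 0
  · exact zero_le
  have h2p : 2 / p < 1 := (div_lt_one (by linarith)).2 hp
  have hne : a ^ (1 - 2 / p) ≠ 0 := (ENNReal.rpow_pos (pos_iff_ne_zero.2 h0) ha).ne'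
  have hne_top : a ^ (1 - 2 / p) ≠ ∞ := ENNReal.rpow_ne_top_of_nonneg (by linarith) ha
  have hle : a ^ (2 / p) ≤ b := by
    rw [← ENNReal.mul_le_mul_iff_left hne hne_top, ← ENNReal.rpow_add _ _ h0 ha, add_sub_cancel,
      ENNReal.rpow_one]
    exact h
  calc a = (a ^ (2 / p)) ^ (p / 2) := by
        rw [← ENNReal.rpow_mul, div_mul_div_cancel₀ (by linarith), div_self two_ne_zero,
          ENNReal.rpow_one]
    _ ≤ b ^ (p / 2) := by gcongr

lemma lintegral_rpow_le_of_forall_finite [SigmaFinite μ] {g : X → ℝ≥0∞} (hp : 0 < p)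
    (hg : Measurable g) (H : ∀ h : X → ℝ≥0∞, Measurable h → h ≤ g → ∫⁻ x, h x ^ p ∂μ ≠ ∞ →
      ∫⁻ x, h x ^ p ∂μ ≤ b) : ∫⁻ x, g x ^ p ∂μ ≤ b := by
  set h : ℕ → X → ℝ≥0∞ := fun N => (spanningSets μ N).indicator fun x => min (g x) N
  have hm (N : ℕ) : Measurable (h N) :=
    (hg.min measurable_const).indicator (measurableSet_spanningSets μ N)
  have hle (N : ℕ) : h N ≤ g :=
    (indicator_le_self _ _).trans fun _ => min_le_left _ _
  have hfin (N : ℕ) : ∫⁻ x, h N x ^ p ∂μ ≠ ∞ := by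
    refine ne_top_of_le_ne_top (ENNReal.mul_ne_top (by finiteness)
      (measure_spanningSets_lt_top μ N).ne) ((lintegral_mono fun x => ?_).trans_eq
      (lintegral_indicator_const (measurableSet_spanningSets μ N) ((N : ℝ≥0∞) ^ p)))
    by_cases hx : x ∈ spanningSets μ N
    · simp only [h, indicator_of_mem hx]
      gcongr
      exact min_le_right _ _
    · simp only [h, indicator_of_notMem hx, ENNReal.zero_rpow_of_pos hp, le_refl]
  have htends (x : X) : Tendsto (fun N => h N x ^ p) atTop (𝓝 (g x ^ p)) := by
    have hmin : Tendsto (fun N : ℕ => min (g x) N) atTop (𝓝 (g x)) := by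
      simpa only [min_top_right] using
        (tendsto_const_nhds (x := g x)).min ENNReal.tendsto_nat_nhds_top
    refine ((ENNReal.continuous_rpow_const.tendsto _).comp hmin).congr' ?_
    filter_upwards [eventually_ge_atTop (spanningSetsIndex μ x)] with N hN
    simp only [h, Function.comp_apply,
      indicator_of_mem (mem_spanningSets_of_index_le μ x hN)]
  calc ∫⁻ x, g x ^ p ∂μ = ∫⁻ x, liminf (fun N => h N x ^ p) atTop ∂μ :=
        lintegral_congr fun x => (htends x).liminf_eq.symm
    _ ≤ liminf (fun N => ∫⁻ x, h N x ^ p ∂μ) atTop :=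
        lintegral_liminf_le fun N => (hm N).pow_const p
    _ ≤ b := by
        refine liminf_le_of_le (by isBoundedDefault) fun c hc => ?_
        obtain ⟨N, hN⟩ := hc.exists
        exact hN.trans (H _ (hm N) (hle N) (hfin N))

lemma holderConjugate_div_two_div_sub_two (hp : 2 < p) :
    (p / 2).HolderConjugate (p / (p - 2)) := by
  have : p - 2 ≠ 0 := (sub_pos.2 hp).ne'
  refine Real.holderConjugate_iff.2 ⟨by linarith, ?_⟩
  field_simp
  ring

variable {E : Type*} [NormedAddCommGroup E] [MeasurableSpace E] [NormedSpace ℝ E]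
  [FiniteDimensional ℝ E] [BorelSpace E]

/-- Take `h ^ (p - 2)` as the weight; the maximal function is bounded on `L^q` for the exponent
`q = p / (p - 2)` conjugate to `p / 2`. -/
lemma exists_lintegral_rpow_le_mul_rpow (μ : Measure E) [μ.IsAddHaarMeasure] (hp : 2 < p) :
    ∃ C : ℝ≥0∞, C ≠ ∞ ∧ ∀ F h : E → ℝ≥0∞, Measurable F → Measurable h →
      ∀ C₀ : ℝ≥0∞, (∀ w : E → ℝ≥0∞, Measurable w →
        ∫⁻ x, h x ^ 2 * w x ∂μ ≤ C₀ * ∫⁻ x, F x ^ 2 * maximalFn μ w x ∂μ) →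
      ∫⁻ x, h x ^ p ∂μ ≤
        C₀ * C * (∫⁻ x, F x ^ p ∂μ) ^ (2 / p) * (∫⁻ x, h x ^ p ∂μ) ^ (1 - 2 / p) := by
  have hp2 : 0 < p - 2 := by linarith
  set q := p / (p - 2) with hq
  have hq1 : 1 < q := (one_lt_div hp2).2 (by linarith)
  have hq_inv : 1 / q = 1 - 2 / p := by
    rw [hq]
    field_simp
  obtain ⟨C, hC_top, hC⟩ := exists_lintegral_maximalFn_rpow_le μ hq1
  refine ⟨C ^ (1 / q), by finiteness, fun F h hF hh C₀ H => ?_⟩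
  have hw : Measurable fun x => h x ^ (p - 2) := hh.pow_const _
  have hhp (x : E) : h x ^ p = h x ^ 2 * h x ^ (p - 2) := by
    rw [← ENNReal.rpow_ofNat, ← ENNReal.rpow_add_of_nonneg _ _ zero_le_two hp2.le, add_sub_cancel]
  have hhq (x : E) : h x ^ p = (h x ^ (p - 2)) ^ q := by
    rw [← ENNReal.rpow_mul, hq, mul_div_cancel₀ _ hp2.ne']
  have hFp (x : E) : (F x ^ 2) ^ (p / 2) = F x ^ p := by
    rw [← ENNReal.rpow_ofNat, ← ENNReal.rpow_mul, mul_div_cancel₀ _ two_ne_zero]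
  calc ∫⁻ x, h x ^ p ∂μ
      = ∫⁻ x, h x ^ 2 * h x ^ (p - 2) ∂μ := lintegral_congr hhp
    _ ≤ C₀ * ∫⁻ x, F x ^ 2 * maximalFn μ (fun x => h x ^ (p - 2)) x ∂μ := H _ hw
    _ ≤ C₀ * ((∫⁻ x, (F x ^ 2) ^ (p / 2) ∂μ) ^ (1 / (p / 2)) *
          (∫⁻ x, maximalFn μ (fun x => h x ^ (p - 2)) x ^ q ∂μ) ^ (1 / q)) := by
        gcongr
        exact ENNReal.lintegral_mul_le_Lp_mul_Lq _ (holderConjugate_div_two_div_sub_two hp)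
          (hF.pow_const 2).aemeasurable (measurable_maximalFn μ _).aemeasurable
    _ ≤ C₀ * ((∫⁻ x, F x ^ p ∂μ) ^ (2 / p) * (C * ∫⁻ x, h x ^ p ∂μ) ^ (1 / q)) := by
        simp_rw [hFp, one_div_div, hhq]
        gcongr
        exact hC _ hw
    _ = _ := by
        rw [ENNReal.mul_rpow_of_nonneg _ _ (by positivity), ← hq_inv]
        ring

lemma exists_lintegral_rpow_le_of_forall_lintegral_sq_mul_le (μ : Measure E) [μ.IsAddHaarMeasure]
    (hp : 2 < p) {C₀ : ℝ≥0∞} (hC₀ : C₀ ≠ ∞) :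
    ∃ C : ℝ≥0∞, C ≠ ∞ ∧ ∀ F g : E → ℝ≥0∞, Measurable F → Measurable g →
      (∀ w : E → ℝ≥0∞, Measurable w →
        ∫⁻ x, g x ^ 2 * w x ∂μ ≤ C₀ * ∫⁻ x, F x ^ 2 * maximalFn μ w x ∂μ) →
      ∫⁻ x, g x ^ p ∂μ ≤ C * ∫⁻ x, F x ^ p ∂μ := by
  obtain ⟨C, hC_top, hC⟩ := exists_lintegral_rpow_le_mul_rpow μ hp
  refine ⟨(C₀ * C) ^ (p / 2), by finiteness, fun F g hF hg H => ?_⟩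
  refine lintegral_rpow_le_of_forall_finite (by linarith) hg fun h hh hle hfin => ?_
  have hroot := le_rpow_of_le_mul_rpow hp hfin (hC F h hF hh C₀ fun w hw =>
    (lintegral_mono fun x => by gcongr; exact hle x).trans (H w hw))
  rwa [ENNReal.mul_rpow_of_nonneg _ _ (by linarith), ← ENNReal.rpow_mul,
    div_mul_div_cancel₀ (by linarith), div_self two_ne_zero, ENNReal.rpow_one] at hroot

end Duality

lemma exists_lintegral_gStar_rpow_le_of_two_le (𝕜 : Type*) [RCLike 𝕜] {n : ℕ} {α lam p : ℝ}
    (hα : 0 < α) (hlam : n < lam * n) (hp : 2 ≤ p) :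
    ∃ C : ℝ≥0∞, C ≠ ∞ ∧ ∀ f : ℝ^n → 𝕜, StronglyMeasurable f → LocallyIntegrable f volume →
      ∫⁻ x, gStar lam α f x ^ p ≤ C * ∫⁻ z, ‖f z‖ₑ ^ p := by
  obtain ⟨C₀, hC₀_top, hC₀⟩ := exists_lintegral_gStar_sq_mul_le 𝕜 hα hlam
  obtain rfl | hp := hp.eq_or_lt
  · refine ⟨C₀, hC₀_top, fun f hfm hf => ?_⟩
    simp only [ENNReal.rpow_ofNat]
    calc ∫⁻ x, gStar lam α f x ^ 2 = ∫⁻ x, gStar lam α f x ^ 2 * 1 := by simp only [mul_one]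
      _ ≤ C₀ * ∫⁻ z, ‖f z‖ₑ ^ 2 * maximalFn volume (fun _ => 1) z :=
        hC₀ f hfm hf _ measurable_const
      _ ≤ C₀ * ∫⁻ z, ‖f z‖ₑ ^ 2 := by
        gcongr with z
        exact mul_le_of_le_one_right' (maximalFn_one_le volume z)
  · obtain ⟨C, hC_top, hC⟩ :=
      exists_lintegral_rpow_le_of_forall_lintegral_sq_mul_le (volume : Measure (ℝ^n)) hp hC₀_top
    exact ⟨C, hC_top, fun f hfm hf => hC _ _ hfm.enorm (measurable_gStar hα lam hf) (hC₀ f hfm hf)⟩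

/-! ### Decay of `g*` off the support of a function with mean value zero -/

section Decay

variable {𝕜 : Type*} [RCLike 𝕜] {n : ℕ} {α lam ε ρ t R : ℝ} {f : ℝ^n → 𝕜} {c x : ℝ^n} {a : ℝ≥0∞}

lemma exists_lintegral_div_rpow_le (hε : 0 < ε) :
    ∃ C : ℝ≥0∞, C ≠ ∞ ∧ ∀ (y : ℝ^n) (t : ℝ), 0 < t →
      ∫⁻ x, ENNReal.ofReal ((t / (t + ‖x - y‖)) ^ (n + ε)) ≤ C * ENNReal.ofReal (t ^ n) := by
  obtain ⟨C, hC_top, hC⟩ :=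
    exists_lintegral_div_rpow_mul_le_maximalFn (n := n) (b := n + ε) (by linarith)
  refine ⟨C, hC_top, fun y t ht => ?_⟩
  have h := hC (fun _ => 1) measurable_const y t ht y (mem_closedBall_self ht.le)
  simp only [mul_one] at h
  exact h.trans (mul_le_of_le_one_right' (maximalFn_one_le volume y))

lemma gStarWeight_mul_maximalConvExt_sq_le (hlam : 0 ≤ lam * n) {q : ℝ^n × ℝ}
    (hq : q ∈ upperHalfSpace n) (hR : 0 < R)
    (hsup : maximalConvExt α f q ≤ a * ENNReal.ofReal (q.2 ^ (-n - ε)))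
    (hzero : q.2 + ‖x - q.1‖ < R → maximalConvExt α f q = 0) :
    gStarWeight lam x q * maximalConvExt α f q ^ 2 ≤
      a * ENNReal.ofReal (min 1 (q.2 / R) ^ (lam * n) * q.2 ^ (-2 * n - 1 - ε)) *
        maximalConvExt α f q := by
  have ht : 0 < q.2 := mem_upperHalfSpace.1 hq
  obtain hqR | hqR := lt_or_ge (q.2 + ‖x - q.1‖) R
  · simp [hzero hqR]
  have hd : 0 < q.2 + ‖x - q.1‖ := by positivity
  have hmin : q.2 / (q.2 + ‖x - q.1‖) ≤ min 1 (q.2 / R) :=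
    le_min ((div_le_one hd).2 (by linarith [norm_nonneg (x - q.1)])) (by gcongr)
  have hpow : q.2 ^ (-2 * n - 1 - ε) = (q.2 ^ (n + 1))⁻¹ * q.2 ^ (-n - ε) := by
    rw [← Real.rpow_natCast, ← Real.rpow_neg ht.le, ← Real.rpow_add ht]
    congr 1
    push_cast
    ring
  calc gStarWeight lam x q * maximalConvExt α f q ^ 2
      ≤ ENNReal.ofReal (min 1 (q.2 / R) ^ (lam * n)) * ENNReal.ofReal (q.2 ^ (n + 1))⁻¹ *
          (a * ENNReal.ofReal (q.2 ^ (-n - ε)) * maximalConvExt α f q) := by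
        rw [gStarWeight, sq]
        gcongr
    _ = _ := by
        rw [hpow, ENNReal.ofReal_mul (by positivity), ENNReal.ofReal_mul (by positivity)]
        ring

lemma lintegral_mul_maximalConvExt_le (hα : 0 < α) (hf : LocallyIntegrable f volume) (hR : 0 < R)
    (ht : 0 < t) (hint : ∫⁻ y, maximalConv α f y t ≤ a * ENNReal.ofReal (t ^ (-ε))) :
    ∫⁻ y, a * ENNReal.ofReal (min 1 (t / R) ^ (lam * n) * t ^ (-2 * n - 1 - ε)) *
        maximalConvExt α f (y, t) ≤
      a ^ 2 * ENNReal.ofReal (min 1 (t / R) ^ (lam * n) * t ^ (-(2 * n + 2 * ε) - 1)) := by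
  have hpow : t ^ (-(2 * n + 2 * ε) - 1) = t ^ (-2 * n - 1 - ε) * t ^ (-ε) := by
    rw [← Real.rpow_add ht]
    ring_nf
  have hAt : Measurable fun y => maximalConvExt α f (y, t) :=
    (measurable_maximalConvExt hα hf).comp measurable_prodMk_right
  have hExt (y : ℝ^n) : maximalConvExt α f (y, t) = maximalConv α f y t :=
    maximalConvExt_of_mem f (mem_upperHalfSpace.2 ht)
  rw [lintegral_const_mul _ hAt, lintegral_congr hExt, hpow, ← mul_assoc,
    ENNReal.ofReal_mul (q := t ^ (-ε)) (by positivity)]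
  exact (mul_le_mul_right hint _).trans_eq (by ring)

-- Of the two factors of `A_α(f)²`, the first is bounded by its supremum and the second is
-- integrated over the slice of height `t`.
lemma exists_gStar_le_of_decay (𝕜 : Type*) [RCLike 𝕜] (hα : 0 < α) (hε : 0 ≤ ε)
    (hεlam : 2 * ε < (lam - 2) * n) :
    ∃ C : ℝ≥0∞, C ≠ ∞ ∧ ∀ f : ℝ^n → 𝕜, LocallyIntegrable f volume →
      ∀ (x : ℝ^n) (R : ℝ) (a : ℝ≥0∞), 0 < R →
      (∀ y t, 0 < t → maximalConv α f y t ≤ a * ENNReal.ofReal (t ^ (-n - ε))) →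
      (∀ t, 0 < t → ∫⁻ y, maximalConv α f y t ≤ a * ENNReal.ofReal (t ^ (-ε))) →
      (∀ y t, 0 < t → t + ‖x - y‖ < R → maximalConv α f y t = 0) →
      gStar lam α f x ≤ C * a * ENNReal.ofReal (R ^ (-n - ε)) := by
  have hn : n ≠ 0 := by
    rintro rfl
    rw [Nat.cast_zero, mul_zero] at hεlam
    linarith
  have hs : (0 : ℝ) < 2 * n + 2 * ε := by positivity
  have hsb : 2 * n + 2 * ε < lam * n := by linarith
  set K : ℝ := 1 / (lam * n - (2 * n + 2 * ε)) + 1 / (2 * n + 2 * ε)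
  refine ⟨ENNReal.ofReal K ^ (1 / 2 : ℝ), by finiteness, fun f hf x R a hR hsup hint hzero => ?_⟩
  have hAm := measurable_maximalConvExt hα hf
  rw [← ENNReal.pow_le_pow_left_iff two_ne_zero, gStar_sq]
  calc ∫⁻ q in upperHalfSpace n, gStarWeight lam x q * maximalConvExt α f q ^ 2
      ≤ ∫⁻ q in upperHalfSpace n,
          a * ENNReal.ofReal (min 1 (q.2 / R) ^ (lam * n) * q.2 ^ (-2 * n - 1 - ε)) *
            maximalConvExt α f q := by
        refine setLIntegral_mono' (measurableSet_upperHalfSpace n) fun q hq => ?_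
        have ht := mem_upperHalfSpace.1 hq
        refine gStarWeight_mul_maximalConvExt_sq_le (hs.trans hsb).le hq hR ?_ ?_ <;>
          rw [maximalConvExt_of_mem f hq]
        exacts [hsup _ _ ht, hzero _ _ ht]
    _ ≤ ∫⁻ t in Ioi (0 : ℝ), a ^ 2 *
          ENNReal.ofReal (min 1 (t / R) ^ (lam * n) * t ^ (-(2 * n + 2 * ε) - 1)) := by
        rw [lintegral_upperHalfSpace (by fun_prop)]
        exact setLIntegral_mono' measurableSet_Ioi fun t ht =>
          lintegral_mul_maximalConvExt_le hα hf hR ht (hint t ht)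
    _ = a ^ 2 * ENNReal.ofReal (R ^ (-(2 * n + 2 * ε)) * K) := by
        rw [lintegral_const_mul _ (by fun_prop), lintegral_min_rpow hs hsb hR]
    _ = (ENNReal.ofReal K ^ (1 / 2 : ℝ) * a * ENNReal.ofReal (R ^ (-n - ε))) ^ 2 := by
        have hR2 : R ^ (-(2 * n + 2 * ε)) = (R ^ (-n - ε)) ^ 2 := by
          rw [← Real.rpow_mul_natCast hR.le]
          push_cast
          ring_nf
        have hK : (ENNReal.ofReal K ^ (1 / 2 : ℝ)) ^ 2 = ENNReal.ofReal K := by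
          rw [← ENNReal.rpow_mul_natCast]
          norm_num
        rw [mul_pow, mul_pow, hK, hR2, ENNReal.ofReal_mul (by positivity),
          ENNReal.ofReal_pow (by positivity)]
        ring

lemma maximalConv_eq_zero {y : ℝ^n} (ht : 0 < t) (h : ∀ z ∈ closedBall y t, f z = 0) :
    maximalConv α f y t = 0 := by
  rw [maximalConv_congr ht (f' := 0) (.of_forall h)]
  simp [maximalConv]

lemma maximalConv_le_of_integral_eq_zero (hα : 0 < α) (hf : Integrable f volume)
    (hsupp : ∀ z ∉ closedBall c ρ, f z = 0) (hint : ∫ z, f z = 0) (y : ℝ^n) (ht : 0 < t) :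
    maximalConv α f y t ≤ ENNReal.ofReal ((t ^ n)⁻¹ * (ρ / t) ^ α) * ∫⁻ z, ‖f z‖ₑ := by
  refine iSup₂_le fun φ hφ => ?_
  have hmul : Integrable (fun z => dilate φ t (y - z) * f z) volume :=
    hf.bdd_mul (continuous_dilate_sub hα hφ t y).aestronglyMeasurable
      (.of_forall fun z => norm_dilate_le hα hφ ht _)
  have hsub : ∫ z, dilate φ t (y - z) * f z =
      ∫ z, (dilate φ t (y - z) - dilate φ t (y - c)) * f z := by
    simp_rw [sub_mul]
    rw [integral_sub hmul (hf.const_mul _), integral_const_mul, hint, mul_zero, sub_zero]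
  rw [hsub, ← lintegral_const_mul' _ _ (by finiteness)]
  refine (enorm_integral_le_lintegral_enorm _).trans (lintegral_mono fun z => ?_)
  by_cases hz : z ∈ closedBall c ρ
  · rw [enorm_mul, ← ofReal_norm]
    gcongr
    refine (norm_dilate_sub_dilate_le hφ ht _ _).trans ?_
    rw [sub_sub_sub_cancel_left, ← dist_eq_norm, dist_comm]
    gcongr
    exact hz
  · simp [hsupp z hz]

lemma lintegral_maximalConv_le (hα : 0 < α) (hf : AEStronglyMeasurable f) (ht : 0 < t) :
    ∫⁻ y, maximalConv α f y t ≤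
      ENNReal.ofReal (2 ^ α) * volume (ball (0 : ℝ^n) 1) * ∫⁻ z, ‖f z‖ₑ := by
  have hm : AEMeasurable (Function.uncurry fun y z : ℝ^n => (closedBall y t).indicator
      (fun z => ‖f z‖ₑ) z) (volume.prod volume) :=
    hf.enorm.comp_snd.indicator (s := {p : ℝ^n × ℝ^n | dist p.2 p.1 ≤ t})
      (measurableSet_le (by fun_prop) measurable_const)
  have hcancel : ENNReal.ofReal (2 ^ α * (t ^ n)⁻¹) * ENNReal.ofReal (t ^ n) =
      ENNReal.ofReal (2 ^ α) := by
    rw [← ENNReal.ofReal_mul (by positivity), inv_mul_cancel_right₀ (by positivity)]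
  calc ∫⁻ y, maximalConv α f y t
      ≤ ∫⁻ y, ENNReal.ofReal (2 ^ α * (t ^ n)⁻¹) * ∫⁻ z, (closedBall y t).indicator
          (fun z => ‖f z‖ₑ) z := by
        refine lintegral_mono fun y => ?_
        rw [lintegral_indicator measurableSet_closedBall]
        exact maximalConv_le hα f y ht
    _ = ENNReal.ofReal (2 ^ α * (t ^ n)⁻¹) * ∫⁻ z, ∫⁻ y, (closedBall z t).indicator
          (fun _ => ‖f z‖ₑ) y := by
        rw [lintegral_const_mul' _ _ ENNReal.ofReal_ne_top, lintegral_lintegral_swap hm]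
        refine congrArg _ (lintegral_congr fun z => lintegral_congr fun y => ?_)
        exact indicator_eq_indicator mem_closedBall_comm rfl
    _ = ENNReal.ofReal (2 ^ α * (t ^ n)⁻¹) * ENNReal.ofReal (t ^ n) *
          volume (ball (0 : ℝ^n) 1) * ∫⁻ z, ‖f z‖ₑ := by
        simp_rw [lintegral_indicator_const measurableSet_closedBall,
          Measure.addHaar_closedBall volume _ ht.le, finrank_euclideanSpace_fin]
        rw [lintegral_mul_const'' _ hf.enorm]
        ring
    _ = _ := by rw [hcancel]

lemma ofReal_inv_pow_mul_div_rpow (hρ : 0 < ρ) (ht : 0 < t) :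
    ENNReal.ofReal ((t ^ n)⁻¹ * (ρ / t) ^ ε) =
      ENNReal.ofReal (ρ ^ ε) * ENNReal.ofReal (t ^ (-n - ε)) := by
  rw [← ENNReal.ofReal_mul (by positivity), Real.rpow_sub ht, Real.rpow_neg ht.le,
    Real.rpow_natCast, Real.div_rpow hρ.le ht.le]
  congr 1
  ring

-- The mean value zero property is used for `t ≥ ρ`, the size of `f` for `t < ρ`.
lemma maximalConv_le_rpow_of_integral_eq_zero (hα : 0 < α) (hε : 0 ≤ ε) (hεα : ε ≤ α)
    (hρ : 0 < ρ) (hf : Integrable f volume) (hsupp : ∀ z ∉ closedBall c ρ, f z = 0)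
    (hint : ∫ z, f z = 0) (y : ℝ^n) (ht : 0 < t) :
    maximalConv α f y t ≤ ENNReal.ofReal (2 ^ α) * ENNReal.ofReal (ρ ^ ε) * (∫⁻ z, ‖f z‖ₑ) *
      ENNReal.ofReal (t ^ (-n - ε)) := by
  suffices h : maximalConv α f y t ≤
      ENNReal.ofReal (2 ^ α * ((t ^ n)⁻¹ * (ρ / t) ^ ε)) * ∫⁻ z, ‖f z‖ₑ by
    refine h.trans_eq ?_
    rw [ENNReal.ofReal_mul (by positivity), ofReal_inv_pow_mul_div_rpow hρ ht]
    ring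
  obtain hρt | hρt := le_or_gt ρ t
  · refine (maximalConv_le_of_integral_eq_zero hα hf hsupp hint y ht).trans ?_
    gcongr ENNReal.ofReal ?_ * _
    refine (mul_le_mul_of_nonneg_left (Real.rpow_le_rpow_of_exponent_ge (by positivity)
      ((div_le_one ht).2 hρt) hεα) (by positivity)).trans ?_
    exact le_mul_of_one_le_left (by positivity) (Real.one_le_rpow one_le_two hα.le)
  · refine (maximalConv_le hα f y ht).trans ?_
    gcongr
    · exact le_mul_of_one_le_right (by positivity)
        (Real.one_le_rpow ((one_le_div ht).2 hρt.le) hε)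
    · exact Measure.restrict_le_self

lemma maximalConv_eq_zero_of_add_lt_dist {y : ℝ^n} (hsupp : ∀ z ∉ closedBall c ρ, f z = 0)
    (ht : 0 < t) (h : ρ + t < dist y c) : maximalConv α f y t = 0 := by
  refine maximalConv_eq_zero ht fun z hz => hsupp z fun hzc => ?_
  linarith [mem_closedBall'.1 hz, mem_closedBall.1 hzc, dist_triangle y z c]

lemma lintegral_maximalConv_le_rpow_of_integral_eq_zero (hα : 0 < α) (hε : 0 ≤ ε) (hεα : ε ≤ α)
    (hρ : 0 < ρ) (hf : Integrable f volume) (hsupp : ∀ z ∉ closedBall c ρ, f z = 0)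
    (hint : ∫ z, f z = 0) (ht : 0 < t) :
    ∫⁻ y, maximalConv α f y t ≤ ENNReal.ofReal (2 ^ α) * (2 ^ n * volume (ball (0 : ℝ^n) 1)) *
      ENNReal.ofReal (ρ ^ ε) * (∫⁻ z, ‖f z‖ₑ) * ENNReal.ofReal (t ^ (-ε)) := by
  obtain hρt | hρt := le_or_gt ρ t
  · have hout (y : ℝ^n) (hy : y ∉ closedBall c (2 * t)) : maximalConv α f y t = 0 :=
      maximalConv_eq_zero_of_add_lt_dist hsupp ht (by linarith [not_le.1 (mt mem_closedBall.2 hy)])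
    have hpow : ENNReal.ofReal (t ^ (-ε)) =
        ENNReal.ofReal (t ^ (-n - ε)) * ENNReal.ofReal (t ^ n) := by
      rw [← ENNReal.ofReal_mul (by positivity), ← Real.rpow_natCast, ← Real.rpow_add ht]
      ring_nf
    rw [← setLIntegral_eq_of_support_subset (s := closedBall c (2 * t))
      fun y hy => by_contra fun hyc => hy (hout y hyc)]
    refine (lintegral_mono
      (maximalConv_le_rpow_of_integral_eq_zero hα hε hεα hρ hf hsupp hint · ht)).trans_eq ?_
    rw [setLIntegral_const, Measure.addHaar_closedBall volume _ (by positivity),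
      finrank_euclideanSpace_fin, mul_pow, ENNReal.ofReal_mul (by positivity),
      ENNReal.ofReal_pow zero_le_two, ENNReal.ofReal_ofNat, hpow]
    ring
  · have hone : 1 ≤ 2 ^ n * (ENNReal.ofReal (ρ ^ ε) * ENNReal.ofReal (t ^ (-ε))) := by
      refine one_le_mul (one_le_pow₀ one_le_two) ?_
      rw [← ENNReal.ofReal_mul (by positivity), Real.rpow_neg ht.le, ← div_eq_mul_inv,
        ← Real.div_rpow hρ.le ht.le, ENNReal.one_le_ofReal]
      exact Real.one_le_rpow ((one_le_div ht).2 hρt.le) hε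
    exact ((lintegral_maximalConv_le hα hf.1 ht).trans (le_mul_of_one_le_right' hone)).trans_eq
      (by ring)

lemma exists_gStar_le_of_integral_eq_zero (𝕜 : Type*) [RCLike 𝕜] (hα : 0 < α) (hε : 0 ≤ ε)
    (hεα : ε ≤ α) (hεlam : 2 * ε < (lam - 2) * n) :
    ∃ C : ℝ≥0∞, C ≠ ∞ ∧ ∀ (f : ℝ^n → 𝕜) (c : ℝ^n) (ρ : ℝ), 0 < ρ → Integrable f volume →
      (∀ z ∉ closedBall c ρ, f z = 0) → ∫ z, f z = 0 → ∀ x, 2 * ρ ≤ dist x c → gStar lam α f x ≤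
        C * ENNReal.ofReal (ρ ^ ε * (dist x c) ^ (-n - ε)) * ∫⁻ z, ‖f z‖ₑ := by
  obtain ⟨C, hC_top, hC⟩ := exists_gStar_le_of_decay 𝕜 hα hε hεlam
  set K : ℝ≥0∞ := 2 ^ n * volume (ball (0 : ℝ^n) 1)
  refine ⟨C * (ENNReal.ofReal (2 ^ α) * (1 + K)) * ENNReal.ofReal (2⁻¹ ^ (-n - ε)),
    by finiteness [measure_ball_lt_top (μ := volume) (x := (0 : ℝ^n)) (r := 1)],
    fun f c ρ hρ hf hsupp hint x hx => ?_⟩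
  have hd : 0 < dist x c := by linarith
  refine (hC f hf.locallyIntegrable x (dist x c / 2)
    (ENNReal.ofReal (2 ^ α) * (1 + K) * ENNReal.ofReal (ρ ^ ε) * ∫⁻ z, ‖f z‖ₑ) (by positivity)
    (fun y t ht => ?_) (fun t ht => ?_) fun y t ht hty => ?_).trans_eq ?_
  · refine (maximalConv_le_rpow_of_integral_eq_zero hα hε hεα hρ hf hsupp hint y ht).trans ?_
    gcongr
    exact le_mul_of_one_le_right' le_self_add
  · refine (lintegral_maximalConv_le_rpow_of_integral_eq_zero hα hε hεα hρ hf hsupp hint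
      ht).trans ?_
    gcongr
    exact le_add_self
  · refine maximalConv_eq_zero_of_add_lt_dist hsupp ht ?_
    rw [← dist_eq_norm] at hty
    linarith [dist_triangle x y c]
  · rw [div_eq_inv_mul, Real.mul_rpow (by norm_num) hd.le, ENNReal.ofReal_mul (by positivity),
      ENNReal.ofReal_mul (by positivity)]
    ring

lemma rpow_mul_rpow_le_inv_pow_mul {d : ℝ} (hρ : 0 < ρ) (hε : 0 ≤ ε) (hd : 2 * ρ ≤ d) :
    ρ ^ ε * d ^ (-n - ε) ≤ 2 ^ (n + ε) * (ρ ^ n)⁻¹ * (ρ / (ρ + d)) ^ (n + ε) := by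
  have hd0 : 0 < d := by linarith
  calc ρ ^ ε * d ^ (-n - ε)
      ≤ ρ ^ ε * ((ρ + d) / 2) ^ (-n - ε) := by
        gcongr ρ ^ ε * ?_
        exact Real.rpow_le_rpow_of_nonpos (by positivity) (by linarith)
          (by linarith [n.cast_nonneg (α := ℝ)])
    _ = _ := by
        rw [← neg_add', Real.rpow_neg (by positivity), Real.div_rpow (by positivity) zero_le_two,
          Real.div_rpow hρ.le (by positivity), Real.rpow_add hρ, Real.rpow_natCast]
        field_simp

lemma exists_lintegral_gStar_le_of_integral_eq_zero (𝕜 : Type*) [RCLike 𝕜] (hα : 0 < α)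
    (hlam : 0 < (lam - 2) * n) :
    ∃ C : ℝ≥0∞, C ≠ ∞ ∧ ∀ (f : ℝ^n → 𝕜) (c : ℝ^n) (ρ : ℝ), 0 < ρ → Integrable f volume →
      (∀ z ∉ closedBall c ρ, f z = 0) → ∫ z, f z = 0 →
      ∫⁻ x in {x | 2 * ρ ≤ dist x c}, gStar lam α f x ≤ C * ∫⁻ z, ‖f z‖ₑ := by
  obtain ⟨ε, hε, hεα, hεlam⟩ : ∃ ε : ℝ, 0 < ε ∧ ε ≤ α ∧ 2 * ε < (lam - 2) * n :=
    ⟨min α ((lam - 2) * n / 4), lt_min hα (by linarith), min_le_left _ _,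
      by linarith [min_le_right α ((lam - 2) * n / 4)]⟩
  obtain ⟨C, hC_top, hC⟩ := exists_gStar_le_of_integral_eq_zero 𝕜 hα hε.le hεα hεlam
  obtain ⟨C', hC'_top, hC'⟩ := exists_lintegral_div_rpow_le (n := n) hε
  refine ⟨C * C' * ENNReal.ofReal (2 ^ (n + ε)), by finiteness,
    fun f c ρ hρ hf hsupp hint => ?_⟩
  set I := ∫⁻ z, ‖f z‖ₑ
  set B := ENNReal.ofReal (2 ^ (n + ε) * (ρ ^ n)⁻¹)
  calc ∫⁻ x in {x | 2 * ρ ≤ dist x c}, gStar lam α f x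
      ≤ ∫⁻ x in {x | 2 * ρ ≤ dist x c},
          C * I * B * ENNReal.ofReal ((ρ / (ρ + ‖x - c‖)) ^ (n + ε)) := by
        refine setLIntegral_mono' (measurableSet_le (by fun_prop) (by fun_prop)) fun x hx => ?_
        refine (hC f c ρ hρ hf hsupp hint x hx).trans ?_
        rw [mul_right_comm, mul_assoc (C * I), ← ENNReal.ofReal_mul (by positivity),
          ← dist_eq_norm]
        gcongr _ * ENNReal.ofReal ?_
        exact rpow_mul_rpow_le_inv_pow_mul hρ hε.le hx
    _ ≤ C * I * B * (C' * ENNReal.ofReal (ρ ^ n)) := by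
        rw [lintegral_const_mul _ (by fun_prop)]
        gcongr
        exact (setLIntegral_le_lintegral _ _).trans (hC' c ρ hρ)
    _ = C * C' * ENNReal.ofReal (2 ^ (n + ε)) * I := by
        have hB : B * ENNReal.ofReal (ρ ^ n) = ENNReal.ofReal (2 ^ (n + ε)) := by
          rw [← ENNReal.ofReal_mul (by positivity), inv_mul_cancel_right₀ (by positivity)]
        rw [← hB]
        ring

end Decay

/-! ### Whitney decompositions -/

section Whitney

/-- The measurable sets `Q i` form a Whitney decomposition of `Ω`: they partition `Ω`, and each is
comparable with the ball of centre `c i` and radius `r i`, where `r i` is comparable with the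
distance from `c i` to the complement of `Ω`. -/
structure IsWhitney {E ι : Type*} [PseudoMetricSpace E] [MeasurableSpace E] (Ω : Set E)
    (c : ι → E) (r : ι → ℝ) (Q : ι → Set E) : Prop where
  radius_pos (i : ι) : 0 < r i
  measurableSet (i : ι) : MeasurableSet (Q i)
  ball_subset (i : ι) : ball (c i) (r i) ⊆ Q i
  subset_ball (i : ι) : Q i ⊆ ball (c i) (5 * r i)
  ball_subset_whole (i : ι) : ball (c i) (20 * r i) ⊆ Ω
  exists_notMem (i : ι) : ∃ z ∉ Ω, z ∈ ball (c i) (25 * r i)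
  pairwise_disjoint : Pairwise (Function.onFun Disjoint Q)
  iUnion_eq : ⋃ i, Q i = Ω

lemma exists_pairwise_disjoint_between {ι X : Type*} [Countable ι] [MeasurableSpace X]
    {A B : ι → Set X} (hA : ∀ i, MeasurableSet (A i)) (hB : ∀ i, MeasurableSet (B i))
    (hBA : ∀ i, B i ⊆ A i) (hdisj : Pairwise (Function.onFun Disjoint B)) :
    ∃ Q : ι → Set X, (∀ i, MeasurableSet (Q i)) ∧ (∀ i, B i ⊆ Q i) ∧ (∀ i, Q i ⊆ A i) ∧
      Pairwise (Function.onFun Disjoint Q) ∧ ⋃ i, Q i = ⋃ i, A i := by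
  obtain ⟨e, he⟩ := exists_injective_nat ι
  refine ⟨fun i => B i ∪ ((A i \ ⋃ j, B j) \ ⋃ (j) (_ : e j < e i), A j),
    fun i => (hB i).union
      (((hA i).diff (.iUnion hB)).diff (.iUnion fun j => .iUnion fun _ => hA j)),
    fun i => subset_union_left,
    fun i => union_subset (hBA i) (sdiff_subset.trans sdiff_subset), fun i j hij => ?_, ?_⟩
  · refine disjoint_left.2 fun x hxi hxj => ?_
    obtain hxi | ⟨⟨hxAi, hxi⟩, hxi'⟩ := hxi <;> obtain hxj | ⟨⟨hxAj, hxj⟩, hxj'⟩ := hxj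
    · exact disjoint_left.1 (hdisj hij) hxi hxj
    · exact hxj (mem_iUnion_of_mem i hxi)
    · exact hxi (mem_iUnion_of_mem j hxj)
    · obtain h | h := (he.ne hij).lt_or_gt
      · exact hxj' (mem_iUnion₂_of_mem h hxAi)
      · exact hxi' (mem_iUnion₂_of_mem h hxAj)
  · refine Subset.antisymm (iUnion_mono fun i =>
      union_subset (hBA i) (sdiff_subset.trans sdiff_subset)) fun x hx => ?_
    by_cases hxB : x ∈ ⋃ j, B j
    · obtain ⟨i, hi⟩ := mem_iUnion.1 hxB
      exact mem_iUnion_of_mem i (.inl hi)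
    · obtain ⟨i, hxi, hmin⟩ := (measure e).wf.has_min {i | x ∈ A i} (mem_iUnion.1 hx)
      refine mem_iUnion_of_mem i (.inr ⟨⟨hxi, hxB⟩, fun hxj => ?_⟩)
      obtain ⟨j, hji, hxj⟩ := mem_iUnion₂.1 hxj
      exact hmin j hxj hji

lemma exists_isWhitney {E : Type*} [PseudoMetricSpace E] [SecondCountableTopology E]
    [MeasurableSpace E] [OpensMeasurableSpace E] {Ω : Set E} (hΩ : IsOpen Ω) (hne : Ωᶜ.Nonempty)
    (hbdd : ∃ R, ∀ x ∈ Ω, infDist x Ωᶜ ≤ R) :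
    ∃ (u : Set E) (r : u → ℝ) (Q : u → Set E), u.Countable ∧ IsWhitney Ω Subtype.val r Q := by
  obtain ⟨R, hR⟩ := hbdd
  set r : E → ℝ := fun b => infDist b Ωᶜ / 20
  have hr_pos (b : E) (hb : b ∈ Ω) : 0 < r b :=
    div_pos ((hΩ.isClosed_compl.notMem_iff_infDist_pos hne).1 fun h => h hb) (by norm_num)
  have hr20 (b : E) : infDist b Ωᶜ = 20 * r b := (mul_div_cancel₀ _ (by norm_num)).symm
  have hball (b : E) : ball b (20 * r b) ⊆ Ω := hr20 b ▸ ball_infDist_compl_subset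
  obtain ⟨u, huΩ, hdisj, hcov⟩ := Vitali.exists_disjoint_subfamily_covering_enlargement_ball Ω
    id r (R / 20) (fun b hb => div_le_div_of_nonneg_right (hR b hb) (by norm_num)) 5 (by norm_num)
  have hu : u.Countable := hdisj.countable_of_isOpen (fun _ _ => isOpen_ball)
    fun b hb => nonempty_ball.2 (hr_pos b (huΩ hb))
  have : Countable u := hu.to_subtype
  have hu_pos (b : u) : 0 < r b := hr_pos b (huΩ b.2)
  obtain ⟨Q, hQm, hBQ, hQA, hQ, hUnion⟩ := exists_pairwise_disjoint_between (ι := u)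
    (A := fun b => ball (b : E) (5 * r b)) (B := fun b => ball (b : E) (r b))
    (fun _ => measurableSet_ball)
    (fun _ => measurableSet_ball) (fun b => ball_subset_ball (by linarith [hu_pos b]))
    fun b b' h => hdisj b.2 b'.2 (Subtype.coe_injective.ne h)
  refine ⟨u, fun b => r b, Q, hu, hu_pos, hQm, hBQ, hQA, fun b => hball b, fun b => ?_, hQ, ?_⟩
  · obtain ⟨z, hz, hbz⟩ := (infDist_lt_iff (r := 25 * r b) hne).1
      (by linarith [hr20 b, hu_pos b] : infDist (b : E) Ωᶜ < 25 * r b)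
    exact ⟨z, hz, mem_ball'.2 hbz⟩
  · refine hUnion.trans (Subset.antisymm (iUnion_subset fun b =>
      (ball_subset_ball (by linarith [hu_pos b])).trans (hball b)) fun x hx => ?_)
    obtain ⟨b, hb, hsub⟩ := hcov x hx
    exact mem_iUnion_of_mem ⟨b, hb⟩ (hsub (mem_ball_self (hr_pos x hx)))

section

variable {E F ι : Type*} [PseudoMetricSpace E] [MeasurableSpace E] {μ : Measure E}
  [NormedAddCommGroup F] {Ω : Set E} {c : ι → E} {r : ι → ℝ} {Q : ι → Set E} {f : E → F}

lemma IsWhitney.measure_ne_top (hQ : IsWhitney Ω c r Q) (hΩ : μ Ω ≠ ∞) (i : ι) : μ (Q i) ≠ ∞ :=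
  measure_ne_top_of_subset (hQ.iUnion_eq ▸ subset_iUnion Q i) hΩ

lemma IsWhitney.integrableOn [ProperSpace E] (hQ : IsWhitney Ω c r Q)
    (hf : LocallyIntegrable f μ) (i : ι) : IntegrableOn f (Q i) μ :=
  (hf.integrableOn_isCompact (isCompact_closedBall (c i) (5 * r i))).mono_set
    ((hQ.subset_ball i).trans ball_subset_closedBall)

end

lemma exists_infDist_compl_le {E : Type*} [NormedAddCommGroup E] [NormedSpace ℝ E]
    [FiniteDimensional ℝ E] [Nontrivial E] [MeasurableSpace E] [BorelSpace E] (μ : Measure E)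
    [μ.IsAddHaarMeasure] {Ω : Set E} (hΩ : μ Ω ≠ ∞) : ∃ R, ∀ x ∈ Ω, infDist x Ωᶜ ≤ R := by
  have : NoncompactSpace E := NormedSpace.noncompactSpace ℝ E
  have : ProperSpace E := FiniteDimensional.proper_real E
  have hlt : μ Ω < ⨆ k : ℕ, μ (ball 0 k) := by
    rw [← Monotone.measure_iUnion fun i j hij => ball_subset_ball (Nat.cast_le.2 hij),
      iUnion_ball_nat, measure_univ_of_isAddLeftInvariant]
    exact hΩ.lt_top
  obtain ⟨k, hk⟩ := lt_iSup_iff.1 hlt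
  refine ⟨k, fun x _ => le_of_not_gt fun hkx => hk.not_ge ?_⟩
  calc μ (ball 0 k) = μ (ball x k) := by
        rw [Measure.addHaar_ball_center μ x]
    _ ≤ μ Ω := measure_mono ((ball_subset_ball hkx.le).trans ball_infDist_compl_subset)

lemma exists_isWhitney_of_measure_ne_top {E : Type*} [NormedAddCommGroup E] [NormedSpace ℝ E]
    [FiniteDimensional ℝ E] [Nontrivial E] [MeasurableSpace E] [BorelSpace E] (μ : Measure E)
    [μ.IsAddHaarMeasure] {Ω : Set E} (hΩ : IsOpen Ω) (hΩμ : μ Ω ≠ ∞) :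
    ∃ (u : Set E) (r : u → ℝ) (Q : u → Set E), u.Countable ∧ IsWhitney Ω Subtype.val r Q := by
  have : NoncompactSpace E := NormedSpace.noncompactSpace ℝ E
  have : ProperSpace E := FiniteDimensional.proper_real E
  refine exists_isWhitney hΩ (nonempty_compl.2 ?_) (exists_infDist_compl_le μ hΩμ)
  rintro rfl
  exact hΩμ (measure_univ_of_isAddLeftInvariant μ)

end Whitney

/-! ### The Calderón–Zygmund decomposition -/

section CalderonZygmund

lemma enorm_setAverage_le {X F : Type*} [MeasurableSpace X] [NormedAddCommGroup F]
    [NormedSpace ℝ F] {μ : Measure X} {A : Set X} {f : X → F} {K : ℝ≥0∞}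
    (h : ∫⁻ z in A, ‖f z‖ₑ ∂μ ≤ K * μ A) : ‖⨍ z in A, f z ∂μ‖ₑ ≤ K :=
  (enorm_integral_le_lintegral_enorm f).trans
    (by rw [← laverage, setLAverage_eq]; exact ENNReal.div_le_of_le_mul h)

variable {E F ι : Type*} [MeasurableSpace E] {μ : Measure E} [NormedAddCommGroup F]
  [NormedSpace ℝ F] {f : E → F} {Q : ι → Set E} {K : ℝ≥0∞} {i : ι} {z : E}

/-- The oscillation of `f` on the cell `Q i`, a bad part of the Calderón–Zygmund decomposition. -/
def badPart (μ : Measure E) (f : E → F) (Q : ι → Set E) (i : ι) : E → F :=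
  (Q i).indicator fun z => f z - ⨍ w in Q i, f w ∂μ

/-- The good part of the Calderón–Zygmund decomposition of `f` along the cells `Q i`: the averages
of `f` on the cells, and `f` elsewhere. -/
def goodPart (μ : Measure E) (f : E → F) (Q : ι → Set E) (z : E) : F :=
  f z - ∑' i, badPart μ f Q i z

lemma hasSum_badPart_of_mem (hQ : Pairwise (Function.onFun Disjoint Q)) (hz : z ∈ Q i) :
    HasSum (fun j => badPart μ f Q j z) (f z - ⨍ w in Q i, f w ∂μ) := by
  have h := hasSum_single (f := fun j => badPart μ f Q j z) i fun j hj =>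
    indicator_of_notMem (disjoint_left.1 (hQ hj.symm) hz) _
  rwa [badPart, indicator_of_mem hz] at h

lemma hasSum_badPart_of_notMem (hz : z ∉ ⋃ i, Q i) : HasSum (fun j => badPart μ f Q j z) 0 :=
  hasSum_zero.congr_fun fun j => indicator_of_notMem (fun h => hz (mem_iUnion_of_mem j h)) _

lemma hasSum_badPart (hQ : Pairwise (Function.onFun Disjoint Q)) (z : E) :
    HasSum (fun i => badPart μ f Q i z) (f z - goodPart μ f Q z) := by
  rw [goodPart, sub_sub_cancel]
  by_cases hz : z ∈ ⋃ i, Q i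
  · obtain ⟨i, hi⟩ := mem_iUnion.1 hz
    exact (hasSum_badPart_of_mem hQ hi).summable.hasSum
  · exact (hasSum_badPart_of_notMem hz).summable.hasSum

lemma goodPart_of_mem (hQ : Pairwise (Function.onFun Disjoint Q)) (hz : z ∈ Q i) :
    goodPart μ f Q z = ⨍ w in Q i, f w ∂μ := by
  rw [goodPart, (hasSum_badPart_of_mem hQ hz).tsum_eq, sub_sub_cancel]

lemma goodPart_of_notMem (hz : z ∉ ⋃ i, Q i) : goodPart μ f Q z = f z := by
  rw [goodPart, (hasSum_badPart_of_notMem hz).tsum_eq, sub_zero]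

lemma stronglyMeasurable_badPart (hQm : ∀ i, MeasurableSet (Q i)) (hf : StronglyMeasurable f)
    (i : ι) : StronglyMeasurable (badPart μ f Q i) :=
  (hf.sub stronglyMeasurable_const).indicator (hQm i)

lemma stronglyMeasurable_goodPart [Countable ι] (hQm : ∀ i, MeasurableSet (Q i))
    (hQ : Pairwise (Function.onFun Disjoint Q)) (hf : StronglyMeasurable f) :
    StronglyMeasurable (goodPart μ f Q) := by
  refine hf.sub (stronglyMeasurable_of_tendsto atTop (f := fun (S : Finset ι) z =>
    ∑ i ∈ S, badPart μ f Q i z) (fun S => Finset.stronglyMeasurable_fun_sum S fun i _ =>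
      stronglyMeasurable_badPart hQm hf i) (tendsto_pi_nhds.2 fun z => ?_))
  exact (hasSum_badPart hQ z).summable.hasSum

lemma integrable_badPart (hQm : MeasurableSet (Q i)) (hQμ : μ (Q i) ≠ ∞)
    (hf : IntegrableOn f (Q i) μ) : Integrable (badPart μ f Q i) μ :=
  (integrable_indicator_iff hQm).2 (hf.sub (integrableOn_const hQμ))

lemma integral_badPart [CompleteSpace F] (hQm : MeasurableSet (Q i)) (hQμ : μ (Q i) ≠ ∞)
    (hf : IntegrableOn f (Q i) μ) : ∫ z, badPart μ f Q i z ∂μ = 0 := by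
  simp only [badPart]
  rw [integral_indicator hQm, integral_sub hf (integrableOn_const hQμ), setIntegral_const,
    measure_smul_setAverage f hQμ, sub_self]

lemma lintegral_enorm_badPart_le (hQm : MeasurableSet (Q i))
    (hK : ∫⁻ z in Q i, ‖f z‖ₑ ∂μ ≤ K * μ (Q i)) :
    ∫⁻ z, ‖badPart μ f Q i z‖ₑ ∂μ ≤ 2 * K * μ (Q i) := by
  calc ∫⁻ z, ‖badPart μ f Q i z‖ₑ ∂μ
      = ∫⁻ z in Q i, ‖f z - ⨍ w in Q i, f w ∂μ‖ₑ ∂μ := by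
        rw [← lintegral_indicator hQm]
        simp only [badPart, enorm_indicator_eq_indicator_enorm]
    _ ≤ ∫⁻ z in Q i, ‖f z‖ₑ + K ∂μ := lintegral_mono fun z =>
        enorm_sub_le.trans (add_le_add le_rfl (enorm_setAverage_le hK))
    _ = (∫⁻ z in Q i, ‖f z‖ₑ ∂μ) + K * μ (Q i) := by
        rw [lintegral_add_right _ measurable_const, setLIntegral_const]
    _ ≤ K * μ (Q i) + K * μ (Q i) := by gcongr
    _ = 2 * K * μ (Q i) := by ring

lemma tsum_lintegral_enorm_badPart_le [Countable ι] (hQm : ∀ i, MeasurableSet (Q i))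
    (hQ : Pairwise (Function.onFun Disjoint Q))
    (hK : ∀ i, ∫⁻ z in Q i, ‖f z‖ₑ ∂μ ≤ K * μ (Q i)) :
    ∑' i, ∫⁻ z, ‖badPart μ f Q i z‖ₑ ∂μ ≤ 2 * K * μ (⋃ i, Q i) := by
  rw [measure_iUnion hQ hQm, ← ENNReal.tsum_mul_left]
  exact ENNReal.tsum_le_tsum fun i => lintegral_enorm_badPart_le (hQm i) (hK i)

lemma enorm_goodPart_le_of_mem (hQ : Pairwise (Function.onFun Disjoint Q))
    (hK : ∀ i, ∫⁻ z in Q i, ‖f z‖ₑ ∂μ ≤ K * μ (Q i)) (hz : z ∈ ⋃ i, Q i) :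
    ‖goodPart μ f Q z‖ₑ ≤ K := by
  obtain ⟨i, hi⟩ := mem_iUnion.1 hz
  rw [goodPart_of_mem hQ hi]
  exact enorm_setAverage_le (hK i)

lemma locallyIntegrable_goodPart [TopologicalSpace E] [IsLocallyFiniteMeasure μ] [Countable ι]
    (hQm : ∀ i, MeasurableSet (Q i)) (hQ : Pairwise (Function.onFun Disjoint Q)) (hKtop : K ≠ ∞)
    (hK : ∀ i, ∫⁻ z in Q i, ‖f z‖ₑ ∂μ ≤ K * μ (Q i)) (hfm : StronglyMeasurable f)
    (hf : LocallyIntegrable f μ) : LocallyIntegrable (goodPart μ f Q) μ := by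
  have hnorm : LocallyIntegrable (fun z => ‖f z‖) μ := fun z => (hf z).norm
  have hbound : LocallyIntegrable (fun z => ‖f z‖ + K.toReal) μ :=
    hnorm.add (locallyIntegrable_const _)
  refine hbound.mono (stronglyMeasurable_goodPart hQm hQ hfm).aestronglyMeasurable
    (.of_forall fun z => ?_)
  rw [Real.norm_of_nonneg (by positivity)]
  by_cases hz : z ∈ ⋃ i, Q i
  · refine le_add_of_nonneg_of_le (norm_nonneg _) ?_
    rw [← toReal_enorm]
    exact ENNReal.toReal_mono hKtop (enorm_goodPart_le_of_mem hQ hK hz)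
  · rw [goodPart_of_notMem hz]
    exact le_add_of_nonneg_right ENNReal.toReal_nonneg

lemma lintegral_enorm_goodPart_sq_le [Countable ι] (hQm : ∀ i, MeasurableSet (Q i))
    (hQ : Pairwise (Function.onFun Disjoint Q))
    (hK : ∀ i, ∫⁻ z in Q i, ‖f z‖ₑ ∂μ ≤ K * μ (Q i)) :
    ∫⁻ z, ‖goodPart μ f Q z‖ₑ ^ 2 ∂μ ≤
      ∫⁻ z in (⋃ i, Q i)ᶜ, ‖f z‖ₑ ^ 2 ∂μ + K ^ 2 * μ (⋃ i, Q i) := by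
  have hm : MeasurableSet (⋃ i, Q i) := .iUnion hQm
  rw [← lintegral_add_compl _ hm, add_comm]
  refine add_le_add (setLIntegral_congr_fun hm.compl fun z hz => ?_).le ?_
  · rw [goodPart_of_notMem hz]
  · rw [← setLIntegral_const]
    exact setLIntegral_mono' hm fun z hz =>
      pow_le_pow_left' (enorm_goodPart_le_of_mem hQ hK hz) 2

end CalderonZygmund

lemma IsWhitney.setLIntegral_le {E ι : Type*} [NormedAddCommGroup E] [NormedSpace ℝ E]
    [FiniteDimensional ℝ E] [MeasurableSpace E] [BorelSpace E] {μ : Measure E} [μ.IsAddHaarMeasure]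
    {Ω : Set E} {c : ι → E} {r : ι → ℝ} {Q : ι → Set E} (hQ : IsWhitney Ω c r Q)
    {w : E → ℝ≥0∞} {s : ℝ≥0∞} (hw : ∀ z ∉ Ω, maximalFn μ w z ≤ s) (i : ι) :
    ∫⁻ z in Q i, w z ∂μ ≤ 25 ^ finrank ℝ E * s * μ (Q i) := by
  obtain ⟨z, hz, hzi⟩ := hQ.exists_notMem i
  have hr := hQ.radius_pos i
  calc ∫⁻ z in Q i, w z ∂μ
      ≤ ∫⁻ z in ball (c i) (25 * r i), w z ∂μ :=
        lintegral_mono_set ((hQ.subset_ball i).trans (ball_subset_ball (by linarith)))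
    _ ≤ maximalFn μ w z * μ (ball (c i) (25 * r i)) := setLIntegral_ball_le_maximalFn_mul hzi
    _ = 25 ^ finrank ℝ E * maximalFn μ w z * μ (ball (c i) (r i)) := by
        rw [measure_ball_mul μ _ (by norm_num), ENNReal.ofReal_ofNat]
        ring
    _ ≤ 25 ^ finrank ℝ E * s * μ (Q i) := by
        gcongr
        exacts [hw z hz, hQ.ball_subset i]

/-! ### The weak type bound and the `L^p` estimate for `p < 2` -/

section WeakType

variable {𝕜 : Type*} [RCLike 𝕜] {n : ℕ} {α lam : ℝ} {f g : ℝ^n → 𝕜} {s : ℝ≥0∞}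

lemma lintegral_closedBall_ne_top (hf : LocallyIntegrable f volume) (y : ℝ^n) (t : ℝ) :
    ∫⁻ z in closedBall y t, ‖f z‖ₑ ≠ ∞ :=
  (hf.integrableOn_isCompact (isCompact_closedBall y t)).2.ne

lemma gStar_add_le (hα : 0 < α) (hf : LocallyIntegrable f volume)
    (hg : LocallyIntegrable g volume) (x : ℝ^n) :
    gStar lam α (fun z => f z + g z) x ≤ gStar lam α f x + gStar lam α g x := by
  have h := gStar_le_tsum (lam := lam) (f := fun z => f z + g z) hα (F := ![f, g])
    (Fin.forall_fin_two.2 ⟨hf, hg⟩)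
    (.of_forall fun z => by simpa using hasSum_fintype fun i : Fin 2 => (![f, g]) i z)
    (fun y t => by
      rw [tsum_fintype, Fin.sum_univ_two]
      exact ENNReal.add_ne_top.2
        ⟨lintegral_closedBall_ne_top hf y t, lintegral_closedBall_ne_top hg y t⟩) x
  rwa [tsum_fintype, Fin.sum_univ_two] at h

lemma exists_mul_volume_le_gStar_le (𝕜 : Type*) [RCLike 𝕜] (hα : 0 < α) (hlam : n < lam * n) :
    ∃ C : ℝ≥0∞, C ≠ ∞ ∧ ∀ f : ℝ^n → 𝕜, StronglyMeasurable f → LocallyIntegrable f volume →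
      ∀ s : ℝ≥0∞, s ^ 2 * volume {x | s ≤ gStar lam α f x} ≤ C * ∫⁻ z, ‖f z‖ₑ ^ 2 := by
  obtain ⟨C, hC_top, hC⟩ := exists_lintegral_gStar_rpow_le_of_two_le 𝕜 hα hlam le_rfl
  refine ⟨C, hC_top, fun f hfm hf s => ?_⟩
  have hset : {x | s ≤ gStar lam α f x} = {x | s ^ 2 ≤ gStar lam α f x ^ 2} := by
    ext x
    exact (ENNReal.pow_le_pow_left_iff two_ne_zero).symm
  have h := hC f hfm hf
  simp only [ENNReal.rpow_ofNat] at h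
  rw [hset]
  exact (mul_meas_ge_le_lintegral ((measurable_gStar hα lam hf).pow_const 2) _).trans h

section Whitney

variable {ι : Type*} [Countable ι] {Ω : Set (ℝ^n)} {c : ι → ℝ^n} {r : ι → ℝ} {Q : ι → Set (ℝ^n)}
  {K : ℝ≥0∞}

lemma IsWhitney.gStar_le_gStar_goodPart_add (hQ : IsWhitney Ω c r Q) (hΩ : volume Ω ≠ ∞)
    (hα : 0 < α) (hK_top : K ≠ ∞) (hK : ∀ i, ∫⁻ z in Q i, ‖f z‖ₑ ≤ K * volume (Q i))
    (hfm : StronglyMeasurable f) (hf : LocallyIntegrable f volume) (x : ℝ^n) :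
    gStar lam α f x ≤ gStar lam α (goodPart volume f Q) x +
      ∑' i, gStar lam α (badPart volume f Q i) x := by
  have hgood := locallyIntegrable_goodPart hQ.measurableSet hQ.pairwise_disjoint hK_top hK hfm hf
  have h := gStar_add_le (lam := lam) hα hgood (hf.sub hgood) x
  have hsplit : (fun z => goodPart volume f Q z + (f - goodPart volume f Q) z) = f :=
    add_sub_cancel (goodPart volume f Q) f
  rw [hsplit] at h
  refine h.trans (add_le_add le_rfl (gStar_le_tsum hα
    (fun i => (integrable_badPart (hQ.measurableSet i) (hQ.measure_ne_top hΩ i)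
      (hQ.integrableOn hf i)).locallyIntegrable)
    (.of_forall (hasSum_badPart hQ.pairwise_disjoint)) (fun y t => ?_) x))
  refine ne_top_of_le_ne_top ?_ ((ENNReal.tsum_le_tsum fun i => setLIntegral_le_lintegral _ _).trans
    (tsum_lintegral_enorm_badPart_le hQ.measurableSet hQ.pairwise_disjoint hK))
  rw [hQ.iUnion_eq]
  finiteness

lemma IsWhitney.volume_two_mul_lt_gStar_le (hQ : IsWhitney Ω c r Q) (hΩ : volume Ω ≠ ∞)
    (hα : 0 < α) (hK_top : K ≠ ∞) (hK : ∀ i, ∫⁻ z in Q i, ‖f z‖ₑ ≤ K * volume (Q i))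
    (hfm : StronglyMeasurable f) (hf : LocallyIntegrable f volume) :
    volume {x | 2 * s < gStar lam α f x} ≤ volume {x | s ≤ gStar lam α (goodPart volume f Q) x} +
      (volume Ω + volume ({x | s ≤ ∑' i, gStar lam α (badPart volume f Q i) x} ∩ Ωᶜ)) := by
  refine (measure_mono fun x hx => ?_).trans
    ((measure_union_le _ _).trans (add_le_add le_rfl (measure_union_le _ _)))
  by_contra hx'
  simp only [mem_union, mem_inter_iff, mem_compl_iff, mem_ofPred_eq, not_or, not_and',
    not_le] at hx'
  obtain ⟨hgood, hxΩ, hbad⟩ := hx'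
  refine hx.not_ge ((hQ.gStar_le_gStar_goodPart_add hΩ hα hK_top hK hfm hf x).trans ?_)
  rw [two_mul]
  exact add_le_add hgood.le (hbad hxΩ).le

lemma exists_setLIntegral_compl_tsum_gStar_badPart_le (𝕜 : Type*) [RCLike 𝕜] (hα : 0 < α)
    (hlam : 0 < (lam - 2) * n) :
    ∃ C : ℝ≥0∞, C ≠ ∞ ∧ ∀ {ι : Type} [Countable ι] {Ω : Set (ℝ^n)} {c : ι → ℝ^n} {r : ι → ℝ}
      {Q : ι → Set (ℝ^n)}, IsWhitney Ω c r Q → volume Ω ≠ ∞ → ∀ f : ℝ^n → 𝕜,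
      LocallyIntegrable f volume → ∀ K : ℝ≥0∞, (∀ i, ∫⁻ z in Q i, ‖f z‖ₑ ≤ K * volume (Q i)) →
      ∫⁻ x in Ωᶜ, ∑' i, gStar lam α (badPart volume f Q i) x ≤ C * K * volume Ω := by
  obtain ⟨C, hC_top, hC⟩ := exists_lintegral_gStar_le_of_integral_eq_zero 𝕜 hα hlam
  refine ⟨C * 2, by finiteness, fun {ι _ Ω c r Q} hQ hΩ f hf K hK => ?_⟩
  have hint (i : ι) := integrable_badPart (hQ.measurableSet i) (hQ.measure_ne_top hΩ i)
    (hQ.integrableOn hf i)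
  calc ∫⁻ x in Ωᶜ, ∑' i, gStar lam α (badPart volume f Q i) x
      = ∑' i, ∫⁻ x in Ωᶜ, gStar lam α (badPart volume f Q i) x := lintegral_tsum fun i =>
        (measurable_gStar hα lam (hint i).locallyIntegrable).aemeasurable
    _ ≤ ∑' i, C * ∫⁻ z, ‖badPart volume f Q i z‖ₑ := by
        refine ENNReal.tsum_le_tsum fun i => ?_
        have hr := hQ.radius_pos i
        refine (lintegral_mono_set fun x hx => ?_).trans (hC _ (c i) (5 * r i) (by positivity)
          (hint i) (fun z hz => ?_)
          (integral_badPart (hQ.measurableSet i) (hQ.measure_ne_top hΩ i) (hQ.integrableOn hf i)))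
        · have hfar : 20 * r i ≤ dist x (c i) :=
            not_lt.1 fun h => hx (hQ.ball_subset_whole i (mem_ball.2 h))
          exact (by linarith : 2 * (5 * r i) ≤ dist x (c i))
        · exact indicator_of_notMem
            (fun h => hz (ball_subset_closedBall (hQ.subset_ball i h))) _
    _ ≤ C * (2 * K * volume Ω) := by
        rw [ENNReal.tsum_mul_left, ← hQ.iUnion_eq]
        gcongr
        exact tsum_lintegral_enorm_badPart_le hQ.measurableSet hQ.pairwise_disjoint hK
    _ = C * 2 * K * volume Ω := by ring

end Whitney

lemma exists_volume_lt_gStar_le_of_isWhitney (𝕜 : Type*) [RCLike 𝕜] (hα : 0 < α)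
    (hlam : 0 < (lam - 2) * n) {A : ℝ≥0∞} (hA : A ≠ ∞) :
    ∃ C : ℝ≥0∞, C ≠ ∞ ∧ ∀ {ι : Type} [Countable ι] {Ω : Set (ℝ^n)} {c : ι → ℝ^n} {r : ι → ℝ}
      {Q : ι → Set (ℝ^n)}, IsWhitney Ω c r Q → volume Ω ≠ ∞ → ∀ f : ℝ^n → 𝕜, StronglyMeasurable f →
      LocallyIntegrable f volume → ∀ s : ℝ≥0∞, s ≠ 0 → s ≠ ∞ →
      (∀ i, ∫⁻ z in Q i, ‖f z‖ₑ ≤ A * s * volume (Q i)) →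
      volume {x | 2 * s < gStar lam α f x} ≤
        C * ((s ^ 2)⁻¹ * (∫⁻ z in Ωᶜ, ‖f z‖ₑ ^ 2) + volume Ω) := by
  have hlam' : n < lam * n := by nlinarith [n.cast_nonneg (α := ℝ)]
  obtain ⟨C₂, hC₂_top, hC₂⟩ := exists_mul_volume_le_gStar_le 𝕜 hα hlam'
  obtain ⟨C₁, hC₁_top, hC₁⟩ := exists_setLIntegral_compl_tsum_gStar_badPart_le 𝕜 hα hlam
  refine ⟨C₂ + (C₂ * A ^ 2 + C₁ * A + 1), by finiteness,
    fun {ι _ Ω c r Q} hQ hΩ f hfm hf s hs hs_top hK => ?_⟩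
  have hK_top : A * s ≠ ∞ := by finiteness
  set g := goodPart volume f Q
  set S : ℝ^n → ℝ≥0∞ := fun x => ∑' i, gStar lam α (badPart volume f Q i) x
  have hgood : volume {x | s ≤ gStar lam α g x} ≤
      (s ^ 2)⁻¹ * (C₂ * ((∫⁻ z in Ωᶜ, ‖f z‖ₑ ^ 2) + (A * s) ^ 2 * volume Ω)) := by
    rw [← ENNReal.mul_le_iff_le_inv (by positivity) (by finiteness)]
    refine (hC₂ g (stronglyMeasurable_goodPart hQ.measurableSet hQ.pairwise_disjoint hfm)
      (locallyIntegrable_goodPart hQ.measurableSet hQ.pairwise_disjoint hK_top hK hfm hf)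
      s).trans ?_
    gcongr C₂ * ?_
    simpa only [hQ.iUnion_eq] using
      lintegral_enorm_goodPart_sq_le hQ.measurableSet hQ.pairwise_disjoint hK
  have hbad : volume ({x | s ≤ S x} ∩ Ωᶜ) ≤ s⁻¹ * (C₁ * (A * s) * volume Ω) := by
    rw [← ENNReal.mul_le_iff_le_inv hs hs_top]
    have hSm : Measurable S := .tsum fun i => measurable_gStar hα lam
      (integrable_badPart (hQ.measurableSet i) (hQ.measure_ne_top hΩ i)
        (hQ.integrableOn hf i)).locallyIntegrable
    rw [← Measure.restrict_apply (measurableSet_le measurable_const hSm)]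
    exact (mul_meas_ge_le_lintegral hSm s).trans (hC₁ hQ hΩ f hf _ hK)
  calc volume {x | 2 * s < gStar lam α f x}
      ≤ volume {x | s ≤ gStar lam α g x} + (volume Ω + volume ({x | s ≤ S x} ∩ Ωᶜ)) :=
        hQ.volume_two_mul_lt_gStar_le hΩ hα hK_top hK hfm hf
    _ ≤ C₂ * ((s ^ 2)⁻¹ * ∫⁻ z in Ωᶜ, ‖f z‖ₑ ^ 2) + (C₂ * A ^ 2 + C₁ * A + 1) * volume Ω := by
        refine (add_le_add hgood (add_le_add le_rfl hbad)).trans_eq ?_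
        calc _ = C₂ * ((s ^ 2)⁻¹ * ∫⁻ z in Ωᶜ, ‖f z‖ₑ ^ 2) +
              (C₂ * A ^ 2 * ((s ^ 2)⁻¹ * s ^ 2) + C₁ * A * (s⁻¹ * s) + 1) * volume Ω := by ring
          _ = _ := by
            rw [ENNReal.inv_mul_cancel hs hs_top,
              ENNReal.inv_mul_cancel (pow_ne_zero 2 hs) (ENNReal.pow_ne_top hs_top), mul_one,
              mul_one]
    _ ≤ _ := by
        rw [mul_add]
        exact add_le_add (mul_le_mul_left le_self_add _) (mul_le_mul_left le_add_self _)

lemma exists_volume_lt_gStar_le (𝕜 : Type*) [RCLike 𝕜] (hα : 0 < α)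
    (hlam : 0 < (lam - 2) * n) :
    ∃ C : ℝ≥0∞, C ≠ ∞ ∧ ∀ f : ℝ^n → 𝕜, StronglyMeasurable f → LocallyIntegrable f volume →
      ∀ s : ℝ≥0∞, s ≠ 0 → s ≠ ∞ → volume {x | s < maximalFn volume (‖f ·‖ₑ) x} ≠ ∞ →
      volume {x | 2 * s < gStar lam α f x} ≤
        C * ((s ^ 2)⁻¹ * (∫⁻ z in {x | maximalFn volume (‖f ·‖ₑ) x ≤ s}, ‖f z‖ₑ ^ 2) +
          volume {x | s < maximalFn volume (‖f ·‖ₑ) x}) := by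
  have : NeZero n := ⟨fun h => by simp [h] at hlam⟩
  obtain ⟨C, hC_top, hC⟩ := exists_volume_lt_gStar_le_of_isWhitney 𝕜 hα hlam
    (A := 25 ^ n) (by finiteness)
  refine ⟨C, hC_top, fun f hfm hf s hs hs_top hΩ => ?_⟩
  obtain ⟨u, r, Q, hu, hQ⟩ := exists_isWhitney_of_measure_ne_top volume
    (isOpen_lt_maximalFn volume (‖f ·‖ₑ) s) hΩ
  have : Countable u := hu.to_subtype
  have hK (i : u) : ∫⁻ z in Q i, ‖f z‖ₑ ≤ 25 ^ n * s * volume (Q i) := by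
    simpa only [finrank_euclideanSpace_fin] using
      hQ.setLIntegral_le (fun z hz => not_lt.1 hz) i
  simpa only [compl_ofPred, not_lt] using hC hQ hΩ f hfm hf s hs hs_top hK

end WeakType

section LtTwo

lemma sq_mul_setLIntegral_le_ofReal {p : ℝ} (hp : 1 < p) (hp2 : p < 2) (c : ℝ≥0∞) :
    c ^ 2 * ∫⁻ s in {s : ℝ | 0 < s ∧ c ≤ ENNReal.ofReal s}, ENNReal.ofReal (p * s ^ (p - 3)) ≤
      ENNReal.ofReal (p / (2 - p)) * c ^ p := by
  obtain rfl | hc_top := eq_or_ne c ∞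
  · simp
  lift c to NNReal using hc_top
  obtain rfl | hc := eq_zero_or_pos c
  · simp
  have hset : {s : ℝ | 0 < s ∧ (c : ℝ≥0∞) ≤ ENNReal.ofReal s} = Ici (c : ℝ) := by
    ext s
    refine ⟨fun h => (ENNReal.le_ofReal_iff_toReal_le ENNReal.coe_ne_top h.1.le).1 h.2, fun h => ?_⟩
    have hs : 0 < s := (NNReal.coe_pos.2 hc).trans_le h
    exact ⟨hs, (ENNReal.le_ofReal_iff_toReal_le ENNReal.coe_ne_top hs.le).2 h⟩
  have hint : ∫⁻ s in Ici (c : ℝ), ENNReal.ofReal (p * s ^ (p - 3)) =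
      ENNReal.ofReal (p / (2 - p) * (c : ℝ) ^ (p - 2)) := by
    simp_rw [ENNReal.ofReal_mul (zero_le_one.trans hp.le)]
    rw [lintegral_const_mul _ (by fun_prop), setLIntegral_congr Ioi_ae_eq_Ici.symm,
      lintegral_Ioi_rpow (by linarith) (NNReal.coe_pos.2 hc), ← ENNReal.ofReal_mul (by linarith)]
    congr 1
    rw [show p - 3 + 1 = -(2 - p) by ring, neg_div_neg_eq, neg_sub]
    ring
  rw [hset, hint, ENNReal.ofReal_mul (div_nonneg (by linarith) (by linarith)), mul_left_comm,
    ← ENNReal.ofReal_rpow_of_pos (NNReal.coe_pos.2 hc), ENNReal.ofReal_coe_nnreal,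
    ← ENNReal.rpow_ofNat, ← ENNReal.rpow_add _ _ (by simpa using hc.ne') ENNReal.coe_ne_top,
    add_sub_cancel]

lemma lintegral_Ioi_mul_setLIntegral_sq_le {X : Type*} [MeasurableSpace X] {μ : Measure X}
    [SFinite μ] {v h : X → ℝ≥0∞} {p : ℝ} (hp : 1 < p) (hp2 : p < 2) (hv : Measurable v)
    (hh : Measurable h) (hvh : ∀ᵐ x ∂μ, v x ≤ h x) :
    ∫⁻ s in Ioi (0 : ℝ), ENNReal.ofReal (p * s ^ (p - 3)) *
      ∫⁻ x in {x | h x ≤ ENNReal.ofReal s}, v x ^ 2 ∂μ ≤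
      ENNReal.ofReal (p / (2 - p)) * ∫⁻ x, v x ^ p ∂μ := by
  refine (lintegral_mul_setLIntegral_comm (S := {z : X × ℝ | h z.1 ≤ ENNReal.ofReal z.2})
    (hv.pow_const 2) (by fun_prop) (measurableSet_le (by fun_prop) (by fun_prop))).symm.trans_le ?_
  rw [← lintegral_const_mul _ (hv.pow_const p)]
  refine lintegral_mono_ae (hvh.mono fun x hx => ?_)
  simp only [mem_ofPred_eq]
  have hxm : MeasurableSet {s : ℝ | h x ≤ ENNReal.ofReal s} :=
    measurableSet_le measurable_const (by fun_prop)
  rw [Measure.restrict_restrict hxm]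
  have hsub : {s : ℝ | h x ≤ ENNReal.ofReal s} ∩ Ioi 0 ⊆ {s | 0 < s ∧ v x ≤ ENNReal.ofReal s} :=
    fun s hs => ⟨hs.2, hx.trans hs.1⟩
  exact (mul_le_mul_right (lintegral_mono_set hsub) _).trans
    (sq_mul_setLIntegral_le_ofReal hp hp2 (v x))

lemma measure_lt_ne_top_of_lintegral_rpow_ne_top {X : Type*} [MeasurableSpace X] {μ : Measure X}
    {h : X → ℝ≥0∞} (hh : Measurable h) {p : ℝ} (hp : 0 ≤ p) (hfin : ∫⁻ x, h x ^ p ∂μ ≠ ∞)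
    {s : ℝ≥0∞} (hs : s ≠ 0) (hs_top : s ≠ ∞) : μ {x | s < h x} ≠ ∞ := by
  have hsp : s ^ p ≠ 0 := (ENNReal.rpow_pos (pos_iff_ne_zero.2 hs) hs_top).ne'
  have hsub : {x | s < h x} ⊆ {x | s ^ p ≤ h x ^ p} := fun x hx => ENNReal.rpow_le_rpow hx.le hp
  exact ne_top_of_le_ne_top (ENNReal.div_ne_top hfin hsp) ((measure_mono hsub).trans
    (meas_ge_le_lintegral_div (hh.pow_const p).aemeasurable hsp (by finiteness)))

lemma ofReal_mul_rpow_sub_one_mul_inv_sq {p s : ℝ} (hp : 0 ≤ p) (hs : 0 < s) :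
    ENNReal.ofReal (p * s ^ (p - 1)) * (ENNReal.ofReal s ^ 2)⁻¹ =
      ENNReal.ofReal (p * s ^ (p - 3)) := by
  rw [← ENNReal.ofReal_pow hs.le, ← ENNReal.ofReal_inv_of_pos (by positivity),
    ← ENNReal.ofReal_mul (by positivity), show p - 3 = p - 1 - (2 : ℕ) by push_cast; ring,
    Real.rpow_sub_natCast hs.ne', mul_assoc, div_eq_mul_inv]

lemma lintegral_rpow_le_of_forall_measure_lt_le {X : Type*} [MeasurableSpace X] {μ : Measure X}
    [SFinite μ] {v h G : X → ℝ≥0∞} {p : ℝ} (hp : 1 < p) (hp2 : p < 2) (hv : Measurable v)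
    (hh : Measurable h) (hG : Measurable G) (hvh : ∀ᵐ x ∂μ, v x ≤ h x)
    (hfin : ∫⁻ x, h x ^ p ∂μ ≠ ∞) {C : ℝ≥0∞} (hC_top : C ≠ ∞)
    (hC : ∀ s : ℝ≥0∞, s ≠ 0 → s ≠ ∞ → μ {x | s < h x} ≠ ∞ →
      μ {x | s < G x} ≤
        C * ((s ^ 2)⁻¹ * (∫⁻ x in {x | h x ≤ s}, v x ^ 2 ∂μ) + μ {x | s < h x})) :
    ∫⁻ x, G x ^ p ∂μ ≤
      C * (ENNReal.ofReal (p / (2 - p)) * ∫⁻ x, v x ^ p ∂μ + ∫⁻ x, h x ^ p ∂μ) := by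
  have hp0 : 0 < p := by linarith
  have hlevel (s : ℝ) (hs : s ∈ Ioi (0 : ℝ)) :
      ENNReal.ofReal (p * s ^ (p - 1)) * μ {x | ENNReal.ofReal s < G x} ≤
      C * (ENNReal.ofReal (p * s ^ (p - 3)) *
        (∫⁻ x in {x | h x ≤ ENNReal.ofReal s}, v x ^ 2 ∂μ) +
        ENNReal.ofReal (p * s ^ (p - 1)) * μ {x | ENNReal.ofReal s < h x}) := by
    have hs0 : ENNReal.ofReal s ≠ 0 := (ENNReal.ofReal_pos.2 hs).ne'
    rw [← ofReal_mul_rpow_sub_one_mul_inv_sq hp0.le hs, mul_assoc, ← mul_add, mul_left_comm]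
    gcongr
    exact hC _ hs0 ENNReal.ofReal_ne_top
      (measure_lt_ne_top_of_lintegral_rpow_ne_top hh hp0.le hfin hs0 ENNReal.ofReal_ne_top)
  rw [lintegral_rpow_eq_lintegral_meas_lt hp0 hG]
  refine (setLIntegral_mono' measurableSet_Ioi hlevel).trans ?_
  have hmeas : Measurable fun s : ℝ =>
      ENNReal.ofReal (p * s ^ (p - 1)) * μ {x | ENNReal.ofReal s < h x} :=
    .mul (by fun_prop) (Antitone.measurable fun s s' hs => measure_mono fun x hx =>
      (ENNReal.ofReal_le_ofReal hs).trans_lt hx)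
  rw [lintegral_const_mul' _ _ hC_top, lintegral_add_right _ hmeas,
    ← lintegral_rpow_eq_lintegral_meas_lt hp0 hh]
  gcongr
  exact lintegral_Ioi_mul_setLIntegral_sq_le hp hp2 hv hh hvh

lemma exists_lintegral_gStar_rpow_le_of_lt_two (𝕜 : Type*) [RCLike 𝕜] {n : ℕ} {α lam p : ℝ}
    (hα : 0 < α) (hlam : 0 < (lam - 2) * n) (hp : 1 < p) (hp2 : p < 2) :
    ∃ C : ℝ≥0∞, C ≠ ∞ ∧ ∀ f : ℝ^n → 𝕜, StronglyMeasurable f → LocallyIntegrable f volume →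
      ∫⁻ x, gStar lam α f x ^ p ≤ C * ∫⁻ z, ‖f z‖ₑ ^ p := by
  obtain ⟨C, hC_top, hC⟩ := exists_volume_lt_gStar_le 𝕜 hα hlam
  obtain ⟨C', hC'_top, hC'⟩ := exists_lintegral_maximalFn_rpow_le (volume : Measure (ℝ^n)) hp
  have hp0 : 0 < p := by linarith
  refine ⟨2 ^ p * (C * (ENNReal.ofReal (p / (2 - p)) + C')) + 1, by finiteness, fun f hfm hf => ?_⟩
  obtain hI | hI := eq_or_ne (∫⁻ z, ‖f z‖ₑ ^ p) ∞
  · rw [hI, ENNReal.mul_top (by simp)]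
    exact le_top
  set M := maximalFn volume (‖f ·‖ₑ)
  have hM : Measurable M := measurable_maximalFn _ _
  have hMp : ∫⁻ x, M x ^ p ≤ C' * ∫⁻ z, ‖f z‖ₑ ^ p := hC' _ hfm.enorm
  have hfM : ∀ᵐ z, ‖f z‖ₑ ≤ M z := ae_le_maximalFn hfm.enorm fun r =>
    ne_top_of_le_ne_top (lintegral_closedBall_ne_top hf 0 r)
      (lintegral_mono_set ball_subset_closedBall)
  have hhalf : ∫⁻ x, (gStar lam α f x / 2) ^ p ≤
      C * (ENNReal.ofReal (p / (2 - p)) * (∫⁻ z, ‖f z‖ₑ ^ p) + ∫⁻ x, M x ^ p) := by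
    refine lintegral_rpow_le_of_forall_measure_lt_le hp hp2 hfm.enorm hM
      ((measurable_gStar hα lam hf).div_const 2) hfM
      (ne_top_of_le_ne_top (ENNReal.mul_ne_top hC'_top hI) hMp) hC_top fun s hs hs_top hfin => ?_
    simp only [ENNReal.lt_div_iff_mul_lt (.inl two_ne_zero) (.inl ENNReal.ofNat_ne_top),
      mul_comm s 2]
    exact hC f hfm hf s hs hs_top hfin
  calc ∫⁻ x, gStar lam α f x ^ p = 2 ^ p * ∫⁻ x, (gStar lam α f x / 2) ^ p := by
        rw [← lintegral_const_mul' _ _ (by finiteness)]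
        refine lintegral_congr fun x => ?_
        rw [← ENNReal.mul_rpow_of_nonneg _ _ hp0.le, ENNReal.mul_div_cancel (by simp) (by simp)]
    _ ≤ 2 ^ p * (C * (ENNReal.ofReal (p / (2 - p)) * (∫⁻ z, ‖f z‖ₑ ^ p) +
          C' * ∫⁻ z, ‖f z‖ₑ ^ p)) := by
        gcongr
        exact hhalf.trans (by gcongr)
    _ ≤ _ := by
        rw [← add_mul, ← mul_assoc, ← mul_assoc, add_mul _ 1, mul_assoc (2 ^ p)]
        exact le_self_add

lemma exists_lintegral_gStar_rpow_le (𝕜 : Type*) [RCLike 𝕜] {n : ℕ} {α lam p : ℝ} (hα : 0 < α)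
    (hlam : 0 < (lam - 2) * n) (hp : 1 < p) :
    ∃ C : ℝ≥0∞, C ≠ ∞ ∧ ∀ f : ℝ^n → 𝕜, LocallyIntegrable f volume →
      ∫⁻ x, gStar lam α f x ^ p ≤ C * ∫⁻ z, ‖f z‖ₑ ^ p := by
  obtain ⟨C, hC_top, hC⟩ : ∃ C : ℝ≥0∞, C ≠ ∞ ∧ ∀ f : ℝ^n → 𝕜, StronglyMeasurable f →
      LocallyIntegrable f volume → ∫⁻ x, gStar lam α f x ^ p ≤ C * ∫⁻ z, ‖f z‖ₑ ^ p := by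
    obtain hp2 | hp2 := lt_or_ge p 2
    · exact exists_lintegral_gStar_rpow_le_of_lt_two 𝕜 hα hlam hp hp2
    · exact exists_lintegral_gStar_rpow_le_of_two_le 𝕜 hα
        (by nlinarith [n.cast_nonneg (α := ℝ)]) hp2
  refine ⟨C, hC_top, fun f hf => ?_⟩
  obtain ⟨f', hfm', hff'⟩ := hf.aestronglyMeasurable
  have hg : ∫⁻ x, gStar lam α f x ^ p = ∫⁻ x, gStar lam α f' x ^ p :=
    lintegral_congr fun x => by rw [gStar_congr hff' x]
  have hn : ∫⁻ z, ‖f z‖ₑ ^ p = ∫⁻ z, ‖f' z‖ₑ ^ p :=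
    lintegral_congr_ae (hff'.mono fun z hz => by simp only [hz])
  rw [hg, hn]
  exact hC f' hfm' (hf.congr hff')

end LtTwo

/-! ### Generalized Morrey spaces -/

section Morrey

variable {n : ℕ} {p D : ℝ} {Φ : ℝ → ℝ} {x₀ : ℝ^n} {r : ℝ}

lemma lintegral_ball_rpow_le_morreyNorm {ε : Type*} [ENorm ε] (hp : 0 < p) (f : ℝ^n → ε)
    (x₀ : ℝ^n) (hr : 0 < r) (hΦ : 0 < Φ r) :
    ∫⁻ x in ball x₀ r, ‖f x‖ₑ ^ p ≤ morreyNorm p Φ f ^ p * ENNReal.ofReal (Φ r) := by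
  have hΦ0 : ENNReal.ofReal (Φ r) ≠ 0 := (ENNReal.ofReal_pos.2 hΦ).ne'
  rw [← ENNReal.div_le_iff hΦ0 ENNReal.ofReal_ne_top, ← ENNReal.rpow_inv_le_iff hp]
  refine le_sInf fun C hC => ?_
  rw [ENNReal.rpow_inv_le_iff hp, ENNReal.div_le_iff hΦ0 ENNReal.ofReal_ne_top]
  exact hC x₀ r hr

lemma lintegral_le_lintegral_rpow_mul_measure_univ {X : Type*} [MeasurableSpace X] {μ : Measure X}
    (hp : 1 < p) {g : X → ℝ≥0∞} (hg : AEMeasurable g μ) :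
    ∫⁻ x, g x ∂μ ≤ (∫⁻ x, g x ^ p ∂μ) ^ p⁻¹ * μ univ ^ (1 - p⁻¹) := by
  have hpq := Real.HolderConjugate.conjExponent hp
  have h := ENNReal.lintegral_mul_le_Lp_mul_Lq μ hpq hg (g := fun _ => 1) aemeasurable_const
  simpa only [Pi.mul_apply, mul_one, ENNReal.one_rpow, lintegral_one, one_div,
    eq_sub_of_add_eq' hpq.inv_add_inv_eq_one] using h

lemma lintegral_ball_le_morreyNorm {ε : Type*} [ENorm ε] (hp : 1 < p) {f : ℝ^n → ε}
    (hf : AEMeasurable (‖f ·‖ₑ)) (x₀ : ℝ^n) (hr : 0 < r) (hΦ : 0 < Φ r) :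
    ∫⁻ x in ball x₀ r, ‖f x‖ₑ ≤
      morreyNorm p Φ f * (ENNReal.ofReal (Φ r) / volume (ball x₀ r)) ^ p⁻¹ *
        volume (ball x₀ r) := by
  have hp0 : 0 < p := zero_lt_one.trans hp
  have hv : volume (ball x₀ r) ≠ 0 := (measure_ball_pos volume x₀ hr).ne'
  calc ∫⁻ x in ball x₀ r, ‖f x‖ₑ
      ≤ (∫⁻ x in ball x₀ r, ‖f x‖ₑ ^ p) ^ p⁻¹ * volume (ball x₀ r) ^ (1 - p⁻¹) := by
        simpa only [Measure.restrict_apply_univ] using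
          lintegral_le_lintegral_rpow_mul_measure_univ hp hf.restrict
    _ ≤ (morreyNorm p Φ f ^ p * ENNReal.ofReal (Φ r)) ^ p⁻¹ *
          volume (ball x₀ r) ^ (1 - p⁻¹) := by
        gcongr
        exact lintegral_ball_rpow_le_morreyNorm hp0 f x₀ hr hΦ
    _ = _ := by
        rw [ENNReal.mul_rpow_of_nonneg _ _ (inv_nonneg.2 hp0.le), ENNReal.rpow_rpow_inv hp0.ne',
          ENNReal.div_rpow_of_nonneg _ _ (inv_nonneg.2 hp0.le),
          ENNReal.rpow_sub _ _ hv measure_ball_lt_top.ne, ENNReal.rpow_one, div_eq_mul_inv,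
          div_eq_mul_inv]
        ring

lemma locallyIntegrable_of_morreyNorm_lt_top {ε : Type*} [TopologicalSpace ε] [ContinuousENorm ε]
    (hp : 1 < p) (hΦ : 0 < Φ 1) {f : ℝ^n → ε} (hf : AEStronglyMeasurable f)
    (h : morreyNorm p Φ f < ∞) : LocallyIntegrable f := by
  refine fun x => ⟨ball x 1, ball_mem_nhds x one_pos, hf.restrict, ?_⟩
  have hv : volume (ball x 1) ≠ 0 := (measure_ball_pos volume x one_pos).ne'
  refine (lintegral_ball_le_morreyNorm hp hf.enorm x one_pos hΦ).trans_lt ?_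
  have hp0 : 0 ≤ p⁻¹ := inv_nonneg.2 (zero_le_one.trans hp.le)
  finiteness [measure_ball_lt_top (μ := volume) (x := x) (r := 1)]

lemma IsDoublingConst.lintegral_indicator_ball_two_mul_rpow_le {E : Type*}
    [NormedAddCommGroup E] (hD : IsDoublingConst Φ D) (hp : 0 < p) (f : ℝ^n → E) (x₀ : ℝ^n)
    (hr : 0 < r) (hΦ : 0 < Φ (2 * r)) :
    ∫⁻ x, ‖(ball x₀ (2 * r)).indicator f x‖ₑ ^ p ≤
      morreyNorm p Φ f ^ p * ENNReal.ofReal (D * Φ r) := by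
  have hind (x : ℝ^n) : ‖(ball x₀ (2 * r)).indicator f x‖ₑ ^ p =
      (ball x₀ (2 * r)).indicator (‖f ·‖ₑ ^ p) x := by
    by_cases hx : x ∈ ball x₀ (2 * r) <;> simp [hx, hp]
  rw [lintegral_congr hind, lintegral_indicator measurableSet_ball]
  refine (lintegral_ball_rpow_le_morreyNorm hp f x₀ (by positivity) hΦ).trans ?_
  gcongr
  exact hD.2 r hr

lemma volume_ball_two_mul (x₀ : ℝ^n) (r : ℝ) :
    volume (ball x₀ (2 * r)) = 2 ^ n * volume (ball x₀ r) := by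
  rw [Measure.addHaar_ball_mul_of_pos _ _ two_pos, finrank_euclideanSpace_fin,
    ENNReal.ofReal_pow zero_le_two, ENNReal.ofReal_ofNat, ← Measure.addHaar_ball_center volume x₀]

lemma IsDoublingConst.growth_div_volume_le (hD : IsDoublingConst Φ D) (x₀ : ℝ^n) (hr : 0 < r)
    (k : ℕ) :
    ENNReal.ofReal (Φ (2 ^ k * r)) / volume (ball x₀ (2 ^ k * r)) ≤
      (ENNReal.ofReal D / 2 ^ n) ^ k * (ENNReal.ofReal (Φ r) / volume (ball x₀ r)) := by
  induction k with
  | zero => simp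
  | succ k ih =>
    have hΦ : Φ (2 * (2 ^ k * r)) ≤ D * Φ (2 ^ k * r) := hD.2 _ (by positivity)
    calc ENNReal.ofReal (Φ (2 ^ (k + 1) * r)) / volume (ball x₀ (2 ^ (k + 1) * r))
        ≤ ENNReal.ofReal (D * Φ (2 ^ k * r)) / (2 ^ n * volume (ball x₀ (2 ^ k * r))) := by
          rw [pow_succ', mul_assoc, volume_ball_two_mul]
          gcongr
      _ = ENNReal.ofReal D / 2 ^ n *
            (ENNReal.ofReal (Φ (2 ^ k * r)) / volume (ball x₀ (2 ^ k * r))) := by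
          rw [ENNReal.ofReal_mul (zero_le_one.trans hD.1), ENNReal.mul_div_mul_comm (by simp)
            (by simp)]
      _ ≤ _ := by
          rw [pow_succ', mul_assoc]
          gcongr

/-- The ball `B(x₀, 2r)` for `k = 0`, and the dyadic annulus
`B(x₀, 2 ^ (k + 1) * r) \ B(x₀, 2 ^ k * r)` for `k > 0`. -/
def dyadicAnnulus (x₀ : ℝ^n) (r : ℝ) (k : ℕ) : Set (ℝ^n) :=
  disjointed (fun k => ball x₀ (2 ^ (k + 1) * r)) k

lemma measurableSet_dyadicAnnulus (x₀ : ℝ^n) (r : ℝ) (k : ℕ) :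
    MeasurableSet (dyadicAnnulus x₀ r k) :=
  MeasurableSet.disjointed (fun _ => measurableSet_ball) k

lemma dyadicAnnulus_zero (x₀ : ℝ^n) (r : ℝ) : dyadicAnnulus x₀ r 0 = ball x₀ (2 * r) := by
  rw [dyadicAnnulus, disjointed_zero, zero_add, pow_one]

lemma dyadicAnnulus_subset_ball (x₀ : ℝ^n) (r : ℝ) (k : ℕ) :
    dyadicAnnulus x₀ r k ⊆ ball x₀ (2 ^ (k + 1) * r) :=
  disjointed_subset _ k

lemma disjoint_dyadicAnnulus_succ_ball (x₀ : ℝ^n) (r : ℝ) (k : ℕ) :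
    Disjoint (dyadicAnnulus x₀ r (k + 1)) (ball x₀ (2 ^ (k + 1) * r)) := by
  have h := disjointed_succ (fun k => ball x₀ (2 ^ (k + 1) * r)) (not_isMax k)
  rw [Order.succ_eq_add_one] at h
  rw [dyadicAnnulus, h]
  exact disjoint_sdiff_left.mono_right (le_partialSups (fun k => ball x₀ (2 ^ (k + 1) * r)) k)

lemma disjoint_dyadicAnnulus_succ_ball_of_mem_ball {x : ℝ^n} (hx : x ∈ ball x₀ r) (k : ℕ) :
    Disjoint (dyadicAnnulus x₀ r (k + 1)) (ball x (2 ^ k * r)) := by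
  refine (disjoint_dyadicAnnulus_succ_ball x₀ r k).mono_right (ball_subset_ball' ?_)
  have hr : r ≤ 2 ^ k * r :=
    le_mul_of_one_le_left (pos_of_mem_ball hx).le (one_le_pow₀ one_le_two)
  rw [pow_succ]
  linarith [mem_ball.1 hx]

lemma iUnion_dyadicAnnulus (x₀ : ℝ^n) (hr : 0 < r) : ⋃ k, dyadicAnnulus x₀ r k = univ := by
  refine iUnion_disjointed.trans (eq_univ_of_forall fun z => mem_iUnion.2 ?_)
  obtain ⟨k, hk⟩ := pow_unbounded_of_one_lt (dist z x₀ / r) one_lt_two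
  refine ⟨k, mem_ball.2 (((div_lt_iff₀ hr).1 hk).trans_le ?_)⟩
  gcongr
  exacts [one_le_two, k.le_succ]

end Morrey

section MorreyBound

variable {𝕜 : Type*} [RCLike 𝕜] {n : ℕ} {α lam p D : ℝ} {Φ : ℝ → ℝ} {f : ℝ^n → 𝕜} {x₀ : ℝ^n}
  {r : ℝ}

lemma gStar_le_tsum_indicator {ι : Type*} [Countable ι] (hα : 0 < α)
    (hf : LocallyIntegrable f volume) {S : ι → Set (ℝ^n)} (hSm : ∀ i, MeasurableSet (S i))
    (hS : Pairwise (Function.onFun Disjoint S)) (hSU : ⋃ i, S i = univ) (x : ℝ^n) :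
    gStar lam α f x ≤ ∑' i, gStar lam α ((S i).indicator f) x := by
  refine gStar_le_tsum hα (fun i => hf.indicator (hSm i)) (.of_forall fun z => ?_)
    (fun y t => ?_) x
  · obtain ⟨i, hi⟩ := mem_iUnion.1 (hSU ▸ mem_univ z)
    rw [← indicator_of_mem hi f]
    exact hasSum_single i fun j hj =>
      indicator_of_notMem (fun h => disjoint_left.1 (hS hj) h hi) f
  · have hpiece (i : ι) : ∫⁻ z in closedBall y t, ‖(S i).indicator f z‖ₑ =
        ∫⁻ z in S i, ‖f z‖ₑ ∂volume.restrict (closedBall y t) := by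
      simp only [enorm_indicator_eq_indicator_enorm, lintegral_indicator (hSm i)]
    rw [tsum_congr hpiece, ← lintegral_iUnion hSm hS, hSU, Measure.restrict_univ]
    exact lintegral_closedBall_ne_top hf y t

lemma exists_gStar_le_of_eq_zero_on_ball (𝕜 : Type*) [RCLike 𝕜] (hα : 0 < α)
    (hlam : 0 < (lam - 2) * n) :
    ∃ C : ℝ≥0∞, C ≠ ∞ ∧ ∀ f : ℝ^n → 𝕜, LocallyIntegrable f volume → ∀ (x : ℝ^n) (R : ℝ), 0 < R →
      (∀ z ∈ ball x R, f z = 0) →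
      gStar lam α f x ≤ C * (volume (ball x R))⁻¹ * ∫⁻ z, ‖f z‖ₑ := by
  obtain ⟨C, hC_top, hC⟩ := exists_gStar_le_of_decay 𝕜 hα le_rfl (by rwa [mul_zero])
  set v := volume (ball (0 : ℝ^n) 1)
  have hv_top : v ≠ ∞ := measure_ball_lt_top.ne
  have hv0 : v ≠ 0 := (measure_ball_pos volume _ one_pos).ne'
  refine ⟨C * (ENNReal.ofReal (2 ^ α) * (1 + v)) * v, by finiteness,
    fun f hf x R hR hzero => ?_⟩
  have hRn : ENNReal.ofReal (R ^ (-n - 0 : ℝ)) = v * (volume (ball x R))⁻¹ := by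
    rw [Measure.addHaar_ball_of_pos _ _ hR, finrank_euclideanSpace_fin,
      ENNReal.mul_inv (.inr hv_top) (.inr hv0), mul_left_comm, ENNReal.mul_inv_cancel hv0 hv_top,
      mul_one, sub_zero, Real.rpow_neg hR.le, Real.rpow_natCast,
      ENNReal.ofReal_inv_of_pos (by positivity)]
  refine (hC f hf x R (ENNReal.ofReal (2 ^ α) * (1 + v) * ∫⁻ z, ‖f z‖ₑ) hR
    (fun y t ht => ?_) (fun t ht => ?_) fun y t ht hty => ?_).trans_eq ?_
  · refine (maximalConv_le hα f y ht).trans ?_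
    rw [sub_zero, Real.rpow_neg ht.le, Real.rpow_natCast, ENNReal.ofReal_mul (by positivity),
      mul_right_comm]
    gcongr
    exacts [le_mul_of_one_le_right' le_self_add, Measure.restrict_le_self]
  · rw [neg_zero, Real.rpow_zero, ENNReal.ofReal_one, mul_one]
    refine (lintegral_maximalConv_le hα hf.aestronglyMeasurable ht).trans ?_
    gcongr
    exact le_add_self
  · refine maximalConv_eq_zero ht fun z hz => hzero z ?_
    rw [← dist_eq_norm'] at hty
    exact mem_ball.2 ((dist_triangle z y x).trans_lt (by linarith [mem_closedBall.1 hz]))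
  · rw [hRn]
    ring

lemma exists_gStar_indicator_dyadicAnnulus_le_setLIntegral (𝕜 : Type*) [RCLike 𝕜] (hα : 0 < α)
    (hlam : 0 < (lam - 2) * n) :
    ∃ C : ℝ≥0∞, C ≠ ∞ ∧ ∀ f : ℝ^n → 𝕜, LocallyIntegrable f volume →
      ∀ (x₀ : ℝ^n) (r : ℝ), ∀ x ∈ ball x₀ r, ∀ k : ℕ,
      gStar lam α ((dyadicAnnulus x₀ r (k + 1)).indicator f) x ≤
        C * (volume (ball x₀ (2 ^ (k + 2) * r)))⁻¹ *
          ∫⁻ z in ball x₀ (2 ^ (k + 2) * r), ‖f z‖ₑ := by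
  obtain ⟨C, hC_top, hC⟩ := exists_gStar_le_of_eq_zero_on_ball (n := n) 𝕜 hα hlam
  refine ⟨C * (2 ^ n * 2 ^ n), by finiteness, fun f hf x₀ r x hx k => ?_⟩
  have hr : 0 < r := pos_of_mem_ball hx
  have hzero (z : ℝ^n) (hz : z ∈ ball x (2 ^ k * r)) :
      (dyadicAnnulus x₀ r (k + 1)).indicator f z = 0 :=
    indicator_of_notMem
      (disjoint_right.1 (disjoint_dyadicAnnulus_succ_ball_of_mem_ball hx k) hz) f
  have hmass : ∫⁻ z, ‖(dyadicAnnulus x₀ r (k + 1)).indicator f z‖ₑ ≤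
      ∫⁻ z in ball x₀ (2 ^ (k + 2) * r), ‖f z‖ₑ := by
    simp only [enorm_indicator_eq_indicator_enorm]
    rw [lintegral_indicator (measurableSet_dyadicAnnulus x₀ r _)]
    exact lintegral_mono_set (dyadicAnnulus_subset_ball x₀ r _)
  have hvol : volume (ball x₀ (2 ^ (k + 2) * r)) =
      2 ^ n * 2 ^ n * volume (ball x (2 ^ k * r)) := by
    rw [pow_succ', pow_succ', mul_assoc, mul_assoc, volume_ball_two_mul, volume_ball_two_mul,
      mul_assoc, Measure.addHaar_ball_center, Measure.addHaar_ball_center volume x]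
  have hinv : 2 ^ n * 2 ^ n * (volume (ball x₀ (2 ^ (k + 2) * r)))⁻¹ =
      (volume (ball x (2 ^ k * r)))⁻¹ := by
    rw [hvol, ENNReal.mul_inv (.inr measure_ball_lt_top.ne)
      (.inr (measure_ball_pos volume x (by positivity)).ne'),
      ENNReal.mul_inv_cancel_left (by simp) (by finiteness)]
  rw [mul_assoc C, hinv]
  exact (hC _ (hf.indicator (measurableSet_dyadicAnnulus x₀ r _)) x _ (by positivity) hzero).trans
    (by gcongr)

lemma exists_gStar_indicator_dyadicAnnulus_le (𝕜 : Type*) [RCLike 𝕜] (hα : 0 < α)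
    (hlam : 0 < (lam - 2) * n) (hp : 1 < p) (hΦ : ∀ r, 0 < r → 0 < Φ r)
    (hD : IsDoublingConst Φ D) :
    ∃ C : ℝ≥0∞, C ≠ ∞ ∧ ∀ f : ℝ^n → 𝕜, LocallyIntegrable f volume →
      ∀ (x₀ : ℝ^n) (r : ℝ), ∀ x ∈ ball x₀ r, ∀ k : ℕ,
      gStar lam α ((dyadicAnnulus x₀ r (k + 1)).indicator f) x ≤
        C * morreyNorm p Φ f * (ENNReal.ofReal (Φ r) / volume (ball x₀ r)) ^ p⁻¹ *
          ((ENNReal.ofReal D / 2 ^ n) ^ p⁻¹) ^ (k + 2) := by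
  obtain ⟨C, hC_top, hC⟩ :=
    exists_gStar_indicator_dyadicAnnulus_le_setLIntegral (n := n) 𝕜 hα hlam
  refine ⟨C, hC_top, fun f hf x₀ r x hx k => ?_⟩
  have hr : 0 < r := pos_of_mem_ball hx
  have hp' : 0 ≤ p⁻¹ := inv_nonneg.2 (zero_le_one.trans hp.le)
  set N := morreyNorm p Φ f
  set R := 2 ^ (k + 2) * r
  have hR : 0 < R := by positivity
  calc gStar lam α ((dyadicAnnulus x₀ r (k + 1)).indicator f) x
      ≤ C * (volume (ball x₀ R))⁻¹ * ∫⁻ z in ball x₀ R, ‖f z‖ₑ := hC f hf x₀ r x hx k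
    _ ≤ C * (volume (ball x₀ R))⁻¹ *
          (N * (ENNReal.ofReal (Φ R) / volume (ball x₀ R)) ^ p⁻¹ * volume (ball x₀ R)) := by
        gcongr
        exact lintegral_ball_le_morreyNorm hp hf.aestronglyMeasurable.enorm x₀ hR (hΦ R hR)
    _ = C * N * (ENNReal.ofReal (Φ R) / volume (ball x₀ R)) ^ p⁻¹ := by
        rw [← mul_one (C * N), ← ENNReal.inv_mul_cancel (measure_ball_pos volume x₀ hR).ne'
          measure_ball_lt_top.ne]
        ring
    _ ≤ C * N * ((ENNReal.ofReal D / 2 ^ n) ^ (k + 2) *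
          (ENNReal.ofReal (Φ r) / volume (ball x₀ r))) ^ p⁻¹ := by
        gcongr
        exact hD.growth_div_volume_le x₀ hr _
    _ = _ := by
        rw [ENNReal.mul_rpow_of_nonneg _ _ hp', ← ENNReal.rpow_natCast_mul,
          ← ENNReal.rpow_mul_natCast, mul_comm p⁻¹]
        ring

lemma exists_gStar_le_gStar_indicator_add (𝕜 : Type*) [RCLike 𝕜] (hα : 0 < α)
    (hlam : 0 < (lam - 2) * n) (hp : 1 < p) (hΦ : ∀ r, 0 < r → 0 < Φ r)
    (hD : IsDoublingConst Φ D) (hDn : D < 2 ^ n) :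
    ∃ C : ℝ≥0∞, C ≠ ∞ ∧ ∀ f : ℝ^n → 𝕜, LocallyIntegrable f volume →
      ∀ (x₀ : ℝ^n) (r : ℝ), ∀ x ∈ ball x₀ r,
      gStar lam α f x ≤ gStar lam α ((ball x₀ (2 * r)).indicator f) x +
        C * morreyNorm p Φ f * (ENNReal.ofReal (Φ r) / volume (ball x₀ r)) ^ p⁻¹ := by
  obtain ⟨C, hC_top, hC⟩ := exists_gStar_indicator_dyadicAnnulus_le (n := n) 𝕜 hα hlam hp hΦ hD
  set ρ := (ENNReal.ofReal D / 2 ^ n) ^ p⁻¹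
  have hρ : ρ < 1 := by
    refine ENNReal.rpow_lt_one (ENNReal.div_lt_of_lt_mul ?_) (inv_pos.2 (zero_lt_one.trans hp))
    rw [one_mul, ← ENNReal.ofReal_ofNat, ← ENNReal.ofReal_pow zero_le_two]
    exact ENNReal.ofReal_lt_ofReal_iff (by positivity) |>.2 hDn
  have hgeom : (1 - ρ)⁻¹ ≠ ∞ := ENNReal.inv_ne_top.2 (tsub_pos_of_lt hρ).ne'
  refine ⟨C * (ρ ^ 2 * (1 - ρ)⁻¹), by finiteness, fun f hf x₀ r x hx => ?_⟩
  have hr : 0 < r := pos_of_mem_ball hx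
  set b := morreyNorm p Φ f * (ENNReal.ofReal (Φ r) / volume (ball x₀ r)) ^ p⁻¹
  refine (gStar_le_tsum_indicator hα hf (measurableSet_dyadicAnnulus x₀ r) (disjoint_disjointed _)
    (iUnion_dyadicAnnulus x₀ hr) x).trans ?_
  rw [tsum_eq_zero_add' ENNReal.summable, dyadicAnnulus_zero]
  gcongr
  refine (ENNReal.tsum_le_tsum fun k => hC f hf x₀ r x hx k).trans_eq ?_
  simp_rw [pow_add]
  rw [ENNReal.tsum_mul_left, ENNReal.tsum_mul_right, ENNReal.tsum_geometric]
  ring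

lemma exists_lintegral_ball_gStar_rpow_le (𝕜 : Type*) [RCLike 𝕜] (hα : 0 < α)
    (hlam : 0 < (lam - 2) * n) (hp : 1 < p) (hΦ : ∀ r, 0 < r → 0 < Φ r)
    (hD : IsDoublingConst Φ D) (hDn : D < 2 ^ n) :
    ∃ C : ℝ≥0∞, C ≠ ∞ ∧ ∀ f : ℝ^n → 𝕜, LocallyIntegrable f volume →
      ∀ (x₀ : ℝ^n) (r : ℝ), 0 < r →
      ∫⁻ x in ball x₀ r, gStar lam α f x ^ p ≤
        C * morreyNorm p Φ f ^ p * ENNReal.ofReal (Φ r) := by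
  have hp0 : 0 < p := zero_lt_one.trans hp
  obtain ⟨C, hC_top, hC⟩ := exists_lintegral_gStar_rpow_le (n := n) 𝕜 hα hlam hp
  obtain ⟨K, hK_top, hK⟩ := exists_gStar_le_gStar_indicator_add (n := n) 𝕜 hα hlam hp hΦ hD hDn
  refine ⟨2 ^ (p - 1) * (C * ENNReal.ofReal D + K ^ p), by finiteness, fun f hf x₀ r hr => ?_⟩
  set N := morreyNorm p Φ f
  set g := gStar lam α ((ball x₀ (2 * r)).indicator f)
  set T := K * N * (ENNReal.ofReal (Φ r) / volume (ball x₀ r)) ^ p⁻¹ with hT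
  have hlocal : ∫⁻ x, g x ^ p ≤ C * (N ^ p * ENNReal.ofReal (D * Φ r)) := by
    refine (hC _ (hf.indicator measurableSet_ball)).trans ?_
    gcongr C * ?_
    exact hD.lintegral_indicator_ball_two_mul_rpow_le hp0 f x₀ hr (hΦ _ (by positivity))
  have htail : T ^ p * volume (ball x₀ r) = K ^ p * N ^ p * ENNReal.ofReal (Φ r) := by
    rw [hT, ENNReal.mul_rpow_of_nonneg _ _ hp0.le, ENNReal.mul_rpow_of_nonneg _ _ hp0.le,
      ENNReal.rpow_inv_rpow hp0.ne', mul_assoc,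
      ENNReal.div_mul_cancel (measure_ball_pos volume x₀ hr).ne' measure_ball_lt_top.ne]
  calc ∫⁻ x in ball x₀ r, gStar lam α f x ^ p
      ≤ ∫⁻ x in ball x₀ r, 2 ^ (p - 1) * (g x ^ p + T ^ p) :=
        setLIntegral_mono' measurableSet_ball fun x hx =>
          (ENNReal.rpow_le_rpow (hK f hf x₀ r x hx) hp0.le).trans
            (ENNReal.rpow_add_le_mul_rpow_add_rpow _ _ hp.le)
    _ = 2 ^ (p - 1) * ((∫⁻ x in ball x₀ r, g x ^ p) + T ^ p * volume (ball x₀ r)) := by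
        rw [lintegral_const_mul' _ _ (by finiteness), lintegral_add_right _ measurable_const,
          setLIntegral_const]
    _ ≤ 2 ^ (p - 1) * (C * (N ^ p * ENNReal.ofReal (D * Φ r)) +
          K ^ p * N ^ p * ENNReal.ofReal (Φ r)) := by
        rw [htail]
        gcongr
        exact (setLIntegral_le_lintegral _ _).trans hlocal
    _ = _ := by
        rw [ENNReal.ofReal_mul (zero_le_one.trans hD.1)]
        ring

lemma exists_morreyNorm_gStar_le (𝕜 : Type*) [RCLike 𝕜] (hα : 0 < α)
    (hlam : 0 < (lam - 2) * n) (hp : 1 < p) (hΦ : ∀ r, 0 < r → 0 < Φ r)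
    (hD : IsDoublingConst Φ D) (hDn : D < 2 ^ n) :
    ∃ C : ℝ≥0∞, C ≠ ∞ ∧ ∀ f : ℝ^n → 𝕜, LocallyIntegrable f volume →
      morreyNorm p Φ (gStar lam α f) ≤ C * morreyNorm p Φ f := by
  have hp0 : 0 < p := zero_lt_one.trans hp
  obtain ⟨C, hC_top, hC⟩ := exists_lintegral_ball_gStar_rpow_le 𝕜 hα hlam hp hΦ hD hDn
  refine ⟨C ^ p⁻¹, by finiteness, fun f hf => sInf_le fun x₀ r hr => ?_⟩
  rw [ENNReal.mul_rpow_of_nonneg _ _ hp0.le, ENNReal.rpow_inv_rpow hp0.ne']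
  exact hC f hf x₀ r hr

end MorreyBound

end IntrinsicSquare

end

theorem theorem1p4_general {𝕜 : Type*} [RCLike 𝕜] (n : ℕ) (α p lam : ℝ)
    (hα : 0 < α) (hp : 1 < p) (hlam : 2 < lam) (Φ : ℝ → ℝ) (hΦ : ∀ r, 0 < r → 0 < Φ r)
    (D : ℝ) (hD : IntrinsicSquare.IsDoublingConst Φ D) (hDn : D < 2 ^ n) :
    ∃ C : ℝ, 0 < C ∧
      ∀ f : EuclideanSpace ℝ (Fin n) → 𝕜, IntrinsicSquare.MemMorrey p Φ f →
        IntrinsicSquare.MemMorrey p Φ (IntrinsicSquare.gStar lam α f) ∧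
        IntrinsicSquare.morreyNorm p Φ (IntrinsicSquare.gStar lam α f) ≤
          ENNReal.ofReal C * IntrinsicSquare.morreyNorm p Φ f := by
  have hn : n ≠ 0 := by
    rintro rfl
    exact absurd hD.1 (by simpa using hDn)
  have hlam' : 0 < (lam - 2) * n := mul_pos (by linarith) (by positivity)
  obtain ⟨C, hC_top, hC⟩ :=
    IntrinsicSquare.exists_morreyNorm_gStar_le 𝕜 hα hlam' hp hΦ hD hDn
  refine ⟨C.toReal + 1, by positivity, fun f hf => ?_⟩
  have hC' : C ≤ ENNReal.ofReal (C.toReal + 1) :=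
    (ENNReal.le_ofReal_iff_toReal_le hC_top (by positivity)).2 (lt_add_one _).le
  have hnorm := (hC f hf.1).trans (mul_le_mul_left hC' (IntrinsicSquare.morreyNorm p Φ f))
  have hfin := hnorm.trans_lt (ENNReal.mul_lt_top ENNReal.ofReal_lt_top hf.2)
  exact ⟨⟨IntrinsicSquare.locallyIntegrable_of_morreyNorm_lt_top hp (hΦ 1 one_pos)
    (IntrinsicSquare.measurable_gStar hα lam hf.1).aestronglyMeasurable hfin, hfin⟩, hnorm⟩

theorem theorem1p4 {𝕜 : Type*} [RCLike 𝕜] (n : ℕ) (α p lam : ℝ)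
    (hα0 : 0 < α) (hα1 : α ≤ 1) (hp : 1 < p) (hlam : 3 < lam)
    (Φ : ℝ → ℝ) (hΦ : IntrinsicSquare.IsGrowthFunction Φ)
    (D : ℝ) (hD : IntrinsicSquare.IsDoublingConst Φ D) (hDn : D < 2 ^ n) :
    ∃ C : ℝ, 0 < C ∧
      ∀ f : EuclideanSpace ℝ (Fin n) → 𝕜, IntrinsicSquare.MemMorrey p Φ f →
        IntrinsicSquare.MemMorrey p Φ (IntrinsicSquare.gStar lam α f) ∧
        IntrinsicSquare.morreyNorm p Φ (IntrinsicSquare.gStar lam α f) ≤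
          ENNReal.ofReal C * IntrinsicSquare.morreyNorm p Φ f :=
  theorem1p4_general n α p lam hα0 hp (by linarith) Φ hΦ.pos D hD hDn
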